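/- **Conventions.** $\mathcal S_{\mathrm{sk}}$ is the category whose objects are the finite totally ordered sets $\{1,\dots,n\}$, $n\ge 0$, and whose morphisms are all maps. A fibre $\phi^{-1}j$ of a map $\phi:I\to J$ in $\mathcal S_{\mathrm{sk}}$, and the lexicographically ordered disjoint union $\bigsqcup_{i\in I}S_i$, are identified with objects of $\mathcal S_{\mathrm{sk}}$ by the increasing enumeration. For a set $S$, $S^*$ is the free monoid of words $(X_i)_{i\in I}$, $I\in\mathcal S_{\mathrm{sk}}$, and $\bigsqcup$ denotes the concatenation of a family of words. Compositions are written so that $\psi\phi$ means first $\phi$, then $\psi$. **Symmetric weak multicategories.** A symmetric weak multicategory $\mathbf C$ consists of a set $\mathrm{Ob}\,\mathbf C$; categories $\mathbf C((X_i)_{i\in I};Y)$; for every $\phi:I\to J$ composition functors $\mu_\phi:\prod_{j\in J}\mathbf C((X_i)_{i\in\phi^{-1}j};Y_j)\times\mathbf C((Y_j)_{j\in J};Z)\to\mathbf C((X_i)_{i\in I};Z)$; units $1_X\in\mathbf C(X;X)$; natural isomorphisms: associators $$\nu_{\phi,\psi}:\mu_{\psi\phi}\bigl((\mu_{\phi|:\phi^{-1}\psi^{-1}k\to\psi^{-1}k}((p_j)_{j\in\psi^{-1}k},q_k))_{k\in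 K},z\bigr)\to\mu_\phi\bigl((p_j)_{j\in J},\mu_\psi((q_k)_{k\in K},z)\bigr)$$ for $I\xrightarrow{\phi}J\xrightarrow{\psi}K$, left unitors $\theta:\mu_{\mathrm{id}}((1_{X_i})_{i\in I},z)\to z$ and right unitors $\zeta:\mu_{I\to 1}(u,1_Y)\to u$; such that the pentagon equation for $I\xrightarrow{\phi}J\xrightarrow{\psi}K\xrightarrow{\xi}L$ $$\mu_{\xi\psi\phi}\bigl((\nu_{\phi|,\psi|})_{l\in L},1\bigr)\ \text{then}\ \nu_{\phi,\xi\psi}\ \text{then}\ \mu_\phi(1,\nu_{\psi,\xi})\;=\;\nu_{\psi\phi,\xi}\ \text{then}\ \nu_{\phi,\psi}$$ and the triangle equation ($\nu_{\phi,\mathrm{id}_J}$ followed by $\mu_\phi(1,\theta)$ equals $\mu_\phi((\zeta)_{j\in J},1)$) hold. A symmetric weak multifunctor $F:\mathbf C\to\mathbf D$ consists of a map $\mathrm{Ob}\,F$, functors $F_{(X_i);Y}:\mathbf C((X_i)_{i\in I};Y)\to\mathbf D((FX_i)_{i\in I};FY)$, natural isomorphisms $F^\phi:\mu_\phi((Fp_j)_{j\in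 J},Fz)\to F\mu_\phi((p_j)_{j\in J},z)$ and isomorphisms $F_X:1_{FX}\to F1_X$, such that $\mu_{\psi\phi}((F^{\phi|})_{k\in K},1)$ followed by $F^{\psi\phi}$ and $F\nu_{\phi,\psi}$ equals $\nu_{\phi,\psi}$ followed by $\mu_\phi(1,F^\psi)$ and $F^\phi$; $\mu_{I\to1}(1,F_Y)$ followed by $F^{I\to 1}$ and $F\zeta$ equals $\zeta$; and $\mu_{\mathrm{id}}((F_{X_i})_{i\in I},1)$ followed by $F^{\mathrm{id}}$ and $F\theta$ equals $\theta$. **Biprops.** A biprop $\mathcal P$ is a bicategory $(\mathcal P,m,1,a,l,r)$ with set of objects $S^*$ for a set $S=\mathrm{Col}\,\mathcal P$, together with functors $$\otimes^{I\xrightarrow{f}L\xleftarrow{g}J}:\prod_{l\in L}\mathcal P\Bigl(\bigsqcup_{i\in f^{-1}l}A_i;\bigsqcup_{j\in g^{-1}l}B_j\Bigr)\to\mathcal P\Bigl(\bigsqcup_{i\in I}A_i;\bigsqcup_{j\in J}B_j\Bigr)$$ for all $I\xrightarrow{f}L\xleftarrow{g}J$ in $\mathcal S_{\mathrm{sk}}$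 and all families $(A_i),(B_j)$ of objects, which strictly preserve the composition $m$, the associator $a$, the units $1$ and the unitors $l,r$, such that $\otimes^{I\to 1\leftarrow J}$ is the identity functor, and which are strict: for $h:K\to L$, $\alpha=hf$, $\beta=hg$, the functor $\otimes^{I\xrightarrow{f}K\xleftarrow{g}J}$ is $\prod_{l\in L}\otimes^{\alpha^{-1}l\xrightarrow{f|}h^{-1}l\xleftarrow{g|}\beta^{-1}l}$ followed by $\otimes^{I\xrightarrow{\alpha}L\xleftarrow{\beta}J}$. A morphism of biprops $G:\mathcal P\to\mathcal R$ consists of a map $\mathrm{Col}\,G$ (inducing $A=(X_i)_i\mapsto GA=(GX_i)_i$ on objects), functors $G_{A;B}:\mathcal P(A;B)\to\mathcal R(GA;GB)$, natural isomorphisms $G_{A;B;C}$ from $m\circ(G_{A;B}\times G_{B;C})$ to $G_{A;C}\circ m$, and isomorphisms $G_A:1_{GA}\to G_{A;A}(1_A)$, such that 1. $G$ commutes strictly with the tensor products: $G_{\bigsqcup_IA_i;\bigsqcup_JB_j}\circ\otimes^{I\xrightarrow{f}L\xleftarrow{g}J}=\otimes^{I\xrightarrow{f}L\xleftarrow{g}J}\circ\prod_{l\in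 L}G_{\bigsqcup_{f^{-1}l}A_i;\bigsqcup_{g^{-1}l}B_j}$; 2. for $I\xrightarrow{f}L$, $J\xrightarrow{g}L$, $K\xrightarrow{h}L$, the transformation $G_{\bigsqcup_IA_i;\bigsqcup_JB_j;\bigsqcup_KC_k}$ evaluated at $(\otimes^{f,g}(x_l)_l,\otimes^{g,h}(y_l)_l)$ is $\otimes^{f,h}$ applied to the family of the values of $G_{\bigsqcup_{f^{-1}l}A_i;\bigsqcup_{g^{-1}l}B_j;\bigsqcup_{h^{-1}l}C_k}$ at $(x_l,y_l)$, $l\in L$; 3. $m(G_{A;B;C},1)$ followed by $G_{A;C;D}$ and $G(a)$ equals $a$ followed by $m(1,G_{B;C;D})$ and $G_{A;B;D}$; 4. $m(1,G_B)$ followed by $G_{A;B;B}$ and $G(r)$ equals $r$; 5. $m(G_A,1)$ followed by $G_{A;A;B}$ and $G(l)$ equals $l$. **Envelopes.** The biprop envelope $\mathbb F\mathbf C$ of a symmetric weak multicategory $\mathbf C$ has $\mathrm{Col}\,\mathbb F\mathbf C=\mathrm{Ob}\,\mathbf C$ and $$\mathbb F\mathbf C((X_i)_{i\in I};(Y_j)_{j\in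 J})=\coprod_{\phi:I\to J}\ \prod_{j\in J}\mathbf C((X_i)_{i\in\phi^{-1}j};Y_j);$$ the composition is $\coprod_{(\phi,\psi)\mapsto\psi\phi}\prod_{k\in K}\mu_{\phi|:\phi^{-1}\psi^{-1}k\to\psi^{-1}k}$; the unit of $(X_i)_{i\in I}$ is $(1_{X_i})_{i\in I}$ in the summand $\mathrm{id}_I$; the associator and the unitors are, componentwise over the fibres, $\nu$, $\theta$, $\zeta$; and $\otimes^{I\xrightarrow{f}L\xleftarrow{g}J}$ sends a family in the summands $\phi_l:\bigsqcup_{i\in f^{-1}l}S_i\to\bigsqcup_{j\in g^{-1}l}Q_j$, $l\in L$, to the union of the families, in the summand $\phi:\bigsqcup_{i\in I}S_i\to\bigsqcup_{j\in J}Q_j$ assembled from the $\phi_l$. For a symmetric weak multifunctor $F:\mathbf C\to\mathbf D$ let $\mathbb FF$ consist of $\mathrm{Col}\,\mathbb FF=\mathrm{Ob}\,F$, the functors $$(\mathbb FF)_{(X_i)_{i\in I};(Y_j)_{j\in J}}=\coprod_{\phi:I\to J}\ \prod_{j\in J}F_{(X_i)_{i\in\phi^{-1}j};Y_j},$$ the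 natural isomorphisms $(\mathbb FF)_{(X_i);(Y_j);(Z_k)}$ given by $\coprod_{(\phi,\psi)}\prod_{k\in K}F^{\phi|:\phi^{-1}\psi^{-1}k\to\psi^{-1}k}$, and the isomorphisms $(\mathbb FF)_{(X_i)_{i\in I}}=\prod_{i\in I}F_{X_i}$ in the summand $\mathrm{id}_I$. **Proposition.** For every symmetric weak multifunctor $F:\mathbf C\to\mathbf D$ between symmetric weak multicategories, $\mathbb FF:\mathbb F\mathbf C\to\mathbb F\mathbf D$ is a morphism of biprops, that is, equations 1–5 hold for it. -/

import Mathlib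

open CategoryTheory

/-- Words in `S`, the elements of the free monoid `S*`: tuples `(X_i)_{i ∈ Fin len}`. -/
@[ext]
structure Word (S : Type*) where
  len : ℕ
  col : Fin len → S

/-! ### Fibres of a map between finite totally ordered sets `Fin n` -/

/-- The increasing enumeration of the fibre `φ⁻¹ j`, as a map into the source of `φ`. -/
noncomputable def femb {n m : ℕ} (φ : Fin n → Fin m) (j : Fin m)
    (s : Fin (Fintype.card {i // φ i = j})) : Fin n :=
  (monoEquivOfFin {i // φ i = j} rfl s).1

/-- The position of `i ∈ φ⁻¹ j` in the increasing enumeration of `φ⁻¹ j`. -/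
noncomputable def fpos {n m : ℕ} (φ : Fin n → Fin m) (j : Fin m) (i : Fin n) (h : φ i = j) :
    Fin (Fintype.card {i // φ i = j}) :=
  (monoEquivOfFin {i // φ i = j} rfl).symm ⟨i, h⟩

theorem femb_spec {n m : ℕ} (φ : Fin n → Fin m) (j : Fin m)
    (s : Fin (Fintype.card {i // φ i = j})) : φ (femb φ j s) = j :=
  (monoEquivOfFin {i // φ i = j} rfl s).2

theorem femb_fpos {n m : ℕ} (φ : Fin n → Fin m) (j : Fin m) (i : Fin n) (h : φ i = j) :
    femb φ j (fpos φ j i h) = i := by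
  simp [femb, fpos]

theorem femb_strictMono {n m : ℕ} (φ : Fin n → Fin m) (j : Fin m) : StrictMono (femb φ j) :=
  fun _ _ h => (monoEquivOfFin {i // φ i = j} rfl).strictMono h

theorem fpos_femb {n m : ℕ} (φ : Fin n → Fin m) (j : Fin m)
    (s : Fin (Fintype.card {i // φ i = j})) (h : φ (femb φ j s) = j) :
    fpos φ j (femb φ j s) h = s :=
  (femb_strictMono φ j).injective (femb_fpos _ _ _ _)

theorem range_femb {n m : ℕ} (φ : Fin n → Fin m) (j : Fin m) :
    Set.range (femb φ j) = {i | φ i = j} := by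
  ext i
  exact ⟨by rintro ⟨s, rfl⟩; exact femb_spec φ j s, fun h => ⟨fpos φ j i h, femb_fpos _ _ _ _⟩⟩

/-- The restriction `φ| : φ⁻¹ψ⁻¹k → ψ⁻¹k` of `φ`, in terms of the enumerations of fibres. -/
noncomputable def frestr {n m p : ℕ} (φ : Fin n → Fin m) (ψ : Fin m → Fin p) (k : Fin p)
    (s : Fin (Fintype.card {i // (ψ ∘ φ) i = k})) : Fin (Fintype.card {j // ψ j = k}) :=
  fpos ψ k (φ (femb (ψ ∘ φ) k s)) (femb_spec (ψ ∘ φ) k s)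

theorem femb_frestr {n m p : ℕ} (φ : Fin n → Fin m) (ψ : Fin m → Fin p) (k : Fin p)
    (s : Fin (Fintype.card {i // (ψ ∘ φ) i = k})) :
    femb ψ k (frestr φ ψ k s) = φ (femb (ψ ∘ φ) k s) :=
  femb_fpos _ _ _ _

theorem enum_unique {n n' : ℕ} {α : Type*} [LinearOrder α] {f : Fin n → α} {g : Fin n' → α}
    (hf : StrictMono f) (hg : StrictMono g) (h : Set.range f = Set.range g) :
    n = n' ∧ ∀ s s', s.val = s'.val → f s = g s' := by
  have hn : n = n' := by
    have h1 := Set.card_range_of_injective hf.injective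
    have h2 := Set.card_range_of_injective hg.injective
    simp only [Fintype.card_fin] at h1 h2
    rw [← h1, ← h2]
    exact Fintype.card_congr (Equiv.setCongr h)
  subst hn
  refine ⟨rfl, fun s s' hs => ?_⟩
  obtain rfl := Fin.ext hs
  rw [(hf.range_inj hg).1 h]

theorem femb_femb_aux {n m p : ℕ} (φ : Fin n → Fin m) (ψ : Fin m → Fin p) (k : Fin p)
    (j : Fin (Fintype.card {j // ψ j = k})) :
    Set.range (fun s => femb (ψ ∘ φ) k (femb (frestr φ ψ k) j s)) =
      Set.range (femb φ (femb ψ k j)) := by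
  rw [range_femb]
  ext i
  constructor
  · rintro ⟨s, rfl⟩
    have := femb_frestr φ ψ k (femb (frestr φ ψ k) j s)
    rw [femb_spec (frestr φ ψ k) j s] at this
    exact this.symm
  · intro h
    have h' : φ i = femb ψ k j := h
    have h1 : (ψ ∘ φ) i = k := by simp [h', femb_spec]
    refine ⟨fpos _ _ (fpos (ψ ∘ φ) k i h1) ?_, ?_⟩
    · apply (femb_strictMono ψ k).injective
      rw [femb_frestr, femb_fpos, h']
    · simp [femb_fpos]

theorem femb_femb_card {n m p : ℕ} (φ : Fin n → Fin m) (ψ : Fin m → Fin p) (k : Fin p)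
    (j : Fin (Fintype.card {j // ψ j = k})) :
    Fintype.card {i // frestr φ ψ k i = j} = Fintype.card {i // φ i = femb ψ k j} :=
  (enum_unique ((femb_strictMono _ _).comp (femb_strictMono _ _)) (femb_strictMono _ _)
    (femb_femb_aux φ ψ k j)).1

/-- Enumerating `φ⁻¹ j` inside `φ⁻¹ψ⁻¹k` is the same as enumerating it directly. -/
theorem femb_femb {n m p : ℕ} (φ : Fin n → Fin m) (ψ : Fin m → Fin p) (k : Fin p)
    (j : Fin (Fintype.card {j // ψ j = k})) (s s') (h : s.val = s'.val) :
    femb (ψ ∘ φ) k (femb (frestr φ ψ k) j s) = femb φ (femb ψ k j) s' :=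
  (enum_unique ((femb_strictMono _ _).comp (femb_strictMono _ _)) (femb_strictMono _ _)
    (femb_femb_aux φ ψ k j)).2 s s' h

theorem frestr_frestr {n m p q : ℕ} (φ : Fin n → Fin m) (ψ : Fin m → Fin p) (ξ : Fin p → Fin q)
    (l : Fin q) : frestr (ψ ∘ φ) ξ l = frestr ψ ξ l ∘ frestr φ (ξ ∘ ψ) l := by
  funext s
  apply (femb_strictMono ξ l).injective
  simp only [femb_frestr, Function.comp_apply]
  rfl

/-- Restricting `φ` to `φ⁻¹ψ⁻¹k → ψ⁻¹k` directly, or first to `φ⁻¹ψ⁻¹ξ⁻¹l → ψ⁻¹ξ⁻¹l`. -/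
theorem frestr_femb {n m p q : ℕ} (φ : Fin n → Fin m) (ψ : Fin m → Fin p) (ξ : Fin p → Fin q)
    (l : Fin q) (k : Fin (Fintype.card {k // ξ k = l})) (s s') (h : s.val = s'.val) :
    (frestr φ ψ (femb ξ l k) s).val =
      (frestr (frestr φ (ξ ∘ ψ) l) (frestr ψ ξ l) k s').val := by
  have hc := femb_femb_card ψ ξ l k
  generalize hx : frestr (frestr φ (ξ ∘ ψ) l) (frestr ψ ξ l) k s' = x
  have key : frestr φ ψ (femb ξ l k) s = Fin.cast hc x := by
    apply (femb_strictMono ψ (femb ξ l k)).injective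
    rw [femb_frestr, ← femb_femb ψ ξ l k x (Fin.cast hc x) rfl, ← hx, femb_frestr, femb_frestr]
    congr 1
    have h2 : ∀ (χ) (hχ : χ = frestr (ψ ∘ φ) ξ l) (t : Fin (Fintype.card {i // χ i = k})),
        s.val = t.val → femb (ψ ∘ φ) (femb ξ l k) s = femb (ξ ∘ ψ ∘ φ) l (femb χ k t) := by
      rintro _ rfl t ht
      exact (femb_femb (ψ ∘ φ) ξ l k t s ht.symm).symm
    exact h2 _ (frestr_frestr φ ψ ξ l).symm s' h
  rw [key]
  rfl

namespace Word

/-- The map of free monoids induced by a map of generators. -/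
def map {S T : Type*} (f : S → T) (A : Word S) : Word T := ⟨A.len, fun i => f (A.col i)⟩

/-- The word of length one. -/
def single {S : Type*} (x : S) : Word S := ⟨1, fun _ => x⟩

/-- The word `(X_i)_{i ∈ I}` of a family indexed by a finite totally ordered set `I`. -/
noncomputable def ofFamily {S : Type*} {I : Type} [Fintype I] [LinearOrder I] (X : I → S) :
    Word S :=
  ⟨Fintype.card I, fun s => X (monoEquivOfFin I rfl s)⟩

/-- The word `(A_i)_{i ∈ φ⁻¹ j}`. -/
noncomputable def fib {S : Type*} (A : Word S) {m : ℕ} (φ : Fin A.len → Fin m) (j : Fin m) :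
    Word S :=
  ofFamily fun i : {i // φ i = j} => A.col i

/-- The inclusion of `φ⁻¹ j` into the index set of `A`. -/
noncomputable def emb {S : Type*} (A : Word S) {m : ℕ} (φ : Fin A.len → Fin m) (j : Fin m) :
    Fin (A.fib φ j).len → Fin A.len :=
  femb φ j

/-- The restriction `φ| : φ⁻¹ψ⁻¹k → ψ⁻¹k` as a map of index sets of words. -/
noncomputable def restrict {S : Type*} (A B : Word S) {p : ℕ} (φ : Fin A.len → Fin B.len)
    (ψ : Fin B.len → Fin p) (k : Fin p) : Fin (A.fib (ψ ∘ φ) k).len → Fin (B.fib ψ k).len :=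
  frestr φ ψ k

/-- The concatenation `⨆_{i ∈ I} A_i` of a family of words indexed by a finite totally ordered
set `I`: the letters are indexed by the lexicographically ordered disjoint union. -/
noncomputable def concat {S : Type*} {I : Type} [Fintype I] [LinearOrder I] (A : I → Word S) :
    Word S :=
  ofFamily fun s : Σₗ i : I, Fin (A i).len => (A (ofLex s).1).col (ofLex s).2

theorem ext_val {S : Type*} {A B : Word S} (h : A.len = B.len)
    (h' : ∀ (i : Fin A.len) (j : Fin B.len), i.val = j.val → A.col i = B.col j) : A = B := by
  obtain ⟨n, X⟩ := A
  obtain ⟨n', X'⟩ := B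
  obtain rfl : n = n' := h
  congr
  funext i
  exact h' i i rfl

theorem ofFamily_congr {S : Type*} {I I' : Type} [Fintype I] [LinearOrder I] [Fintype I']
    [LinearOrder I'] (e : I ≃o I') (X : I → S) (X' : I' → S) (h : ∀ i, X i = X' (e i)) :
    ofFamily X = ofFamily X' := by
  have hc : Fintype.card I = Fintype.card I' := Fintype.card_congr e.toEquiv
  refine ext_val hc fun i j hij => ?_
  change X (monoEquivOfFin I rfl i) = X' (monoEquivOfFin I' rfl j)
  rw [h]
  congr 1
  have := (enum_unique (f := fun s => e (monoEquivOfFin I rfl s)) (g := monoEquivOfFin I' rfl)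
    (e.strictMono.comp (monoEquivOfFin I rfl).strictMono) (monoEquivOfFin I' rfl).strictMono
    (by rw [(monoEquivOfFin I' rfl).surjective.range_eq]
        exact (e.surjective.comp (monoEquivOfFin I rfl).surjective).range_eq)).2
  exact this i j hij

/-- `((A_i)_{i ∈ φ⁻¹ψ⁻¹k})_{i ∈ φ⁻¹j} = (A_i)_{i ∈ φ⁻¹j}` for `j ∈ ψ⁻¹k`. -/
theorem fib_fib {S : Type*} (A B : Word S) {p : ℕ} (φ : Fin A.len → Fin B.len)
    (ψ : Fin B.len → Fin p) (k : Fin p) (j : Fin (B.fib ψ k).len) :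
    (A.fib (ψ ∘ φ) k).fib (A.restrict B φ ψ k) j = A.fib φ (B.emb ψ k j) :=
  ext_val (femb_femb_card φ ψ k j) fun s s' h =>
    congrArg A.col (femb_femb φ ψ k j s s' h)

theorem fib_fib' {S : Type*} (A B D : Word S) {p : ℕ} (φ : Fin A.len → Fin B.len)
    (ψ : Fin B.len → Fin D.len) (ξ : Fin D.len → Fin p) (l : Fin p) (k : Fin (D.fib ξ l).len) :
    A.fib (ψ ∘ φ) (D.emb ξ l k) =
      (A.fib (ξ ∘ ψ ∘ φ) l).fib (B.restrict D ψ ξ l ∘ A.restrict B φ (ξ ∘ ψ) l) k := by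
  have h : A.restrict D (ψ ∘ φ) ξ l = B.restrict D ψ ξ l ∘ A.restrict B φ (ξ ∘ ψ) l :=
    frestr_frestr φ ψ ξ l
  rw [← h]
  exact (fib_fib A D (ψ ∘ φ) ξ l k).symm

theorem femb_id {m : ℕ} (j : Fin m) (s) : femb (n := m) id j s = j :=
  femb_spec (n := m) id j s

theorem card_fib_id {m : ℕ} (j : Fin m) : Fintype.card {i : Fin m // id i = j} = 1 := by
  simp

theorem fib_id {S : Type*} (A : Word S) (j : Fin A.len) : A.fib id j = single (A.col j) :=
  ext_val (card_fib_id j) fun s _ _ => congrArg A.col (femb_id j s)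

theorem fib_const {S : Type*} (A : Word S) {m : ℕ} (φ : Fin A.len → Fin m) (j : Fin m)
    (h : ∀ i, φ i = j) : A.fib φ j = A := by
  have H := enum_unique (femb_strictMono φ j) (strictMono_id (α := Fin A.len))
    (by rw [range_femb]; simp [h])
  exact ext_val H.1 fun s s' hs => congrArg A.col (H.2 s s' hs)

end Word
set_option linter.checkUnivs false

universe v w u

/-- The hom-categories, composition functors and units of a symmetric weak multicategory.

In `comp`, the word `W j` is `(A_i)_{i ∈ φ⁻¹ j}`; it is named by an equation so that no transport
along equalities of words is needed later on. -/
structure MultiCore where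
  Ob : Type u
  Hom : Word Ob → Ob → Type v
  cat : ∀ A Y, Category.{w} (Hom A Y)
  /-- The unit `1_X ∈ C(X; X)`. -/
  one : ∀ X, Hom (Word.single X) X
  /-- `μ_φ : ∏_{j ∈ J} C((A_i)_{i ∈ φ⁻¹ j}; B_j) × C((B_j)_{j ∈ J}; Z) ⥤ C((A_i)_{i ∈ I}; Z)`. -/
  comp : ∀ {A B : Word Ob} (φ : Fin A.len → Fin B.len) (W : Fin B.len → Word Ob)
    (_ : ∀ j, W j = A.fib φ j) (Z : Ob), ((∀ j, Hom (W j) (B.col j)) × Hom B Z) ⥤ Hom A Z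

namespace MultiCore

attribute [instance] MultiCore.cat

variable (C : MultiCore.{v, w, u})

/-- Transport of hom-categories along equalities of words and objects. -/
def cast {A A' : Word C.Ob} {Y Y' : C.Ob} (hA : A = A') (hY : Y = Y') :
    C.Hom A Y ⥤ C.Hom A' Y' := by
  subst hA hY
  exact 𝟭 _

/-- The composition functor `μ_φ : ∏_{j ∈ J} C((A_i)_{i ∈ φ⁻¹ j}; B_j) × C((B_j)_{j ∈ J}; Z) ⥤
C((A_i)_{i ∈ I}; Z)`. -/
noncomputable def mu {A B : Word C.Ob} (φ : Fin A.len → Fin B.len) (Z : C.Ob) :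
    ((∀ j, C.Hom (A.fib φ j) (B.col j)) × C.Hom B Z) ⥤ C.Hom A Z :=
  C.comp φ (fun j => A.fib φ j) (fun _ => rfl) Z

/-- The functor `μ_{φ| : φ⁻¹ψ⁻¹k → ψ⁻¹k}`, precomposed with the projection
`∏_{j ∈ J} C((A_i)_{i ∈ φ⁻¹ j}; B_j) ⥤ ∏_{j ∈ ψ⁻¹k} C((A_i)_{i ∈ φ⁻¹ j}; B_j)`. -/
noncomputable def compAt {A B : Word C.Ob} {p : ℕ} (φ : Fin A.len → Fin B.len)
    (ψ : Fin B.len → Fin p) (k : Fin p) (Z : C.Ob) :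
    ((∀ j, C.Hom (A.fib φ j) (B.col j)) × C.Hom (B.fib ψ k) Z) ⥤ C.Hom (A.fib (ψ ∘ φ) k) Z :=
  (Pi.comap (fun j => C.Hom (A.fib φ j) (B.col j)) (B.emb ψ k)).prod (𝟭 _) ⋙
    C.comp (A := A.fib (ψ ∘ φ) k) (B := B.fib ψ k) (A.restrict B φ ψ k)
      (fun j => A.fib φ (B.emb ψ k j)) (fun j => (Word.fib_fib A B φ ψ k j).symm) Z

/-- The functor `((p_j)_j, (q_k)_k, z) ↦ μ_{ψφ}((μ_{φ|k}((p_j)_{j ∈ ψ⁻¹k}, q_k))_k, z)`. -/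
noncomputable def assocSource {A B D : Word C.Ob} (φ : Fin A.len → Fin B.len)
    (ψ : Fin B.len → Fin D.len) (Z : C.Ob) :
    ((∀ j, C.Hom (A.fib φ j) (B.col j)) × (∀ k, C.Hom (B.fib ψ k) (D.col k)) × C.Hom D Z) ⥤
      C.Hom A Z :=
  Functor.prod'
    (Functor.pi' fun k =>
      Functor.prod' (CategoryTheory.Prod.fst _ _) (CategoryTheory.Prod.snd _ _ ⋙ CategoryTheory.Prod.fst _ _ ⋙ Pi.eval _ k) ⋙
        C.compAt φ ψ k (D.col k))
    (CategoryTheory.Prod.snd _ _ ⋙ CategoryTheory.Prod.snd _ _) ⋙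
  C.mu (ψ ∘ φ) Z

/-- The functor `((p_j)_j, (q_k)_k, z) ↦ μ_φ((p_j)_j, μ_ψ((q_k)_k, z))`. -/
noncomputable def assocTarget {A B D : Word C.Ob} (φ : Fin A.len → Fin B.len)
    (ψ : Fin B.len → Fin D.len) (Z : C.Ob) :
    ((∀ j, C.Hom (A.fib φ j) (B.col j)) × (∀ k, C.Hom (B.fib ψ k) (D.col k)) × C.Hom D Z) ⥤
      C.Hom A Z :=
  (𝟭 _).prod (C.mu ψ Z) ⋙
    C.mu φ Z

/-- The family `(1_{A_i})_i`, its `i`-th member being an object of `C((A_{i'})_{i' ∈ id⁻¹ i}; A_i)`. -/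
noncomputable def units (A : Word C.Ob) (i : Fin A.len) : C.Hom (A.fib id i) (A.col i) :=
  (C.cast (Word.fib_id A i).symm rfl).obj (C.one (A.col i))

/-- The functor `z ↦ μ_id((1_{A_i})_i, z)`. -/
noncomputable def lunitSource (A : Word C.Ob) (Z : C.Ob) : C.Hom A Z ⥤ C.Hom A Z :=
  Prod.sectR (C.units A) _ ⋙ C.mu (A := A) (B := A) id Z

/-- The functor `u ↦ μ_{I → 1}(u, 1_Y)`. -/
noncomputable def runitSource (A : Word C.Ob) (Y : C.Ob) : C.Hom A Y ⥤ C.Hom A Y :=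
  Functor.prod' (Functor.pi' fun _ => 𝟭 _) ((Functor.const _).obj (C.one Y)) ⋙
    C.comp (A := A) (B := Word.single Y) (fun _ => (0 : Fin 1)) (fun _ => A)
      (fun j => (Word.fib_const A _ j fun _ => Subsingleton.elim (α := Fin 1) _ _).symm) Y

end MultiCore

/-- The data of a symmetric weak multicategory. -/
structure SymWeakMultiData extends MultiCore.{v, w, u} where
  /-- The associator `ν_{φ,ψ}`. -/
  assoc : ∀ {A B D : Word Ob} (φ : Fin A.len → Fin B.len) (ψ : Fin B.len → Fin D.len) (Z : Ob),
    toMultiCore.assocSource φ ψ Z ≅ toMultiCore.assocTarget φ ψ Z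
  /-- The left unitor `θ`. -/
  lunit : ∀ (A : Word Ob) (Z : Ob), toMultiCore.lunitSource A Z ≅ 𝟭 _
  /-- The right unitor `ζ`. -/
  runit : ∀ (A : Word Ob) (Y : Ob), toMultiCore.runitSource A Y ≅ 𝟭 _
theorem functor_eq_of_arrow {C D : Type*} [Category* C] [Category* D] {F G : C ⥤ D}
    (h : ∀ (X Y : C) (f : X ⟶ Y), Arrow.mk (F.map f) = Arrow.mk (G.map f)) : F = G := by
  have ho : ∀ X, F.obj X = G.obj X := fun X => congrArg (fun a => a.left) (h X X (𝟙 X))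
  exact CategoryTheory.Functor.ext ho fun X Y f => ((Arrow.mk_eq_mk_iff _ _).1 (h X Y f)).2.2

namespace MultiCore

variable (C : MultiCore.{v, w, u})

/-- A morphism of some hom-category, together with its indices. -/
def TArr : Type _ := Σ (A : Word C.Ob) (Y : C.Ob), Arrow (C.Hom A Y)

variable {C}

def tarr {A : Word C.Ob} {Y : C.Ob} {x y : C.Hom A Y} (f : x ⟶ y) : C.TArr :=
  ⟨A, Y, Arrow.mk f⟩

theorem tarr_inj {A : Word C.Ob} {Y : C.Ob} {x y x' y' : C.Hom A Y} {f : x ⟶ y} {g : x' ⟶ y'}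
    (h : tarr f = tarr g) : Arrow.mk f = Arrow.mk g := by
  simpa [tarr, TArr] using h

theorem tarr_cast {A A' : Word C.Ob} {Y Y' : C.Ob} (hA : A = A') (hY : Y = Y') {x y : C.Hom A Y}
    (f : x ⟶ y) : tarr ((C.cast hA hY).map f) = tarr f := by
  subst hA hY
  rfl

theorem tarr_idx {ι : Type*} {A : ι → Word C.Ob} {Y : ι → C.Ob} {x y : ∀ i, C.Hom (A i) (Y i)}
    (f : x ⟶ y) {i j : ι} (h : i = j) : tarr (f i) = tarr (f j) := by
  rw [h]

theorem tarr_comp {A B A' B' : Word C.Ob} (hA : A = A') (hB : B = B')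
    (φ : Fin A.len → Fin B.len) (φ' : Fin A'.len → Fin B'.len)
    (hφ : ∀ i i', i.val = i'.val → (φ i).val = (φ' i').val)
    (W W') (hW) (hW') {Z Z' : C.Ob}
    {p q : ∀ j, C.Hom (W j) (B.col j)} {p' q' : ∀ j, C.Hom (W' j) (B'.col j)}
    (f : p ⟶ q) (f' : p' ⟶ q')
    (hf : ∀ j j', j.val = j'.val → tarr (f j) = tarr (f' j'))
    {z t : C.Hom B Z} {z' t' : C.Hom B' Z'} (g : z ⟶ t) (g' : z' ⟶ t')
    (hg : tarr g = tarr g') :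
    tarr ((C.comp φ W hW Z).map (X := (p, z)) (Y := (q, t)) (f, g)) =
      tarr ((C.comp φ' W' hW' Z').map (X := (p', z')) (Y := (q', t')) (f', g')) := by
  subst hA hB
  obtain rfl : φ = φ' := funext fun i => Fin.ext (hφ i i rfl)
  obtain rfl : W = W' := funext fun j => (hW j).trans (hW' j).symm
  obtain rfl : Z = Z' := by
    simp only [tarr, TArr, Sigma.mk.injEq, heq_eq_eq, true_and] at hg
    exact hg.1
  have hg' := (Arrow.mk_eq_mk_iff _ _).1 (tarr_inj hg)
  have hf' := fun j => (Arrow.mk_eq_mk_iff _ _).1 (tarr_inj (hf j j rfl))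
  obtain ⟨rfl, rfl, hg'⟩ := hg'
  obtain rfl : g = g' := by simpa using hg'
  obtain rfl : p = p' := funext fun j => (hf' j).1
  obtain rfl : q = q' := funext fun j => (hf' j).2.1
  obtain rfl : f = f' := funext fun j => by
    obtain ⟨_, _, h⟩ := hf' j
    simpa using h
  rfl

theorem tarr_compAt {A B A' B' : Word C.Ob} (hA : A = A') (hB : B = B') {p p' : ℕ}
    (hp : p = p') (φ : Fin A.len → Fin B.len) (φ' : Fin A'.len → Fin B'.len)
    (hφ : ∀ i i', i.val = i'.val → (φ i).val = (φ' i').val)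
    (ψ : Fin B.len → Fin p) (ψ' : Fin B'.len → Fin p')
    (hψ : ∀ i i', i.val = i'.val → (ψ i).val = (ψ' i').val)
    (k : Fin p) (k' : Fin p') (hk : k.val = k'.val)
    {Z Z' : C.Ob}
    {x y : ∀ j, C.Hom (A.fib φ j) (B.col j)} {x' y' : ∀ j, C.Hom (A'.fib φ' j) (B'.col j)}
    (f : x ⟶ y) (f' : x' ⟶ y')
    (hf : ∀ j j', j.val = j'.val → tarr (f j) = tarr (f' j'))
    {z t : C.Hom (B.fib ψ k) Z} {z' t' : C.Hom (B'.fib ψ' k') Z'} (g : z ⟶ t) (g' : z' ⟶ t')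
    (hg : tarr g = tarr g') :
    tarr ((C.compAt φ ψ k Z).map (X := (x, z)) (Y := (y, t)) (f, g)) =
      tarr ((C.compAt φ' ψ' k' Z').map (X := (x', z')) (Y := (y', t')) (f', g')) := by
  subst hA hB hp
  obtain rfl : φ = φ' := funext fun i => Fin.ext (hφ i i rfl)
  obtain rfl : ψ = ψ' := funext fun i => Fin.ext (hψ i i rfl)
  obtain rfl : k = k' := Fin.ext hk
  refine tarr_comp rfl rfl _ _ (fun i i' h => by rw [Fin.ext h]) _ _ _ _ _ _ ?_ _ _ hg
  intro j j' h
  obtain rfl := Fin.ext h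
  exact hf _ _ rfl

variable (C)

/-- The restriction functor `∏_{j ∈ J} C((A_i)_{i ∈ φ⁻¹ j}; B_j) ⥤
∏_{j ∈ ψ⁻¹k} C((A_i)_{i ∈ φ⁻¹ j}; B_j)`, the target being written in terms of the restricted map
`φ| : φ⁻¹ψ⁻¹k → ψ⁻¹k`. -/
noncomputable def restr {A B : Word C.Ob} {p : ℕ} (φ : Fin A.len → Fin B.len)
    (ψ : Fin B.len → Fin p) (k : Fin p) :
    (∀ j, C.Hom (A.fib φ j) (B.col j)) ⥤
      (∀ j, C.Hom ((A.fib (ψ ∘ φ) k).fib (A.restrict B φ ψ k) j) ((B.fib ψ k).col j)) :=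
  Functor.pi' fun j =>
    Pi.eval (fun j => C.Hom (A.fib φ j) (B.col j)) (B.emb ψ k j) ⋙
      C.cast (Word.fib_fib A B φ ψ k j).symm rfl

/-- The functor `((p_j)_j, (q_k)_k, z) ↦ μ_{ψφ|l}((μ_{φ|k}((p_j)_j, q_k))_{k ∈ ξ⁻¹l}, z)`. -/
noncomputable def assocSourceAt {A B D : Word C.Ob} {p : ℕ} (φ : Fin A.len → Fin B.len)
    (ψ : Fin B.len → Fin D.len) (ξ : Fin D.len → Fin p) (l : Fin p) (Z : C.Ob) :
    ((∀ j, C.Hom (A.fib φ j) (B.col j)) × (∀ k, C.Hom (B.fib ψ k) (D.col k)) ×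
      C.Hom (D.fib ξ l) Z) ⥤ C.Hom (A.fib (ξ ∘ ψ ∘ φ) l) Z :=
  Functor.prod'
    (Functor.pi' fun k =>
      Functor.prod' (CategoryTheory.Prod.fst _ _)
          (CategoryTheory.Prod.snd _ _ ⋙ CategoryTheory.Prod.fst _ _ ⋙ Pi.eval _ k) ⋙
        C.compAt φ ψ k (D.col k))
    (CategoryTheory.Prod.snd _ _ ⋙ CategoryTheory.Prod.snd _ _) ⋙
  C.compAt (ψ ∘ φ) ξ l Z

/-- The functor `((p_j)_j, (q_k)_k, z) ↦ μ_{φ|l}((p_j)_{j ∈ ψ⁻¹ξ⁻¹l}, μ_{ψ|l}((q_k)_k, z))`. -/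
noncomputable def assocTargetAt {A B D : Word C.Ob} {p : ℕ} (φ : Fin A.len → Fin B.len)
    (ψ : Fin B.len → Fin D.len) (ξ : Fin D.len → Fin p) (l : Fin p) (Z : C.Ob) :
    ((∀ j, C.Hom (A.fib φ j) (B.col j)) × (∀ k, C.Hom (B.fib ψ k) (D.col k)) ×
      C.Hom (D.fib ξ l) Z) ⥤ C.Hom (A.fib (ξ ∘ ψ ∘ φ) l) Z :=
  (𝟭 _).prod (C.compAt ψ ξ l Z) ⋙ C.compAt φ (ξ ∘ ψ) l Z

theorem assocSourceAt_eq {A B D : Word C.Ob} {p : ℕ} (φ : Fin A.len → Fin B.len)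
    (ψ : Fin B.len → Fin D.len) (ξ : Fin D.len → Fin p) (l : Fin p) (Z : C.Ob) :
    C.assocSourceAt φ ψ ξ l Z =
      (C.restr φ (ξ ∘ ψ) l).prod ((C.restr ψ ξ l).prod (𝟭 _)) ⋙
        C.assocSource (A.restrict B φ (ξ ∘ ψ) l) (B.restrict D ψ ξ l) Z := by
  refine functor_eq_of_arrow fun X Y f => tarr_inj ?_
  obtain ⟨f, g, h⟩ := f
  refine tarr_comp rfl rfl _ _ ?_ _ _ _ _ _ _ ?_ _ _ rfl
  · intro i i' hi
    obtain rfl := Fin.ext hi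
    exact congrArg Fin.val (congrFun (frestr_frestr φ ψ ξ l) i)
  · intro k k' hk
    obtain rfl := Fin.ext hk
    refine tarr_comp (Word.fib_fib' A B D φ ψ ξ l k) (Word.fib_fib B D ψ ξ l k).symm _ _ ?_ _ _ _ _ _ _ ?_ _ _
      (tarr_cast _ _ _).symm
    · exact frestr_femb φ ψ ξ l k
    · intro j j' hj
      refine Eq.trans ?_ (tarr_cast _ _ _).symm
      exact tarr_idx f (femb_femb ψ ξ l k j' j hj.symm).symm

theorem assocTargetAt_eq {A B D : Word C.Ob} {p : ℕ} (φ : Fin A.len → Fin B.len)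
    (ψ : Fin B.len → Fin D.len) (ξ : Fin D.len → Fin p) (l : Fin p) (Z : C.Ob) :
    (C.restr φ (ξ ∘ ψ) l).prod ((C.restr ψ ξ l).prod (𝟭 _)) ⋙
        C.assocTarget (A.restrict B φ (ξ ∘ ψ) l) (B.restrict D ψ ξ l) Z =
      C.assocTargetAt φ ψ ξ l Z := by
  refine functor_eq_of_arrow fun X Y f => tarr_inj ?_
  obtain ⟨f, g, h⟩ := f
  refine tarr_comp rfl rfl _ _ (fun i i' h => by rw [Fin.ext h]) _ _ _ _ _ _ ?_ _ _ ?_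
  · intro j j' h
    obtain rfl := Fin.ext h
    exact tarr_cast _ _ _
  · refine tarr_comp rfl rfl _ _ (fun i i' h => by rw [Fin.ext h]) _ _ _ _ _ _ ?_ _ _ rfl
    intro j j' h
    obtain rfl := Fin.ext h
    exact tarr_cast _ _ _

end MultiCore
namespace MultiCore

variable (C : MultiCore.{v, w, u})

variable {C} in
theorem tarr_units (A : Word C.Ob) (i : Fin A.len) :
    tarr (𝟙 (C.units A i)) = tarr (𝟙 (C.one (A.col i))) := by
  rw [units, ← CategoryTheory.Functor.map_id]
  exact tarr_cast _ _ _

/-- The functor `u ↦ μ_{id|}((1_{A_i})_{i ∈ φ⁻¹ j}, u)`. -/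
noncomputable def lunitSourceAt {p : ℕ} (A : Word C.Ob) (φ : Fin A.len → Fin p) (j : Fin p)
    (Z : C.Ob) : C.Hom (A.fib φ j) Z ⥤ C.Hom (A.fib φ j) Z :=
  Prod.sectR (C.units A) _ ⋙ C.compAt (A := A) (B := A) id φ j Z

theorem lunitSourceAt_eq {p : ℕ} (A : Word C.Ob) (φ : Fin A.len → Fin p) (j : Fin p) (Z : C.Ob) :
    C.lunitSourceAt A φ j Z = C.lunitSource (A.fib φ j) Z := by
  refine functor_eq_of_arrow fun X Y f => tarr_inj ?_
  refine tarr_comp rfl rfl _ _ ?_ _ _ _ _ _ _ ?_ _ _ rfl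
  · intro i i' h
    obtain rfl := Fin.ext h
    exact congrArg Fin.val (fpos_femb _ _ _ _)
  · intro i i' h
    obtain rfl := Fin.ext h
    exact (tarr_units A (A.emb φ j i)).trans (tarr_units (A.fib φ j) i).symm

/-- The functor `(p_j)_j ↦ μ_{φ⁻¹ j → 1}(p_j, 1_{B_j})`. -/
noncomputable def runitSourceAt {A B : Word C.Ob} (φ : Fin A.len → Fin B.len) (j : Fin B.len) :
    (∀ j, C.Hom (A.fib φ j) (B.col j)) ⥤ C.Hom (A.fib φ j) (B.col j) :=
  Prod.sectL _ (C.units B j) ⋙ C.compAt φ id j (B.col j)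

theorem runitSourceAt_eq {A B : Word C.Ob} (φ : Fin A.len → Fin B.len) (j : Fin B.len) :
    C.runitSourceAt φ j =
      Pi.eval (fun j => C.Hom (A.fib φ j) (B.col j)) j ⋙ C.runitSource (A.fib φ j) (B.col j) := by
  refine functor_eq_of_arrow fun X Y f => tarr_inj ?_
  refine tarr_comp rfl (Word.fib_id B j) _ _ ?_ _ _ _ _ _ _ ?_ _ _ (tarr_units B j)
  · intro i i' _
    have h : ∀ t : Fin (Fintype.card {i : Fin B.len // id i = j}), t.val = 0 := by
      intro t
      have h1 := t.isLt
      have h2 := Word.card_fib_id j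
      omega
    exact h _
  · intro i i' _
    exact tarr_idx f (Word.femb_id j i)

end MultiCore

namespace SymWeakMultiData

variable (C : SymWeakMultiData.{v, w, u})

/-- The associator `ν` of the restricted maps
`φ⁻¹ψ⁻¹ξ⁻¹l → ψ⁻¹ξ⁻¹l → ξ⁻¹l`. -/
noncomputable def assocAt {A B D : Word C.Ob} {p : ℕ} (φ : Fin A.len → Fin B.len)
    (ψ : Fin B.len → Fin D.len) (ξ : Fin D.len → Fin p) (l : Fin p) (Z : C.Ob) :
    C.assocSourceAt φ ψ ξ l Z ≅ C.assocTargetAt φ ψ ξ l Z :=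
  eqToIso (C.assocSourceAt_eq φ ψ ξ l Z) ≪≫
    Functor.isoWhiskerLeft ((C.restr φ (ξ ∘ ψ) l).prod ((C.restr ψ ξ l).prod (𝟭 _)))
      (C.assoc (A.restrict B φ (ξ ∘ ψ) l) (B.restrict D ψ ξ l) Z) ≪≫
    eqToIso (C.assocTargetAt_eq φ ψ ξ l Z)

/-- The left unitor `θ` over the fibre `φ⁻¹ j`. -/
noncomputable def lunitAt {p : ℕ} (A : Word C.Ob) (φ : Fin A.len → Fin p) (j : Fin p) (Z : C.Ob) :
    C.lunitSourceAt A φ j Z ≅ 𝟭 _ :=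
  eqToIso (C.lunitSourceAt_eq A φ j Z) ≪≫ C.lunit (A.fib φ j) Z

/-- The right unitor `ζ` over the fibre `φ⁻¹ j`. -/
noncomputable def runitAt {A B : Word C.Ob} (φ : Fin A.len → Fin B.len) (j : Fin B.len) :
    C.runitSourceAt φ j ≅ Pi.eval (fun j => C.Hom (A.fib φ j) (B.col j)) j :=
  eqToIso (C.runitSourceAt_eq φ j) ≪≫
    Functor.isoWhiskerLeft (Pi.eval (fun j => C.Hom (A.fib φ j) (B.col j)) j)
      (C.runit (A.fib φ j) (B.col j))

end SymWeakMultiData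
/-- Symmetric weak multicategories: the associator satisfies the pentagon equation, the associator
and the unitors satisfy the triangle equation. -/
structure SymWeakMulticategory extends SymWeakMultiData.{v, w, u} where
  pentagon : ∀ {A B D E : Word Ob} (φ : Fin A.len → Fin B.len) (ψ : Fin B.len → Fin D.len)
    (ξ : Fin D.len → Fin E.len) (Z : Ob) (p : ∀ j, Hom (A.fib φ j) (B.col j))
    (q : ∀ k, Hom (B.fib ψ k) (D.col k)) (s : ∀ l, Hom (D.fib ξ l) (E.col l)) (z : Hom E Z),
    (toMultiCore.mu (ξ ∘ ψ ∘ φ) Z).map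
        (X := (fun l => (toMultiCore.assocSourceAt φ ψ ξ l (E.col l)).obj (p, q, s l), z))
        (Y := (fun l => (toMultiCore.assocTargetAt φ ψ ξ l (E.col l)).obj (p, q, s l), z))
        (fun l => (toSymWeakMultiData.assocAt φ ψ ξ l (E.col l)).hom.app (p, q, s l), 𝟙 z) ≫
      (assoc φ (ξ ∘ ψ) Z).hom.app
        (p, fun l => (toMultiCore.compAt ψ ξ l (E.col l)).obj (q, s l), z) ≫
      (toMultiCore.mu φ Z).map
        (X := (p, (toMultiCore.assocSource ψ ξ Z).obj (q, s, z)))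
        (Y := (p, (toMultiCore.assocTarget ψ ξ Z).obj (q, s, z)))
        (𝟙 p, (assoc ψ ξ Z).hom.app (q, s, z)) =
    (assoc (ψ ∘ φ) ξ Z).hom.app
        (fun k => (toMultiCore.compAt φ ψ k (D.col k)).obj (p, q k), s, z) ≫
      (assoc φ ψ Z).hom.app (p, q, (toMultiCore.mu ξ Z).obj (s, z))
  triangle : ∀ {A B : Word Ob} (φ : Fin A.len → Fin B.len) (Z : Ob)
    (p : ∀ j, Hom (A.fib φ j) (B.col j)) (z : Hom B Z),
    (assoc φ id Z).hom.app (p, toMultiCore.units B, z) ≫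
      (toMultiCore.mu φ Z).map (X := (p, (toMultiCore.lunitSource B Z).obj z)) (Y := (p, z))
        (𝟙 p, (lunit B Z).hom.app z) =
    (toMultiCore.mu φ Z).map
      (X := (fun j => (toMultiCore.runitSourceAt φ j).obj p, z)) (Y := (p, z))
      (fun j => (toSymWeakMultiData.runitAt φ j).hom.app p, 𝟙 z)

/-! ### Symmetric weak multifunctors -/

/-- The data of a symmetric weak multifunctor. -/
structure SymWeakMultifunctorData (C : SymWeakMulticategory.{v, w, u})
    (D : SymWeakMulticategory.{v, w, u}) where
  ob : C.Ob → D.Ob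
  fn : ∀ (A : Word C.Ob) (Y : C.Ob), C.Hom A Y ⥤ D.Hom (A.map ob) (ob Y)
  /-- The isomorphism `F^φ : μ_φ((F p_j)_j, F z) ≅ F μ_φ((p_j)_j, z)`. -/
  comp : ∀ {A B : Word C.Ob} (φ : Fin A.len → Fin B.len) (W : Fin B.len → Word C.Ob)
    (hW : ∀ j, W j = A.fib φ j) (Z : C.Ob),
    (Functor.pi fun j => fn (W j) (B.col j)).prod (fn B Z) ⋙
        D.comp (A := A.map ob) (B := B.map ob) φ (fun j => (W j).map ob)
          (fun j => congrArg (Word.map ob) (hW j)) (ob Z) ≅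
      C.comp φ W hW Z ⋙ fn A Z
  /-- The isomorphism `F_X : 1_{FX} ≅ F 1_X`. -/
  one : ∀ X : C.Ob, D.one (ob X) ≅ (fn (Word.single X) X).obj (C.one X)

namespace SymWeakMultifunctorData

variable {C : SymWeakMulticategory.{v, w, u}} {D : SymWeakMulticategory.{v, w, u}}
  (F : SymWeakMultifunctorData C D)

/-- `F^φ` for the canonical choice of fibre words. -/
noncomputable def mu {A B : Word C.Ob} (φ : Fin A.len → Fin B.len) (Z : C.Ob) :
    (Functor.pi fun j => F.fn (A.fib φ j) (B.col j)).prod (F.fn B Z) ⋙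
        D.mu (A := A.map F.ob) (B := B.map F.ob) φ (F.ob Z) ≅
      C.mu φ Z ⋙ F.fn A Z :=
  F.comp φ (fun j => A.fib φ j) (fun _ => rfl) Z

/-- The isomorphism `F^{φ|}` for the restricted map `φ| : φ⁻¹ψ⁻¹k → ψ⁻¹k`. -/
noncomputable def compAt {A B : Word C.Ob} {p : ℕ} (φ : Fin A.len → Fin B.len)
    (ψ : Fin B.len → Fin p) (k : Fin p) (Z : C.Ob) :
    (Functor.pi fun j => F.fn (A.fib φ j) (B.col j)).prod (F.fn (B.fib ψ k) Z) ⋙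
        D.compAt (A := A.map F.ob) (B := B.map F.ob) φ ψ k (F.ob Z) ≅
      C.compAt φ ψ k Z ⋙ F.fn (A.fib (ψ ∘ φ) k) Z :=
  Functor.isoWhiskerLeft
    ((Pi.comap (fun j => C.Hom (A.fib φ j) (B.col j)) (B.emb ψ k)).prod (𝟭 (C.Hom (B.fib ψ k) Z)))
    (F.comp (A := A.fib (ψ ∘ φ) k) (B := B.fib ψ k) (A.restrict B φ ψ k)
      (fun j => A.fib φ (B.emb ψ k j)) (fun j => (Word.fib_fib A B φ ψ k j).symm) Z)

/-- `F_X`, as an isomorphism in a hom-category indexed by a word equal to `X`. -/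
def oneCast {A : Word C.Ob} {X : C.Ob} (h : Word.single X = A) :
    (D.cast (congrArg (Word.map F.ob) h) (rfl : F.ob X = F.ob X)).obj (D.one (F.ob X)) ≅
      (F.fn A X).obj ((C.cast h rfl).obj (C.one X)) := by
  subst h
  exact F.one X

/-- The isomorphisms `F_{A_i} : 1_{F A_i} ≅ F 1_{A_i}`. -/
noncomputable def units (A : Word C.Ob) (i : Fin A.len) :
    D.units (A.map F.ob) i ≅ (F.fn (A.fib id i) (A.col i)).obj (C.units A i) :=
  F.oneCast (Word.fib_id A i).symm

end SymWeakMultifunctorData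

/-- Symmetric weak multifunctors: the structure isomorphisms are compatible with the associators
and the unitors. -/
structure SymWeakMultifunctor (C : SymWeakMulticategory.{v, w, u})
    (D : SymWeakMulticategory.{v, w, u}) extends SymWeakMultifunctorData C D where
  map_assoc : ∀ {A B E : Word C.Ob} (φ : Fin A.len → Fin B.len) (ψ : Fin B.len → Fin E.len)
    (Z : C.Ob) (p : ∀ j, C.Hom (A.fib φ j) (B.col j)) (q : ∀ k, C.Hom (B.fib ψ k) (E.col k))
    (z : C.Hom E Z),
    (D.mu (A := A.map ob) (B := E.map ob) (ψ ∘ φ) (ob Z)).map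
        (X := (fun k => (D.compAt (A := A.map ob) (B := B.map ob) φ ψ k (ob (E.col k))).obj
          (fun j => (fn _ _).obj (p j), (fn _ _).obj (q k)), (fn _ _).obj z))
        (Y := (fun k => (fn _ _).obj ((C.compAt φ ψ k (E.col k)).obj (p, q k)), (fn _ _).obj z))
        (fun k => (toSymWeakMultifunctorData.compAt φ ψ k (E.col k)).hom.app (p, q k), 𝟙 _) ≫
      (toSymWeakMultifunctorData.mu (ψ ∘ φ) Z).hom.app
        (fun k => (C.compAt φ ψ k (E.col k)).obj (p, q k), z) ≫
      (fn A Z).map ((C.assoc φ ψ Z).hom.app (p, q, z)) =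
    (D.assoc (A := A.map ob) (B := B.map ob) (D := E.map ob) φ ψ (ob Z)).hom.app
        (fun j => (fn _ _).obj (p j), fun k => (fn _ _).obj (q k), (fn _ _).obj z) ≫
      (D.mu (A := A.map ob) (B := B.map ob) φ (ob Z)).map
        (X := (fun j => (fn _ _).obj (p j), (D.mu (A := B.map ob) (B := E.map ob) ψ (ob Z)).obj
          (fun k => (fn _ _).obj (q k), (fn _ _).obj z)))
        (Y := (fun j => (fn _ _).obj (p j), (fn _ _).obj ((C.mu ψ Z).obj (q, z))))
        (𝟙 _, (toSymWeakMultifunctorData.mu ψ Z).hom.app (q, z)) ≫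
      (toSymWeakMultifunctorData.mu φ Z).hom.app (p, (C.mu ψ Z).obj (q, z))
  map_runit : ∀ (A : Word C.Ob) (Y : C.Ob) (x : C.Hom A Y),
    (D.comp (A := A.map ob) (B := Word.single (ob Y)) (fun _ => (0 : Fin 1)) (fun _ => A.map ob)
        (fun j => (Word.fib_const (A.map ob) _ j
          fun _ => Subsingleton.elim (α := Fin 1) _ _).symm) (ob Y)).map
        (X := (fun _ => (fn A Y).obj x, D.one (ob Y)))
        (Y := (fun _ => (fn A Y).obj x, (fn _ _).obj (C.one Y)))
        (𝟙 _, (one Y).hom) ≫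
      (comp (A := A) (B := Word.single Y) (fun _ => (0 : Fin 1)) (fun _ => A)
        (fun j => (Word.fib_const A _ j
          fun _ => Subsingleton.elim (α := Fin 1) _ _).symm) Y).hom.app (fun _ => x, C.one Y) ≫
      (fn A Y).map ((C.runit A Y).hom.app x) =
    (D.runit (A.map ob) (ob Y)).hom.app ((fn A Y).obj x)
  map_lunit : ∀ (A : Word C.Ob) (Z : C.Ob) (z : C.Hom A Z),
    (D.mu (A := A.map ob) (B := A.map ob) id (ob Z)).map
        (X := (D.units (A.map ob), (fn A Z).obj z))
        (Y := (fun i => (fn _ _).obj (C.units A i), (fn A Z).obj z))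
        (fun i => (toSymWeakMultifunctorData.units A i).hom, 𝟙 _) ≫
      (toSymWeakMultifunctorData.mu id Z).hom.app (C.units A, z) ≫
      (fn A Z).map ((C.lunit A Z).hom.app z) =
    (D.lunit (A.map ob) (ob Z)).hom.app ((fn A Z).obj z)
/-! ### Reindexing of concatenations -/

namespace Word

/-- Reindexing of a lexicographically ordered disjoint union. -/
noncomputable def lexCongr {S : Type*} {I I' : Type} [LinearOrder I] [LinearOrder I']
    (e : I ≃o I') (A : I' → Word S) :
    (Σₗ i : I, Fin (A (e i)).len) ≃o (Σₗ i : I', Fin (A i).len) :=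
  let E : (Σₗ i : I, Fin (A (e i)).len) ≃ (Σₗ i : I', Fin (A i).len) :=
    ofLex.trans ((Equiv.sigmaCongrLeft (β := fun i => Fin (A i).len) e.toEquiv).trans toLex)
  have hE : StrictMono E := by
    intro x y hxy
    rw [Sigma.Lex.lt_def] at hxy ⊢
    obtain ⟨i, s⟩ := x
    obtain ⟨j, t⟩ := y
    rcases hxy with hxy | ⟨e', hxy⟩
    · exact Or.inl (e.strictMono hxy)
    · refine Or.inr ?_
      have e'' : i = j := e'
      subst e''
      exact ⟨rfl, hxy⟩
  hE.orderIsoOfSurjective E E.surjective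

theorem concat_congr {S : Type*} {I I' : Type} [Fintype I] [LinearOrder I] [Fintype I']
    [LinearOrder I'] (e : I ≃o I') (A : I → Word S) (A' : I' → Word S)
    (h : ∀ i, A i = A' (e i)) : concat A = concat A' := by
  obtain rfl : A = fun i => A' (e i) := funext h
  exact ofFamily_congr (lexCongr e A') _ _ fun _ => rfl

/-- If `f` is constant, then `f⁻¹ l` is everything. -/
theorem concat_const {S : Type*} {I L : ℕ} (f : Fin I → Fin L) (l : Fin L) (h : ∀ i, f i = l)
    (A : Fin I → Word S) : (concat fun i : {i // f i = l} => A i) = concat A :=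
  concat_congr ⟨Equiv.subtypeUnivEquiv h, Iff.rfl⟩ _ _ fun _ => rfl

/-- The concatenation over a fibre, in terms of the enumeration of the fibre. -/
theorem concat_femb {S : Type*} {I L : ℕ} (f : Fin I → Fin L) (l : Fin L)
    (A : Fin I → Word S) :
    (concat fun i => A (femb f l i)) = concat fun i : {i // f i = l} => A i :=
  concat_congr (monoEquivOfFin {i // f i = l} rfl) _ _ fun _ => rfl

/-- The concatenation over a fibre of `f`, and the concatenation over the same fibre enumerated
inside a fibre of `h ∘ f`. -/
theorem concat_frestr {S : Type*} {I K L : ℕ} (f : Fin I → Fin K) (h : Fin K → Fin L) (l : Fin L)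
    (k : Fin (Fintype.card {k // h k = l})) (A : Fin I → Word S) :
    (concat fun i : {i // f i = femb h l k} => A i) =
      concat fun i : {i // frestr f h l i = k} => A (femb (h ∘ f) l i) := by
  refine (concat_femb f _ A).symm.trans (Eq.trans ?_ (concat_femb (frestr f h l) k
    (fun i => A (femb (h ∘ f) l i))))
  refine concat_congr (Fin.castOrderIso (femb_femb_card f h l k).symm) _ _ fun s => ?_
  exact congrArg A (femb_femb f h l k _ s rfl).symm

end Word

/-! ### Biprops -/

/-- The data of a biprop: colours, hom-categories indexed by pairs of words in the colours, units,
compositions, associators, unitors and tensor product functors. -/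
structure BipropData where
  Col : Type u
  Hom : Word Col → Word Col → Type v
  cat : ∀ A B, Category.{w} (Hom A B)
  one : ∀ A, Hom A A
  m : ∀ A B D, (Hom A B × Hom B D) ⥤ Hom A D
  a : ∀ A B D E,
    Functor.prod' (Functor.prod' (CategoryTheory.Prod.fst (Hom A B) (Hom B D × Hom D E))
        (CategoryTheory.Prod.snd _ _ ⋙ CategoryTheory.Prod.fst _ _) ⋙ m A B D)
        (CategoryTheory.Prod.snd _ _ ⋙ CategoryTheory.Prod.snd _ _) ⋙ m A D E ≅
      (𝟭 (Hom A B)).prod (m B D E) ⋙ m A B E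
  l : ∀ A B, Prod.sectR (one A) (Hom A B) ⋙ m A A B ≅ 𝟭 (Hom A B)
  r : ∀ A B, Prod.sectL (Hom A B) (one B) ⋙ m A B B ≅ 𝟭 (Hom A B)
  /-- The functor `⊗^{f,g}` for a cospan `f : I → L ← J : g`. -/
  tensor : ∀ {I J L : ℕ} (f : Fin I → Fin L) (g : Fin J → Fin L) (A : Fin I → Word Col)
    (B : Fin J → Word Col),
    (∀ l, Hom (Word.concat fun i : {i // f i = l} => A i)
      (Word.concat fun j : {j // g j = l} => B j)) ⥤ Hom (Word.concat A) (Word.concat B)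

namespace BipropData

attribute [instance] BipropData.cat

variable (P : BipropData.{v, w, u})

/-- Transport of hom-categories along equalities of words. -/
def cast {A A' B B' : Word P.Col} (hA : A = A') (hB : B = B') :
    P.Hom A B ⥤ P.Hom A' B' := by
  subst hA hB
  exact 𝟭 _

/-- The functor `⊗` for the restrictions `α⁻¹l → h⁻¹l ← β⁻¹l` of `f` and `g`, where `α = h ∘ f`
and `β = h ∘ g`, precomposed with the projection onto the factors indexed by `h⁻¹l`. -/
noncomputable def tensorAt {I J K L : ℕ} (f : Fin I → Fin K) (g : Fin J → Fin K)
    (h : Fin K → Fin L) (l : Fin L) (A : Fin I → Word P.Col) (B : Fin J → Word P.Col) :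
    (∀ k, P.Hom (Word.concat fun i : {i // f i = k} => A i)
      (Word.concat fun j : {j // g j = k} => B j)) ⥤
      P.Hom (Word.concat fun i : {i // (h ∘ f) i = l} => A i)
        (Word.concat fun j : {j // (h ∘ g) j = l} => B j) :=
  (Functor.pi' fun k =>
    Pi.eval (fun k => P.Hom (Word.concat fun i : {i // f i = k} => A i)
        (Word.concat fun j : {j // g j = k} => B j)) (femb h l k) ⋙
      P.cast (Word.concat_frestr f h l k A) (Word.concat_frestr g h l k B)) ⋙
    P.tensor (frestr f h l) (frestr g h l) (fun i => A (femb (h ∘ f) l i))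
      (fun j => B (femb (h ∘ g) l j)) ⋙
    P.cast (Word.concat_femb (h ∘ f) l A) (Word.concat_femb (h ∘ g) l B)

end BipropData

/-- Biprops. Two natural transformations, whose sources and targets agree by previous axioms, are
compared by comparing their components as objects of the arrow category. -/
structure Biprop extends BipropData.{v, w, u} where
  pentagon : ∀ (A B D E G : Word Col) (x : Hom A B) (y : Hom B D) (z : Hom D E) (t : Hom E G),
    (m A E G).map (X := ((m A D E).obj ((m A B D).obj (x, y), z), t))
        (Y := ((m A B E).obj (x, (m B D E).obj (y, z)), t))
        ((a A B D E).hom.app (x, y, z), 𝟙 t) ≫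
      (a A B E G).hom.app (x, (m B D E).obj (y, z), t) ≫
      (m A B G).map (X := (x, (m B E G).obj ((m B D E).obj (y, z), t)))
        (Y := (x, (m B D G).obj (y, (m D E G).obj (z, t))))
        (𝟙 x, (a B D E G).hom.app (y, z, t)) =
    (a A D E G).hom.app ((m A B D).obj (x, y), z, t) ≫
      (a A B D G).hom.app (x, y, (m D E G).obj (z, t))
  triangle : ∀ (A B D : Word Col) (x : Hom A B) (y : Hom B D),
    (a A B B D).hom.app (x, one B, y) ≫
      (m A B D).map (X := (x, (m B B D).obj (one B, y))) (Y := (x, y))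
        (𝟙 x, (l B D).hom.app y) =
    (m A B D).map (X := ((m A B B).obj (x, one B), y)) (Y := (x, y)) ((r A B).hom.app x, 𝟙 y)
  /-- The tensor product functors preserve compositions. -/
  tensor_m : ∀ {I J K L : ℕ} (f : Fin I → Fin L) (g : Fin J → Fin L) (h : Fin K → Fin L)
    (A : Fin I → Word Col) (B : Fin J → Word Col) (D : Fin K → Word Col),
    (tensor f g A B).prod (tensor g h B D) ⋙
        m (Word.concat A) (Word.concat B) (Word.concat D) =
      (Functor.pi' fun l => (Pi.eval _ l).prod (Pi.eval _ l) ⋙ m _ _ _) ⋙ tensor f h A D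
  /-- The tensor product functors preserve associators. -/
  tensor_a : ∀ {I J K L N : ℕ} (f : Fin I → Fin N) (g : Fin J → Fin N) (h : Fin K → Fin N)
    (e : Fin L → Fin N) (A : Fin I → Word Col) (B : Fin J → Word Col) (D : Fin K → Word Col)
    (E : Fin L → Word Col)
    (x : ∀ n, Hom (Word.concat fun i : {i // f i = n} => A i)
      (Word.concat fun j : {j // g j = n} => B j))
    (y : ∀ n, Hom (Word.concat fun j : {j // g j = n} => B j)
      (Word.concat fun k : {k // h k = n} => D k))
    (z : ∀ n, Hom (Word.concat fun k : {k // h k = n} => D k)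
      (Word.concat fun l : {l // e l = n} => E l)),
    Arrow.mk ((tensor f e A E).map
        (X := fun n => (m _ _ _).obj ((m _ _ _).obj (x n, y n), z n))
        (Y := fun n => (m _ _ _).obj (x n, (m _ _ _).obj (y n, z n)))
        (fun n => (a _ _ _ _).hom.app (x n, y n, z n))) =
      Arrow.mk ((a (Word.concat A) (Word.concat B) (Word.concat D) (Word.concat E)).hom.app
        ((tensor f g A B).obj x, (tensor g h B D).obj y, (tensor h e D E).obj z))
  /-- The functor `⊗^{I → 1 ← J}` is the identity functor. -/
  tensor_id : ∀ {I J : ℕ} (f : Fin I → Fin 1) (g : Fin J → Fin 1) (A : Fin I → Word Col)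
    (B : Fin J → Word Col),
    tensor f g A B = Pi.eval (fun l => Hom (Word.concat fun i : {i // f i = l} => A i)
        (Word.concat fun j : {j // g j = l} => B j)) 0 ⋙ toBipropData.cast
      (Word.concat_const f 0 (fun _ => Subsingleton.elim _ _) A)
      (Word.concat_const g 0 (fun _ => Subsingleton.elim _ _) B)
  /-- The tensor product functors preserve units. -/
  tensor_unit : ∀ {I L : ℕ} (f : Fin I → Fin L) (A : Fin I → Word Col),
    (tensor f f A A).obj (fun _ => one _) = one (Word.concat A)
  /-- The tensor product functors preserve left unitors. -/
  tensor_l : ∀ {I J K : ℕ} (f : Fin I → Fin K) (g : Fin J → Fin K)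
    (A : Fin I → Word Col) (B : Fin J → Word Col)
    (x : ∀ k, Hom (Word.concat fun i : {i // f i = k} => A i)
      (Word.concat fun j : {j // g j = k} => B j)),
    Arrow.mk ((tensor f g A B).map (X := fun k => (m _ _ _).obj (one _, x k)) (Y := x)
        (fun k => (l _ _).hom.app (x k))) =
      Arrow.mk ((l (Word.concat A) (Word.concat B)).hom.app ((tensor f g A B).obj x))
  /-- The tensor product functors preserve right unitors. -/
  tensor_r : ∀ {I J K : ℕ} (f : Fin I → Fin K) (g : Fin J → Fin K)
    (A : Fin I → Word Col) (B : Fin J → Word Col)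
    (x : ∀ k, Hom (Word.concat fun i : {i // f i = k} => A i)
      (Word.concat fun j : {j // g j = k} => B j)),
    Arrow.mk ((tensor f g A B).map (X := fun k => (m _ _ _).obj (x k, one _)) (Y := x)
        (fun k => (r _ _).hom.app (x k))) =
      Arrow.mk ((r (Word.concat A) (Word.concat B)).hom.app ((tensor f g A B).obj x))
  /-- Strictness of the tensor multiplication. -/
  tensor_tensor : ∀ {I J K L : ℕ} (f : Fin I → Fin K) (g : Fin J → Fin K) (h : Fin K → Fin L)
    (A : Fin I → Word Col) (B : Fin J → Word Col),
    tensor f g A B = (Functor.pi' fun l => toBipropData.tensorAt f g h l A B) ⋙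
      tensor (h ∘ f) (h ∘ g) A B
/-- The data of a morphism of biprops. -/
structure BipropMorphismData (P R : Biprop.{v, w, u}) where
  col : P.Col → R.Col
  fn : ∀ A B, P.Hom A B ⥤ R.Hom (A.map col) (B.map col)
  comp : ∀ A B D, (fn A B).prod (fn B D) ⋙ R.m (A.map col) (B.map col) (D.map col) ≅
    P.m A B D ⋙ fn A D
  one : ∀ A, R.one (A.map col) ≅ (fn A A).obj (P.one A)

structure BipropMorphismData.IsMorphism {P R : Biprop.{v, w, u}}
    (F : BipropMorphismData P R) :
    Prop where
  tensor_fn : ∀ {I J L : ℕ} (f : Fin I → Fin L) (g : Fin J → Fin L) (A : Fin I → Word P.Col)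
    (B : Fin J → Word P.Col),
    P.tensor f g A B ⋙ F.fn (Word.concat A) (Word.concat B) =
      Functor.pi (fun l => F.fn (Word.concat fun i : {i // f i = l} => A i)
          (Word.concat fun j : {j // g j = l} => B j)) ⋙
        R.tensor f g (fun i => (A i).map F.col) (fun j => (B j).map F.col)
  tensor_comp : ∀ {I J K L : ℕ} (f : Fin I → Fin L) (g : Fin J → Fin L) (h : Fin K → Fin L)
    (A : Fin I → Word P.Col) (B : Fin J → Word P.Col) (D : Fin K → Word P.Col)
    (x : ∀ l, P.Hom (Word.concat fun i : {i // f i = l} => A i)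
      (Word.concat fun j : {j // g j = l} => B j))
    (y : ∀ l, P.Hom (Word.concat fun j : {j // g j = l} => B j)
      (Word.concat fun k : {k // h k = l} => D k)),
    Arrow.mk ((F.comp (Word.concat A) (Word.concat B) (Word.concat D)).hom.app
        ((P.tensor f g A B).obj x, (P.tensor g h B D).obj y)) =
      Arrow.mk ((R.tensor f h (fun i => (A i).map F.col) (fun k => (D k).map F.col)).map
        (X := fun l => (R.m _ _ _).obj ((F.fn _ _).obj (x l), (F.fn _ _).obj (y l)))
        (Y := fun l => (F.fn _ _).obj ((P.m _ _ _).obj (x l, y l)))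
        (fun l => (F.comp _ _ _).hom.app (x l, y l)))
  comp_assoc : ∀ (A B D E : Word P.Col) (x : P.Hom A B) (y : P.Hom B D) (z : P.Hom D E),
    (R.m (A.map F.col) (D.map F.col) (E.map F.col)).map
        (X := ((R.m _ _ _).obj ((F.fn A B).obj x, (F.fn B D).obj y), (F.fn D E).obj z))
        (Y := ((F.fn A D).obj ((P.m A B D).obj (x, y)), (F.fn D E).obj z))
        ((F.comp A B D).hom.app (x, y), 𝟙 _) ≫
      (F.comp A D E).hom.app ((P.m A B D).obj (x, y), z) ≫
      (F.fn A E).map ((P.a A B D E).hom.app (x, y, z)) =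
    (R.a (A.map F.col) (B.map F.col) (D.map F.col) (E.map F.col)).hom.app
        ((F.fn A B).obj x, (F.fn B D).obj y, (F.fn D E).obj z) ≫
      (R.m (A.map F.col) (B.map F.col) (E.map F.col)).map
        (X := ((F.fn A B).obj x, (R.m _ _ _).obj ((F.fn B D).obj y, (F.fn D E).obj z)))
        (Y := ((F.fn A B).obj x, (F.fn B E).obj ((P.m B D E).obj (y, z))))
        (𝟙 _, (F.comp B D E).hom.app (y, z)) ≫
      (F.comp A B E).hom.app (x, (P.m B D E).obj (y, z))
  comp_r : ∀ (A B : Word P.Col) (x : P.Hom A B),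
    (R.m (A.map F.col) (B.map F.col) (B.map F.col)).map
        (X := ((F.fn A B).obj x, R.one (B.map F.col)))
        (Y := ((F.fn A B).obj x, (F.fn B B).obj (P.one B))) (𝟙 _, (F.one B).hom) ≫
      (F.comp A B B).hom.app (x, P.one B) ≫ (F.fn A B).map ((P.r A B).hom.app x) =
    (R.r (A.map F.col) (B.map F.col)).hom.app ((F.fn A B).obj x)
  comp_l : ∀ (A B : Word P.Col) (x : P.Hom A B),
    (R.m (A.map F.col) (A.map F.col) (B.map F.col)).map
        (X := (R.one (A.map F.col), (F.fn A B).obj x))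
        (Y := ((F.fn A A).obj (P.one A), (F.fn A B).obj x)) ((F.one A).hom, 𝟙 _) ≫
      (F.comp A A B).hom.app (P.one A, x) ≫ (F.fn A B).map ((P.l A B).hom.app x) =
    (R.l (A.map F.col) (B.map F.col)).hom.app ((F.fn A B).obj x)
/-! ### Letters of a concatenation -/

namespace Word

variable {S : Type*} {I : Type} [Fintype I] [LinearOrder I]

/-- The letters of `⨆_{i ∈ I} A_i` are the letters of the words `A_i`. -/
noncomputable def letters (A : I → Word S) :
    Fin (concat A).len ≃o (Σₗ i : I, Fin (A i).len) :=
  monoEquivOfFin (Σₗ i : I, Fin (A i).len) rfl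

/-- The projection `pr_I : ⨆_{i ∈ I} S_i → I` from the letters of `⨆_{i ∈ I} A_i`. -/
noncomputable def pr (A : I → Word S) (s : Fin (concat A).len) : I := (ofLex (letters A s)).1

variable {I L : ℕ} (f : Fin I → Fin L) (A : Fin I → Word S)

/-- The inclusion `⨆_{i ∈ f⁻¹l} S_i ↪ ⨆_{i ∈ I} S_i` of sets of letters. -/
noncomputable def incl (l : Fin L) (s : Fin (concat fun i : {i // f i = l} => A i).len) :
    Fin (concat A).len :=
  (letters A).symm (toLex ⟨(pr (fun i : {i // f i = l} => A i) s).1,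
    (ofLex (letters (fun i : {i // f i = l} => A i) s)).2⟩)

/-- The inverse of `incl` on letters which project to `f⁻¹l`. -/
noncomputable def place (l : Fin L) (s : Fin (concat A).len) (h : f (pr A s) = l) :
    Fin (concat fun i : {i // f i = l} => A i).len :=
  (letters fun i : {i // f i = l} => A i).symm
    (toLex ⟨⟨pr A s, h⟩, (ofLex (letters A s)).2⟩)

theorem incl_place (l : Fin L) (s : Fin (concat A).len) (h : f (pr A s) = l) :
    incl f A l (place f A l s h) = s := by
  unfold incl place pr
  rw [OrderIso.symm_apply_eq, OrderIso.apply_symm_apply]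
  rfl

theorem f_pr_incl (l : Fin L) (s : Fin (concat fun i : {i // f i = l} => A i).len) :
    f (pr A (incl f A l s)) = l := by
  simp only [incl, pr, OrderIso.apply_symm_apply, ofLex_toLex]
  exact (pr (fun i : {i // f i = l} => A i) s).2

theorem incl_strictMono (l : Fin L) : StrictMono (incl f A l) := by
  intro s t h
  apply (letters A).symm.strictMono
  have h' := (letters (fun i : {i // f i = l} => A i)).strictMono h
  unfold pr
  generalize letters (fun i : {i // f i = l} => A i) s = x at h' ⊢
  generalize letters (fun i : {i // f i = l} => A i) t = y at h' ⊢
  rw [Sigma.Lex.lt_def] at h' ⊢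
  obtain ⟨⟨i, hi⟩, x⟩ := x
  obtain ⟨⟨j, hj⟩, y⟩ := y
  rcases h' with h' | ⟨e, h'⟩
  · exact Or.inl h'
  · refine Or.inr ?_
    have e' : i = j := congrArg Subtype.val e
    subst e'
    exact ⟨rfl, h'⟩

theorem place_incl (l : Fin L) (s : Fin (concat fun i : {i // f i = l} => A i).len)
    (h : f (pr A (incl f A l s)) = l) : place f A l (incl f A l s) h = s :=
  (incl_strictMono f A l).injective (incl_place f A l _ h)

theorem col_incl (l : Fin L) (s : Fin (concat fun i : {i // f i = l} => A i).len) :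
    (concat A).col (incl f A l s) = (concat fun i : {i // f i = l} => A i).col s := by
  change (A (ofLex (letters A (incl f A l s))).1).col (ofLex (letters A (incl f A l s))).2 = _
  rw [incl, OrderIso.apply_symm_apply]
  rfl

variable {J : ℕ} (g : Fin J → Fin L) (B : Fin J → Word S)

/-- The map `φ` assembled from maps
`φ_l : ⨆_{i ∈ f⁻¹l} S_i → ⨆_{j ∈ g⁻¹l} Q_j`. -/
noncomputable def glue (φ : ∀ l, Fin (concat fun i : {i // f i = l} => A i).len →
      Fin (concat fun j : {j // g j = l} => B j).len) (s : Fin (concat A).len) :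
    Fin (concat B).len :=
  incl g B (f (pr A s)) (φ (f (pr A s)) (place f A _ s rfl))

variable (φ : ∀ l, Fin (concat fun i : {i // f i = l} => A i).len →
      Fin (concat fun j : {j // g j = l} => B j).len)

theorem glue_incl (l : Fin L) (s : Fin (concat fun i : {i // f i = l} => A i).len) :
    glue f A g B φ (incl f A l s) = incl g B l (φ l s) := by
  have h : ∀ l' (h : f (pr A (incl f A l s)) = l'),
      incl g B l' (φ l' (place f A l' (incl f A l s) h)) = incl g B l (φ l s) := by
    intro l' h
    obtain rfl : l' = l := h.symm.trans (f_pr_incl f A l s)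
    rw [place_incl]
  exact h _ rfl

theorem range_incl_femb (q : Fin (concat B).len) (l : Fin L) (h : g (pr B q) = l) :
    Set.range (fun s => incl f A l (femb (φ l) (place g B l q h) s)) =
      Set.range (femb (glue f A g B φ) q) := by
  rw [range_femb]
  ext s
  constructor
  · rintro ⟨t, rfl⟩
    change glue f A g B φ _ = q
    rw [glue_incl, femb_spec (φ l), incl_place]
  · intro hs
    have hs' : glue f A g B φ s = q := hs
    have hl : f (pr A s) = l := by
      rw [← h, ← hs']
      exact (f_pr_incl g B _ _).symm
    refine ⟨fpos _ _ (place f A l s hl) ?_, ?_⟩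
    · apply (incl_strictMono g B l).injective
      rw [← glue_incl f A, incl_place, incl_place, hs']
    · simp only [femb_fpos, incl_place]

theorem fib_glue_aux (q : Fin (concat B).len) (l : Fin L) (h : g (pr B q) = l) :
    Fintype.card {s // φ l s = place g B l q h} = Fintype.card {s // glue f A g B φ s = q} ∧
      ∀ s s', s.val = s'.val → incl f A l (femb (φ l) (place g B l q h) s) =
        femb (glue f A g B φ) q s' :=
  enum_unique ((incl_strictMono f A l).comp (femb_strictMono (φ l) (place g B l q h)))
    (femb_strictMono (glue f A g B φ) q) (range_incl_femb f A g B φ q l h)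

/-- The fibre of the assembled map is the fibre of the corresponding map `φ_l`. -/
theorem fib_glue (q : Fin (concat B).len) (l : Fin L) (h : g (pr B q) = l) :
    (concat fun i : {i // f i = l} => A i).fib (φ l) (place g B l q h) =
      (concat A).fib (glue f A g B φ) q :=
  ext_val (fib_glue_aux f A g B φ q l h).1 fun s s' hs =>
    (col_incl f A l _).symm.trans
      (congrArg (concat A).col ((fib_glue_aux f A g B φ q l h).2 s s' hs))

theorem col_place (q : Fin (concat B).len) (l : Fin L) (h : g (pr B q) = l) :
    (concat fun j : {j // g j = l} => B j).col (place g B l q h) = (concat B).col q := by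
  rw [← col_incl, incl_place]

end Word

/-! ### Disjoint unions of categories -/

section SigmaFunctors

/-- The functor between disjoint unions induced by a map of index sets and functors. -/
def sigmaFunctor {I K : Type*} {P : I → Type*} {R : K → Type*} [∀ i, Category* (P i)]
    [∀ k, Category* (R k)] (op : I → K) (G : ∀ i, P i ⥤ R (op i)) :
    (Σ i, P i) ⥤ Σ k, R k :=
  Sigma.desc fun i => G i ⋙ Sigma.incl (op i)

/-- The distributivity isomorphism `(∐_i P_i) × (∐_j Q_j) ≅ ∐_{(i,j)} P_i × Q_j`. -/
def prodSigma {I J : Type*} {P : I → Type*} {Q : J → Type*} [∀ i, Category* (P i)]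
    [∀ j, Category* (Q j)] :
    ((Σ i, P i) × (Σ j, Q j)) ⥤ Σ k : I × J, P k.1 × Q k.2 where
  obj x := ⟨(x.1.1, x.2.1), (x.1.2, x.2.2)⟩
  map {x y} f := match x, y, f with
    | (⟨_, _⟩, ⟨_, _⟩), (⟨_, _⟩, ⟨_, _⟩), (.mk f, .mk g) => .mk (f, g)
  map_id := by
    rintro ⟨⟨_, _⟩, ⟨_, _⟩⟩
    rfl
  map_comp := by
    rintro ⟨⟨_, _⟩, ⟨_, _⟩⟩ ⟨⟨_, _⟩, ⟨_, _⟩⟩ ⟨⟨_, _⟩, ⟨_, _⟩⟩ ⟨⟨f⟩, ⟨g⟩⟩ ⟨⟨f'⟩, ⟨g'⟩⟩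
    rfl

/-- The component of a morphism of a disjoint union. -/
def sigmaSnd {I : Type*} {P : I → Type*} [∀ i, Category* (P i)] {i : I} {x y : P i}
    (f : (⟨i, x⟩ : Σ i, P i) ⟶ ⟨i, y⟩) : x ⟶ y :=
  match f with
  | .mk f => f

theorem sigmaHom_fst {I : Type*} {P : I → Type*} [∀ i, Category* (P i)] {x y : Σ i, P i}
    (f : x ⟶ y) : x.1 = y.1 := by
  obtain ⟨f⟩ := f
  rfl

theorem sigmaHom_mk_snd {I : Type*} {P : I → Type*} [∀ i, Category* (P i)] {i : I} {x y : P i}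
    (f : (⟨i, x⟩ : Σ i, P i) ⟶ ⟨i, y⟩) : f = .mk (sigmaSnd f) :=
  match f with
  | .mk _ => rfl

def piSigmaMap {Λ : Type*} {I : Λ → Type*} {P : ∀ l, I l → Type*} [∀ l i, Category* (P l i)]
    {i j : ∀ l, I l} {x : ∀ l, P l (i l)} {y : ∀ l, P l (j l)}
    (f : ∀ l, (⟨i l, x l⟩ : Σ i, P l i) ⟶ ⟨j l, y l⟩) :
    (⟨i, x⟩ : Σ i : ∀ l, I l, ∀ l, P l (i l)) ⟶ ⟨j, y⟩ := by
  have h : i = j := funext fun l => sigmaHom_fst (f l)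
  subst h
  exact .mk fun l => sigmaSnd (f l)

/-- The distributivity isomorphism `∏_l ∐_i P_{l,i} ≅ ∐_{(i_l)_l} ∏_l P_{l,i_l}`. -/
def piSigma {Λ : Type*} {I : Λ → Type*} {P : ∀ l, I l → Type*} [∀ l i, Category* (P l i)] :
    (∀ l, Σ i, P l i) ⥤ Σ i : ∀ l, I l, ∀ l, P l (i l) where
  obj x := ⟨fun l => (x l).1, fun l => (x l).2⟩
  map f := piSigmaMap f
  map_id x := rfl
  map_comp {x y z} f g := by
    obtain ⟨i, x, rfl⟩ : ∃ (i : ∀ l, I l) (x' : ∀ l, P l (i l)), x = fun l => ⟨i l, x' l⟩ :=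
      ⟨fun l => (x l).1, fun l => (x l).2, rfl⟩
    obtain ⟨j, y, rfl⟩ : ∃ (i : ∀ l, I l) (x' : ∀ l, P l (i l)), y = fun l => ⟨i l, x' l⟩ :=
      ⟨fun l => (y l).1, fun l => (y l).2, rfl⟩
    obtain ⟨k, z, rfl⟩ : ∃ (i : ∀ l, I l) (x' : ∀ l, P l (i l)), z = fun l => ⟨i l, x' l⟩ :=
      ⟨fun l => (z l).1, fun l => (z l).2, rfl⟩
    obtain rfl : i = j := funext fun l => sigmaHom_fst (f l)
    obtain rfl : i = k := funext fun l => sigmaHom_fst (g l)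
    have hf : f = fun l => .mk (sigmaSnd (f l)) := by
      funext l
      exact sigmaHom_mk_snd (f l)
    have hg : g = fun l => .mk (sigmaSnd (g l)) := by
      funext l
      exact sigmaHom_mk_snd (g l)
    rw [hf, hg]
    rfl

end SigmaFunctors
/-! ### The biprop envelope -/

namespace SymWeakMulticategory

variable (C : SymWeakMulticategory.{v, w, u})

/-- The hom-category `∐_{φ : I → J} ∏_{j ∈ J} C((X_i)_{i ∈ φ⁻¹ j}; Y_j)`. -/
abbrev EnvHom (A B : Word C.Ob) : Type v :=
  Σ φ : Fin A.len → Fin B.len, ∀ j, C.Hom (A.fib φ j) (B.col j)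

/-- The composition `∐_{(φ,ψ)} ∏_k μ_{φ| : φ⁻¹ψ⁻¹k → ψ⁻¹k}`. -/
noncomputable def envM (A B D : Word C.Ob) : (C.EnvHom A B × C.EnvHom B D) ⥤ C.EnvHom A D :=
  prodSigma ⋙ sigmaFunctor (fun k : (Fin A.len → Fin B.len) × (Fin B.len → Fin D.len) => k.2 ∘ k.1) fun k =>
    Functor.pi' fun j => (𝟭 _).prod (Pi.eval _ j) ⋙ C.compAt k.1 k.2 j (D.col j)

noncomputable def envOne (A : Word C.Ob) : C.EnvHom A A := ⟨id, C.units A⟩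

/-- The identification `∏_l ∏_{j ∈ ⨆_{j ∈ g⁻¹l} Q_j} C(φ_l⁻¹ j; Y_j) ≅ ∏_{q ∈ Q} C(φ⁻¹ q; Y_q)`, where
`φ : ⨆_i S_i → ⨆_j Q_j` is assembled from the maps `φ_l`. -/
noncomputable def envGlue {I J L : ℕ} (f : Fin I → Fin L) (g : Fin J → Fin L)
    (A : Fin I → Word C.Ob) (B : Fin J → Word C.Ob)
    (φ : ∀ l, Fin (Word.concat fun i : {i // f i = l} => A i).len →
      Fin (Word.concat fun j : {j // g j = l} => B j).len) :
    (∀ l j, C.Hom ((Word.concat fun i : {i // f i = l} => A i).fib (φ l) j)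
      ((Word.concat fun j : {j // g j = l} => B j).col j)) ⥤
    ∀ q, C.Hom ((Word.concat A).fib (Word.glue f A g B φ) q) ((Word.concat B).col q) :=
  Functor.pi' fun q => Pi.eval _ (g (Word.pr B q)) ⋙ Pi.eval _ (Word.place g B _ q rfl) ⋙
    C.cast (Word.fib_glue f A g B φ q _ rfl) (Word.col_place g B q _ rfl)

noncomputable def envTensor {I J L : ℕ} (f : Fin I → Fin L) (g : Fin J → Fin L)
    (A : Fin I → Word C.Ob) (B : Fin J → Word C.Ob) :
    (∀ l, C.EnvHom (Word.concat fun i : {i // f i = l} => A i)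
      (Word.concat fun j : {j // g j = l} => B j)) ⥤ C.EnvHom (Word.concat A) (Word.concat B) :=
  piSigma ⋙ sigmaFunctor (fun φ => Word.glue f A g B φ) fun φ => C.envGlue f g A B φ

noncomputable def envA (A B D E : Word C.Ob) :
    Functor.prod' (Functor.prod' (CategoryTheory.Prod.fst (C.EnvHom A B) (C.EnvHom B D × C.EnvHom D E))
        (CategoryTheory.Prod.snd _ _ ⋙ CategoryTheory.Prod.fst _ _) ⋙ C.envM A B D)
        (CategoryTheory.Prod.snd _ _ ⋙ CategoryTheory.Prod.snd _ _) ⋙ C.envM A D E ≅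
      (𝟭 (C.EnvHom A B)).prod (C.envM B D E) ⋙ C.envM A B E :=
  NatIso.ofComponents
    (fun x => (Sigma.incl (x.2.2.1 ∘ x.2.1.1 ∘ x.1.1)).mapIso
      (Pi.isoMk fun l => (C.assocAt x.1.1 x.2.1.1 x.2.2.1 l (E.col l)).app
        (x.1.2, x.2.1.2, x.2.2.2 l)))
    (by
      rintro ⟨⟨φ, p⟩, ⟨ψ, q⟩, ⟨ξ, s⟩⟩ ⟨⟨φ', p'⟩, ⟨ψ', q'⟩, ⟨ξ', s'⟩⟩ ⟨⟨x⟩, ⟨y⟩, ⟨z⟩⟩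
      refine congrArg Sigma.SigmaHom.mk (funext fun l => ?_)
      exact (C.assocAt φ ψ ξ l (E.col l)).hom.naturality
        (X := (p, q, s l)) (Y := (_, _, _)) (x, y, z l))

noncomputable def envL (A B : Word C.Ob) :
    Prod.sectR (C.envOne A) (C.EnvHom A B) ⋙ C.envM A A B ≅ 𝟭 (C.EnvHom A B) :=
  NatIso.ofComponents
    (fun x => (Sigma.incl x.1).mapIso
      (Pi.isoMk fun j => (C.lunitAt A x.1 j (B.col j)).app (x.2 j)))
    (by
      rintro ⟨φ, p⟩ ⟨φ', p'⟩ ⟨x⟩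
      refine congrArg Sigma.SigmaHom.mk (funext fun l => ?_)
      exact (C.lunitAt A φ l (B.col l)).hom.naturality (x l))

noncomputable def envR (A B : Word C.Ob) :
    Prod.sectL (C.EnvHom A B) (C.envOne B) ⋙ C.envM A B B ≅ 𝟭 (C.EnvHom A B) :=
  NatIso.ofComponents
    (fun x => (Sigma.incl x.1).mapIso
      (Pi.isoMk fun j => (C.runitAt x.1 j).app x.2))
    (by
      rintro ⟨φ, p⟩ ⟨φ', p'⟩ ⟨x⟩
      refine congrArg Sigma.SigmaHom.mk (funext fun l => ?_)
      exact (C.runitAt φ l).hom.naturality x)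

/-- The data of the biprop envelope. -/
noncomputable abbrev envelopeData : BipropData.{v, max v w, u} where
  Col := C.Ob
  Hom := C.EnvHom
  cat _ _ := inferInstance
  one := C.envOne
  m := C.envM
  a := C.envA
  l := C.envL
  r := C.envR
  tensor := C.envTensor

end SymWeakMulticategory
/-! ### Cartesian squares of finite totally ordered sets -/

/-- Increasing maps `a` and `b` with `φ ∘ a = b ∘ φ'`, such that `φ⁻¹` of the image of `b` is the
image of `a`. -/
structure Cart {n m n' m' : ℕ} (a : Fin n' → Fin n) (b : Fin m' → Fin m) (φ' : Fin n' → Fin m')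
    (φ : Fin n → Fin m) : Prop where
  mono_a : StrictMono a
  mono_b : StrictMono b
  comm : ∀ s, φ (a s) = b (φ' s)
  surj : ∀ i j, φ i = b j → ∃ s, a s = i

namespace Cart

variable {n m p q n' m' p' q' : ℕ} {a : Fin n' → Fin n} {b : Fin m' → Fin m} {c : Fin p' → Fin p}
  {d : Fin q' → Fin q}
  {φ' : Fin n' → Fin m'} {φ : Fin n → Fin m} {ψ' : Fin m' → Fin p'} {ψ : Fin m → Fin p}
  {ξ' : Fin p' → Fin q'} {ξ : Fin p → Fin q}

theorem comp (h : Cart a b φ' φ) (k : Cart b c ψ' ψ) : Cart a c (ψ' ∘ φ') (ψ ∘ φ) where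
  mono_a := h.mono_a
  mono_b := k.mono_b
  comm s := by simp [h.comm, k.comm]
  surj i j e := by
    obtain ⟨t, ht⟩ := k.surj _ _ e
    exact h.surj i t ht.symm

theorem id (h : StrictMono a) : Cart a a id id := ⟨h, h, fun _ => rfl, fun _ j e => ⟨j, e.symm⟩⟩

theorem femb_aux (h : Cart a b φ' φ) (j : Fin m') :
    Set.range (fun s => a (femb φ' j s)) = Set.range (femb φ (b j)) := by
  rw [range_femb]
  ext i
  constructor
  · rintro ⟨s, rfl⟩
    exact (h.comm _).trans (congrArg b (femb_spec φ' j s))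
  · intro e
    obtain ⟨s, rfl⟩ := h.surj i j e
    have e' : φ' s = j := h.mono_b.injective ((h.comm s).symm.trans e)
    exact ⟨fpos φ' j s e', congrArg a (femb_fpos _ _ _ _)⟩

theorem card (h : Cart a b φ' φ) (j : Fin m') :
    Fintype.card {i // φ' i = j} = Fintype.card {i // φ i = b j} :=
  (enum_unique (h.mono_a.comp (femb_strictMono _ _)) (femb_strictMono _ _) (h.femb_aux j)).1

theorem femb_eq (h : Cart a b φ' φ) (j : Fin m') (s s') (e : s.val = s'.val) :
    a (femb φ' j s) = femb φ (b j) s' :=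
  (enum_unique (h.mono_a.comp (femb_strictMono _ _)) (femb_strictMono _ _) (h.femb_aux j)).2 s s' e

theorem frestr_eq (h : Cart a b φ' φ) (k : Cart b c ψ' ψ) (l : Fin p') (s s')
    (e : s.val = s'.val) : (frestr φ' ψ' l s).val = (frestr φ ψ (c l) s').val := by
  have key : Fin.cast (k.card l) (frestr φ' ψ' l s) = frestr φ ψ (c l) s' := by
    apply (femb_strictMono ψ (c l)).injective
    rw [femb_frestr, ← k.femb_eq l (frestr φ' ψ' l s) _ rfl, femb_frestr, ← h.comm]
    congr 1
    exact (h.comp k).femb_eq l s s' e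
  exact congrArg Fin.val key

theorem frestr (φ : Fin n → Fin m) (ψ : Fin m → Fin p) (k : Fin p) :
    Cart (femb (ψ ∘ φ) k) (femb ψ k) (frestr φ ψ k) φ where
  mono_a := femb_strictMono _ _
  mono_b := femb_strictMono _ _
  comm s := (femb_frestr φ ψ k s).symm
  surj i j e := by
    have e' : (ψ ∘ φ) i = k := (congrArg ψ e).trans (femb_spec ψ k j)
    exact ⟨fpos _ _ i e', femb_fpos _ _ _ _⟩

theorem fib_eq {S : Type*} {A A' : Word S} {m m' : ℕ} {a : Fin A'.len → Fin A.len}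
    {b : Fin m' → Fin m} {φ' : Fin A'.len → Fin m'} {φ : Fin A.len → Fin m}
    (h : Cart a b φ' φ) (ha : ∀ s, A'.col s = A.col (a s)) (j : Fin m') :
    A'.fib φ' j = A.fib φ (b j) :=
  Word.ext_val (h.card j) fun s s' e => (ha _).trans (congrArg A.col (h.femb_eq j s s' e))

end Cart

namespace Word

theorem cart_incl {S : Type*} {I J L : ℕ} (f : Fin I → Fin L) (A : Fin I → Word S)
    (g : Fin J → Fin L) (B : Fin J → Word S)
    (φ : ∀ l, Fin (concat fun i : {i // f i = l} => A i).len →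
      Fin (concat fun j : {j // g j = l} => B j).len) (l : Fin L) :
    Cart (incl f A l) (incl g B l) (φ l) (glue f A g B φ) where
  mono_a := incl_strictMono f A l
  mono_b := incl_strictMono g B l
  comm := glue_incl f A g B φ l
  surj i j e := by
    have hl : f (pr A i) = l := by
      rw [← f_pr_incl g B l j, ← e]
      exact (f_pr_incl g B _ _).symm
    exact ⟨place f A l i hl, incl_place _ _ _ _ _⟩

end Word

/-! ### Comparison of structure morphisms along equalities of indices -/

namespace MultiCore

variable {C : MultiCore.{v, w, u}}

theorem tarr_of_arrow {A : Word C.Ob} {Y : C.Ob} {x y x' y' : C.Hom A Y} {f : x ⟶ y}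
    {g : x' ⟶ y'} (h : Arrow.mk f = Arrow.mk g) : tarr f = tarr g :=
  congrArg (fun t => (⟨A, Y, t⟩ : C.TArr)) h

theorem tarr_ext {A : Word C.Ob} {Y : C.Ob} {x y : C.Hom A Y} {f g : x ⟶ y}
    (h : tarr f = tarr g) : f = g :=
  Arrow.mk_injective _ _ (tarr_inj h)

theorem tarr_comp_congr {A A' : Word C.Ob} {Y Y' : C.Ob} {x y z : C.Hom A Y} {x' y' z' : C.Hom A' Y'}
    {f : x ⟶ y} {g : y ⟶ z} {f' : x' ⟶ y'} {g' : y' ⟶ z'} (hf : tarr f = tarr f')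
    (hg : tarr g = tarr g') : tarr (f ≫ g) = tarr (f' ≫ g') := by
  obtain rfl : A = A' := congrArg Sigma.fst hf
  obtain rfl : Y = Y' := by
    simp only [tarr, TArr, Sigma.mk.injEq, heq_eq_eq, true_and] at hf
    exact hf.1
  obtain ⟨rfl, rfl, hf⟩ := (Arrow.mk_eq_mk_iff _ _).1 (tarr_inj hf)
  obtain ⟨_, rfl, hg⟩ := (Arrow.mk_eq_mk_iff _ _).1 (tarr_inj hg)
  obtain rfl : f = f' := by simpa using hf
  obtain rfl : g = g' := by simpa using hg
  rfl

theorem tarr_eqToHom_comp {A : Word C.Ob} {Y : C.Ob} {x y z : C.Hom A Y} (h : x = y) (f : y ⟶ z) :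
    tarr (eqToHom h ≫ f) = tarr f := by
  subst h
  simp

theorem tarr_comp_eqToHom {A : Word C.Ob} {Y : C.Ob} {x y z : C.Hom A Y} (h : y = z) (f : x ⟶ y) :
    tarr (f ≫ eqToHom h) = tarr f := by
  subst h
  simp

/-- Equality of objects of hom-categories from equality of their identity morphisms. -/
theorem eq_of_tarr {A : Word C.Ob} {Y : C.Ob} {x y : C.Hom A Y} (h : tarr (𝟙 x) = tarr (𝟙 y)) :
    x = y :=
  ((Arrow.mk_eq_mk_iff _ _).1 (tarr_inj h)).1

theorem tarr_id_cast {A A' : Word C.Ob} {Y Y' : C.Ob} (hA : A = A') (hY : Y = Y') (x : C.Hom A Y) :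
    tarr (𝟙 ((C.cast hA hY).obj x)) = tarr (𝟙 x) := by
  subst hA hY
  rfl

theorem tarr_id_comp {A B A' B' : Word C.Ob} (hA : A = A') (hB : B = B')
    (φ : Fin A.len → Fin B.len) (φ' : Fin A'.len → Fin B'.len)
    (hφ : ∀ i i', i.val = i'.val → (φ i).val = (φ' i').val)
    (W W') (hW) (hW') {Z Z' : C.Ob}
    {p : ∀ j, C.Hom (W j) (B.col j)} {p' : ∀ j, C.Hom (W' j) (B'.col j)}
    (hf : ∀ j j', j.val = j'.val → tarr (𝟙 (p j)) = tarr (𝟙 (p' j')))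
    {z : C.Hom B Z} {z' : C.Hom B' Z'} (hg : tarr (𝟙 z) = tarr (𝟙 z')) :
    tarr (𝟙 ((C.comp φ W hW Z).obj (p, z))) = tarr (𝟙 ((C.comp φ' W' hW' Z').obj (p', z'))) := by
  rw [← CategoryTheory.Functor.map_id, ← CategoryTheory.Functor.map_id]
  exact tarr_comp hA hB φ φ' hφ W W' hW hW' (𝟙 p) (𝟙 p') hf (𝟙 z) (𝟙 z') hg

theorem tarr_compAt_cart {A B A' B' : Word C.Ob} {n n' : ℕ} {a : Fin A'.len → Fin A.len}
    {b : Fin B'.len → Fin B.len} {c : Fin n' → Fin n} {φ' : Fin A'.len → Fin B'.len}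
    {φ : Fin A.len → Fin B.len} {ψ' : Fin B'.len → Fin n'} {ψ : Fin B.len → Fin n}
    (h : Cart a b φ' φ) (k : Cart b c ψ' ψ) (ha : ∀ s, A'.col s = A.col (a s))
    (hb : ∀ s, B'.col s = B.col (b s)) (l : Fin n') {Z Z' : C.Ob}
    {x y : ∀ j, C.Hom (A.fib φ j) (B.col j)} {x' y' : ∀ j, C.Hom (A'.fib φ' j) (B'.col j)}
    (f' : x' ⟶ y') (f : x ⟶ y) (hf : ∀ j, tarr (f' j) = tarr (f (b j)))
    {z t : C.Hom (B.fib ψ (c l)) Z} {z' t' : C.Hom (B'.fib ψ' l) Z'} (g' : z' ⟶ t') (g : z ⟶ t)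
    (hg : tarr g' = tarr g) :
    tarr ((C.compAt φ' ψ' l Z').map (X := (x', z')) (Y := (y', t')) (f', g')) =
      tarr ((C.compAt φ ψ (c l) Z).map (X := (x, z)) (Y := (y, t)) (f, g)) := by
  have h1 : A'.fib (ψ' ∘ φ') l = A.fib (ψ ∘ φ) (c l) := (h.comp k).fib_eq ha l
  have h2 : B'.fib ψ' l = B.fib ψ (c l) := k.fib_eq hb l
  refine tarr_comp h1 h2 (A'.restrict B' φ' ψ' l) (A.restrict B φ ψ (c l)) ?_ _ _ _ _ _ _ ?_ _ _ hg
  · exact fun s s' e => h.frestr_eq k l s s' e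
  · exact fun j j' e => (hf _).trans (tarr_idx f (k.femb_eq l j j' e))

theorem tarr_id_compAt_cart {A B A' B' : Word C.Ob} {n n' : ℕ} {a : Fin A'.len → Fin A.len}
    {b : Fin B'.len → Fin B.len} {c : Fin n' → Fin n} {φ' : Fin A'.len → Fin B'.len}
    {φ : Fin A.len → Fin B.len} {ψ' : Fin B'.len → Fin n'} {ψ : Fin B.len → Fin n}
    (h : Cart a b φ' φ) (k : Cart b c ψ' ψ) (ha : ∀ s, A'.col s = A.col (a s))
    (hb : ∀ s, B'.col s = B.col (b s)) (l : Fin n') {Z Z' : C.Ob}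
    {x : ∀ j, C.Hom (A.fib φ j) (B.col j)} {x' : ∀ j, C.Hom (A'.fib φ' j) (B'.col j)}
    (hf : ∀ j, tarr (𝟙 (x' j)) = tarr (𝟙 (x (b j))))
    {z : C.Hom (B.fib ψ (c l)) Z} {z' : C.Hom (B'.fib ψ' l) Z'} (hg : tarr (𝟙 z') = tarr (𝟙 z)) :
    tarr (𝟙 ((C.compAt φ' ψ' l Z').obj (x', z'))) = tarr (𝟙 ((C.compAt φ ψ (c l) Z).obj (x, z))) := by
  rw [← CategoryTheory.Functor.map_id, ← CategoryTheory.Functor.map_id]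
  exact tarr_compAt_cart h k ha hb l (𝟙 x') (𝟙 x) hf (𝟙 z') (𝟙 z) hg

end MultiCore

namespace SymWeakMultiData

open MultiCore

variable (C : SymWeakMultiData.{v, w, u})

theorem tarr_assoc {A B D A' B' D' : Word C.Ob} (hA : A = A') (hB : B = B') (hD : D = D')
    (φ : Fin A.len → Fin B.len) (φ' : Fin A'.len → Fin B'.len)
    (hφ : ∀ i i', i.val = i'.val → (φ i).val = (φ' i').val)
    (ψ : Fin B.len → Fin D.len) (ψ' : Fin B'.len → Fin D'.len)
    (hψ : ∀ i i', i.val = i'.val → (ψ i).val = (ψ' i').val) {Z Z' : C.Ob}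
    {p : ∀ j, C.Hom (A.fib φ j) (B.col j)} {p' : ∀ j, C.Hom (A'.fib φ' j) (B'.col j)}
    (hp : ∀ j j', j.val = j'.val → tarr (𝟙 (p j)) = tarr (𝟙 (p' j')))
    {q : ∀ k, C.Hom (B.fib ψ k) (D.col k)} {q' : ∀ k, C.Hom (B'.fib ψ' k) (D'.col k)}
    (hq : ∀ j j', j.val = j'.val → tarr (𝟙 (q j)) = tarr (𝟙 (q' j')))
    {z : C.Hom D Z} {z' : C.Hom D' Z'} (hz : tarr (𝟙 z) = tarr (𝟙 z')) :
    tarr ((C.assoc φ ψ Z).hom.app (p, q, z)) = tarr ((C.assoc φ' ψ' Z').hom.app (p', q', z')) := by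
  subst hA hB hD
  obtain rfl : φ = φ' := funext fun i => Fin.ext (hφ i i rfl)
  obtain rfl : ψ = ψ' := funext fun i => Fin.ext (hψ i i rfl)
  obtain rfl : Z = Z' := by
    simp only [tarr, TArr, Sigma.mk.injEq, heq_eq_eq, true_and] at hz
    exact hz.1
  obtain rfl : p = p' := funext fun j => eq_of_tarr (hp j j rfl)
  obtain rfl : q = q' := funext fun j => eq_of_tarr (hq j j rfl)
  obtain rfl := eq_of_tarr hz
  rfl

theorem tarr_assocAt {A B D : Word C.Ob} {n : ℕ} (φ : Fin A.len → Fin B.len)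
    (ψ : Fin B.len → Fin D.len) (ξ : Fin D.len → Fin n) (l : Fin n) (Z : C.Ob) (p q z) :
    tarr ((C.assocAt φ ψ ξ l Z).hom.app (p, q, z)) =
      tarr ((C.assoc (A.restrict B φ (ξ ∘ ψ) l) (B.restrict D ψ ξ l) Z).hom.app
        ((C.restr φ (ξ ∘ ψ) l).obj p, (C.restr ψ ξ l).obj q, z)) := by
  simp only [assocAt, Iso.trans_hom, NatTrans.comp_app, eqToIso.hom, eqToHom_app]
  rw [tarr_eqToHom_comp, tarr_comp_eqToHom]
  rfl

theorem tarr_restr {A B : Word C.Ob} {p : ℕ} (φ : Fin A.len → Fin B.len)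
    (ψ : Fin B.len → Fin p) (k : Fin p) (x : ∀ j, C.Hom (A.fib φ j) (B.col j)) (j) :
    tarr (𝟙 ((C.restr φ ψ k).obj x j)) = tarr (𝟙 (x (B.emb ψ k j))) :=
  tarr_id_cast _ _ _

variable {C} in
theorem tarr_assocAt_cart {A B D A' B' D' : Word C.Ob} {n n' : ℕ} {a : Fin A'.len → Fin A.len}
    {b : Fin B'.len → Fin B.len} {c : Fin D'.len → Fin D.len} {d : Fin n' → Fin n}
    {φ' : Fin A'.len → Fin B'.len} {φ : Fin A.len → Fin B.len} {ψ' : Fin B'.len → Fin D'.len}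
    {ψ : Fin B.len → Fin D.len} {ξ' : Fin D'.len → Fin n'} {ξ : Fin D.len → Fin n}
    (h : Cart a b φ' φ) (k : Cart b c ψ' ψ) (m : Cart c d ξ' ξ)
    (ha : ∀ s, A'.col s = A.col (a s)) (hb : ∀ s, B'.col s = B.col (b s))
    (hc : ∀ s, D'.col s = D.col (c s)) (l : Fin n') {Z Z' : C.Ob}
    {p : ∀ j, C.Hom (A.fib φ j) (B.col j)} {p' : ∀ j, C.Hom (A'.fib φ' j) (B'.col j)}
    (hp : ∀ j, tarr (𝟙 (p' j)) = tarr (𝟙 (p (b j))))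
    {q : ∀ j, C.Hom (B.fib ψ j) (D.col j)} {q' : ∀ j, C.Hom (B'.fib ψ' j) (D'.col j)}
    (hq : ∀ j, tarr (𝟙 (q' j)) = tarr (𝟙 (q (c j))))
    {z : C.Hom (D.fib ξ (d l)) Z} {z' : C.Hom (D'.fib ξ' l) Z'} (hz : tarr (𝟙 z') = tarr (𝟙 z)) :
    tarr ((C.assocAt φ' ψ' ξ' l Z').hom.app (p', q', z')) =
      tarr ((C.assocAt φ ψ ξ (d l) Z).hom.app (p, q, z)) := by
  rw [tarr_assocAt, tarr_assocAt]
  have h1 : A'.fib (ξ' ∘ ψ' ∘ φ') l = A.fib (ξ ∘ ψ ∘ φ) (d l) := ((h.comp k).comp m).fib_eq ha l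
  have h2 : B'.fib (ξ' ∘ ψ') l = B.fib (ξ ∘ ψ) (d l) := (k.comp m).fib_eq hb l
  have h3 : D'.fib ξ' l = D.fib ξ (d l) := m.fib_eq hc l
  refine C.tarr_assoc h1 h2 h3
    (A'.restrict B' φ' (ξ' ∘ ψ') l) (A.restrict B φ (ξ ∘ ψ) (d l)) ?_
    (B'.restrict D' ψ' ξ' l) (B.restrict D ψ ξ (d l)) ?_ ?_ ?_ hz
  · exact fun s s' e => h.frestr_eq (k.comp m) l s s' e
  · exact fun s s' e => k.frestr_eq m l s s' e
  · intro j j' e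
    rw [tarr_restr, tarr_restr, hp]
    exact tarr_idx (𝟙 p) ((k.comp m).femb_eq l j j' e)
  · intro j j' e
    rw [tarr_restr, tarr_restr, hq]
    exact tarr_idx (𝟙 q) (m.femb_eq l j j' e)

theorem tarr_lunit {A A' : Word C.Ob} (hA : A = A') {Z Z' : C.Ob} {z : C.Hom A Z} {z' : C.Hom A' Z'}
    (hz : tarr (𝟙 z) = tarr (𝟙 z')) :
    tarr ((C.lunit A Z).hom.app z) = tarr ((C.lunit A' Z').hom.app z') := by
  subst hA
  obtain rfl : Z = Z' := by
    simp only [tarr, TArr, Sigma.mk.injEq, heq_eq_eq, true_and] at hz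
    exact hz.1
  obtain rfl := eq_of_tarr hz
  rfl

theorem tarr_runit {A A' : Word C.Ob} (hA : A = A') {Z Z' : C.Ob} {z : C.Hom A Z} {z' : C.Hom A' Z'}
    (hz : tarr (𝟙 z) = tarr (𝟙 z')) :
    tarr ((C.runit A Z).hom.app z) = tarr ((C.runit A' Z').hom.app z') := by
  subst hA
  obtain rfl : Z = Z' := by
    simp only [tarr, TArr, Sigma.mk.injEq, heq_eq_eq, true_and] at hz
    exact hz.1
  obtain rfl := eq_of_tarr hz
  rfl

theorem tarr_lunitAt {n : ℕ} (A : Word C.Ob) (φ : Fin A.len → Fin n) (j : Fin n) (Z : C.Ob) (z) :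
    tarr ((C.lunitAt A φ j Z).hom.app z) = tarr ((C.lunit (A.fib φ j) Z).hom.app z) := by
  simp only [lunitAt, Iso.trans_hom, NatTrans.comp_app, eqToIso.hom, eqToHom_app]
  rw [tarr_eqToHom_comp]

theorem tarr_runitAt {A B : Word C.Ob} (φ : Fin A.len → Fin B.len) (j : Fin B.len) (p) :
    tarr ((C.runitAt φ j).hom.app p) = tarr ((C.runit (A.fib φ j) (B.col j)).hom.app (p j)) := by
  simp only [runitAt, Iso.trans_hom, NatTrans.comp_app, eqToIso.hom, eqToHom_app]
  rw [tarr_eqToHom_comp]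
  rfl

end SymWeakMultiData
namespace SymWeakMulticategory

open MultiCore SymWeakMultiData

variable (C : SymWeakMulticategory.{v, w, u})

theorem tarr_assocAt_restr {A B D E : Word C.Ob} {n : ℕ} (φ : Fin A.len → Fin B.len)
    (ψ : Fin B.len → Fin D.len) (ξ : Fin D.len → Fin E.len) (κ : Fin E.len → Fin n) (m : Fin n)
    (p : ∀ j, C.Hom (A.fib φ j) (B.col j)) (q : ∀ k, C.Hom (B.fib ψ k) (D.col k))
    (s : ∀ l, C.Hom (D.fib ξ l) (E.col l)) (l : Fin (E.fib κ m).len) :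
    tarr ((C.assocAt φ ψ ξ (E.emb κ m l) (E.col (E.emb κ m l))).hom.app
        (p, q, s (E.emb κ m l))) =
      tarr ((C.assocAt (A.restrict B φ (κ ∘ ξ ∘ ψ) m) (B.restrict D ψ (κ ∘ ξ) m)
        (D.restrict E ξ κ m) l ((E.fib κ m).col l)).hom.app
          ((C.restr φ (κ ∘ ξ ∘ ψ) m).obj p, (C.restr ψ (κ ∘ ξ) m).obj q,
            (C.restr ξ κ m).obj s l)) := by
  have h1 : Cart (A.emb ((κ ∘ ξ ∘ ψ) ∘ φ) m) (B.emb (κ ∘ ξ ∘ ψ) m)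
    (A.restrict B φ (κ ∘ ξ ∘ ψ) m) φ := Cart.frestr φ (κ ∘ ξ ∘ ψ) m
  have h2 : Cart (B.emb (κ ∘ ξ ∘ ψ) m) (D.emb (κ ∘ ξ) m) (B.restrict D ψ (κ ∘ ξ) m) ψ :=
    Cart.frestr ψ (κ ∘ ξ) m
  have h3 : Cart (D.emb (κ ∘ ξ) m) (E.emb κ m) (D.restrict E ξ κ m) ξ := Cart.frestr ξ κ m
  have k1 : ∀ s, (A.fib ((κ ∘ ξ ∘ ψ) ∘ φ) m).col s = A.col (A.emb ((κ ∘ ξ ∘ ψ) ∘ φ) m s) :=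
    fun _ => rfl
  have k2 : ∀ s, (B.fib (κ ∘ ξ ∘ ψ) m).col s = B.col (B.emb (κ ∘ ξ ∘ ψ) m s) := fun _ => rfl
  have k3 : ∀ s, (D.fib (κ ∘ ξ) m).col s = D.col (D.emb (κ ∘ ξ) m s) := fun _ => rfl
  have e1 := C.tarr_restr φ (κ ∘ ξ ∘ ψ) m p
  have e2 := C.tarr_restr ψ (κ ∘ ξ) m q
  have e3 := C.tarr_restr ξ κ m s l
  have t1 := @tarr_assocAt_cart C.toSymWeakMultiData A B D
    (A.fib ((κ ∘ ξ ∘ ψ) ∘ φ) m) (B.fib (κ ∘ ξ ∘ ψ) m) (D.fib (κ ∘ ξ) m) _ _ _ _ _ _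
    (A.restrict B φ (κ ∘ ξ ∘ ψ) m) φ
    (B.restrict D ψ (κ ∘ ξ) m) ψ (D.restrict E ξ κ m) ξ h1 h2 h3 k1 k2 k3 l (E.col (E.emb κ m l)) ((E.fib κ m).col l)
    p
  have t2 := @t1 ((C.restr φ (κ ∘ ξ ∘ ψ) m).obj p) e1 q
  have t3 := @t2 ((C.restr ψ (κ ∘ ξ) m).obj q) e2 (s (E.emb κ m l))
  have t4 := @t3 ((C.restr ξ κ m).obj s l) e3
  exact t4.symm

theorem tarr_id_compAt_restr {A B D : Word C.Ob} {n : ℕ} (φ : Fin A.len → Fin B.len)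
    (ψ : Fin B.len → Fin D.len) (ξ : Fin D.len → Fin n) (m : Fin n)
    (p : ∀ j, C.Hom (A.fib φ j) (B.col j)) (q : ∀ k, C.Hom (B.fib ψ k) (D.col k))
    (l : Fin (D.fib ξ m).len) :
    tarr (𝟙 ((C.compAt φ ψ (D.emb ξ m l) (D.col (D.emb ξ m l))).obj (p, q (D.emb ξ m l)))) =
      tarr (𝟙 ((C.compAt (A.restrict B φ (ξ ∘ ψ) m) (B.restrict D ψ ξ m) l
        ((D.fib ξ m).col l)).obj
          ((C.restr φ (ξ ∘ ψ) m).obj p, (C.restr ψ ξ m).obj q l))) := by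
  symm
  refine tarr_id_compAt_cart (C := C.toMultiCore)
    (A := A) (B := B) (A' := A.fib (ξ ∘ ψ ∘ φ) m) (B' := B.fib (ξ ∘ ψ) m)
    (φ' := A.restrict B φ (ξ ∘ ψ) m)
    (ψ' := B.restrict D ψ ξ m) (φ := φ) (ψ := ψ)
    (a := A.emb (ξ ∘ ψ ∘ φ) m) (b := B.emb (ξ ∘ ψ) m) (c := D.emb ξ m)
    (Z := D.col (D.emb ξ m l)) (Z' := (D.fib ξ m).col l) (x := p) (z := q (D.emb ξ m l))
    (x' := (C.restr φ (ξ ∘ ψ) m).obj p) (z' := (C.restr ψ ξ m).obj q l)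
    (Cart.frestr φ (ξ ∘ ψ) m) (Cart.frestr ψ ξ m)
    (fun _ => rfl) (fun _ => rfl) l ?_ ?_
  · exact C.tarr_restr φ (ξ ∘ ψ) m p
  · exact C.tarr_restr ψ ξ m q l

theorem pentagonAt {A B D E : Word C.Ob} {n : ℕ} (φ : Fin A.len → Fin B.len)
    (ψ : Fin B.len → Fin D.len) (ξ : Fin D.len → Fin E.len) (κ : Fin E.len → Fin n) (m : Fin n)
    (Z : C.Ob) (p : ∀ j, C.Hom (A.fib φ j) (B.col j)) (q : ∀ k, C.Hom (B.fib ψ k) (D.col k))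
    (s : ∀ l, C.Hom (D.fib ξ l) (E.col l)) (t : C.Hom (E.fib κ m) Z) :
    (C.compAt (ξ ∘ ψ ∘ φ) κ m Z).map
        (X := (fun l => (C.assocSourceAt φ ψ ξ l (E.col l)).obj (p, q, s l), t))
        (Y := (fun l => (C.assocTargetAt φ ψ ξ l (E.col l)).obj (p, q, s l), t))
        (fun l => (C.assocAt φ ψ ξ l (E.col l)).hom.app (p, q, s l), 𝟙 t) ≫
      (C.assocAt φ (ξ ∘ ψ) κ m Z).hom.app
        (p, fun l => (C.compAt ψ ξ l (E.col l)).obj (q, s l), t) ≫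
      (C.compAt φ (κ ∘ ξ ∘ ψ) m Z).map
        (X := (p, (C.assocSourceAt ψ ξ κ m Z).obj (q, s, t)))
        (Y := (p, (C.assocTargetAt ψ ξ κ m Z).obj (q, s, t)))
        (𝟙 p, (C.assocAt ψ ξ κ m Z).hom.app (q, s, t)) =
    (C.assocAt (ψ ∘ φ) ξ κ m Z).hom.app
        (fun k => (C.compAt φ ψ k (D.col k)).obj (p, q k), s, t) ≫
      (C.assocAt φ ψ (κ ∘ ξ) m Z).hom.app (p, q, (C.compAt ξ κ m Z).obj (s, t)) := by
  have key := C.pentagon (A.restrict B φ (κ ∘ ξ ∘ ψ) m) (B.restrict D ψ (κ ∘ ξ) m)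
    (D.restrict E ξ κ m) Z ((C.restr φ (κ ∘ ξ ∘ ψ) m).obj p) ((C.restr ψ (κ ∘ ξ) m).obj q)
    ((C.restr ξ κ m).obj s) t
  have hp := C.tarr_restr φ (κ ∘ ξ ∘ ψ) m p
  have hs := C.tarr_restr ξ κ m s
  apply tarr_ext
  refine Eq.trans (tarr_comp_congr ?_ (tarr_comp_congr ?_ ?_))
    ((congrArg tarr key).trans (tarr_comp_congr ?_ ?_))
  · refine tarr_comp rfl rfl (A.restrict E (ξ ∘ ψ ∘ φ) κ m)
      (D.restrict E ξ κ m ∘ B.restrict D ψ (κ ∘ ξ) m ∘ A.restrict B φ (κ ∘ ξ ∘ ψ) m)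
      ?_ _ _ _ _ _ _ ?_ _ _ rfl
    · intro i i' e
      obtain rfl := Fin.ext e
      have e1 := congrFun (frestr_frestr (ψ ∘ φ) ξ κ m) i
      have e2 := congrArg (frestr ξ κ m) (congrFun (frestr_frestr φ ψ (κ ∘ ξ) m) i)
      exact congrArg Fin.val (e1.trans e2)
    · intro l l' e
      obtain rfl := Fin.ext e
      exact C.tarr_assocAt_restr φ ψ ξ κ m p q s l
  · refine (C.tarr_assocAt φ (ξ ∘ ψ) κ m Z _ _ _).trans ?_
    refine C.tarr_assoc rfl rfl rfl _ _ ?_ _ _ ?_ ?_ ?_ rfl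
    · exact fun i i' e => congrArg (fun t => (frestr φ (κ ∘ ξ ∘ ψ) m t).val) (Fin.ext e)
    · intro i i' e
      obtain rfl := Fin.ext e
      exact congrArg Fin.val (congrFun (frestr_frestr ψ ξ κ m) i)
    · intro j j' e
      obtain rfl := Fin.ext e
      rfl
    · intro l l' e
      obtain rfl := Fin.ext e
      refine (C.tarr_restr (ξ ∘ ψ) κ m _ l).trans ?_
      exact C.tarr_id_compAt_restr ψ ξ κ m q s l
  · refine tarr_comp rfl rfl (A.restrict B φ (κ ∘ ξ ∘ ψ) m) (A.restrict B φ (κ ∘ ξ ∘ ψ) m)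
      (fun i i' e => by rw [Fin.ext e]) _ _ _ _ _ _ ?_ _ _ (C.tarr_assocAt ψ ξ κ m Z _ _ _)
    intro j j' e
    obtain rfl := Fin.ext e
    exact (hp j).symm
  · refine Eq.trans ?_ (C.tarr_assocAt (ψ ∘ φ) ξ κ m Z _ _ _).symm
    refine C.tarr_assoc rfl rfl rfl _ _ ?_ _ _ ?_ ?_ ?_ rfl
    · intro i i' e
      obtain rfl := Fin.ext e
      exact congrArg Fin.val (congrFun (frestr_frestr φ ψ (κ ∘ ξ) m) i).symm
    · exact fun i i' e => congrArg (fun t => (frestr ξ κ m t).val) (Fin.ext e)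
    · intro l l' e
      obtain rfl := Fin.ext e
      refine Eq.trans ?_ (C.tarr_restr (ψ ∘ φ) (κ ∘ ξ) m _ l).symm
      exact (C.tarr_id_compAt_restr φ ψ (κ ∘ ξ) m p q l).symm
    · intro l l' e
      obtain rfl := Fin.ext e
      rfl
  · refine Eq.trans ?_ (C.tarr_assocAt φ ψ (κ ∘ ξ) m Z _ _ _).symm
    refine C.tarr_assoc rfl rfl rfl _ _ (fun i i' e => by rw [Fin.ext e]; rfl) _ _
      (fun i i' e => by rw [Fin.ext e]) ?_ ?_ ?_
    · intro l l' e
      obtain rfl := Fin.ext e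
      rfl
    · intro l l' e
      obtain rfl := Fin.ext e
      rfl
    · refine tarr_id_comp rfl rfl (D.restrict E ξ κ m) (D.restrict E ξ κ m)
        (fun i i' e => by rw [Fin.ext e]) _ _ _ _ ?_ rfl
      intro j j' e
      obtain rfl := Fin.ext e
      exact hs j

theorem triangleAt {A B : Word C.Ob} {n : ℕ} (φ : Fin A.len → Fin B.len)
    (ψ : Fin B.len → Fin n) (k : Fin n) (Z : C.Ob) (p : ∀ j, C.Hom (A.fib φ j) (B.col j))
    (z : C.Hom (B.fib ψ k) Z) :
    (C.assocAt φ id ψ k Z).hom.app (p, C.units B, z) ≫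
      (C.compAt φ ψ k Z).map (X := (p, (C.lunitSourceAt B ψ k Z).obj z)) (Y := (p, z))
        (𝟙 p, (C.lunitAt B ψ k Z).hom.app z) =
    (C.compAt φ ψ k Z).map
      (X := (fun j => (C.runitSourceAt φ j).obj p, z)) (Y := (p, z))
      (fun j => (C.runitAt φ j).hom.app p, 𝟙 z) := by
  have key := C.triangle (A.restrict B φ ψ k) Z ((C.restr φ ψ k).obj p) z
  have hp := C.tarr_restr φ ψ k p
  apply tarr_ext
  refine Eq.trans (tarr_comp_congr ?_ ?_) ((congrArg tarr key).trans ?_)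
  · refine (C.tarr_assocAt φ id ψ k Z _ _ _).trans ?_
    refine C.tarr_assoc rfl rfl rfl _ _ (fun i i' e => by rw [Fin.ext e]; rfl) _ _ ?_ ?_ ?_ rfl
    · intro i i' e
      obtain rfl := Fin.ext e
      exact congrArg Fin.val (fpos_femb _ _ _ _)
    · intro l l' e
      obtain rfl := Fin.ext e
      rfl
    · intro l l' e
      obtain rfl := Fin.ext e
      refine (C.tarr_restr id ψ k _ l).trans ?_
      exact (tarr_units B (B.emb ψ k l)).trans (tarr_units (B.fib ψ k) l).symm
  · refine tarr_comp rfl rfl (A.restrict B φ ψ k) (A.restrict B φ ψ k)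
      (fun i i' e => by rw [Fin.ext e]) _ _ _ _ _ _ ?_ _ _ (C.tarr_lunitAt B ψ k Z _)
    intro j j' e
    obtain rfl := Fin.ext e
    exact (hp j).symm
  · refine tarr_comp rfl rfl (A.restrict B φ ψ k) (A.restrict B φ ψ k)
      (fun i i' e => by rw [Fin.ext e]) _ _ _ _ _ _ ?_ _ _ rfl
    intro j j' e
    obtain rfl := Fin.ext e
    refine (C.tarr_runitAt (A.restrict B φ ψ k) j _).trans ?_
    refine Eq.trans ?_ (C.tarr_runitAt φ (B.emb ψ k j) p).symm
    exact C.tarr_runit (Word.fib_fib A B φ ψ k j) (hp j)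

attribute [local irreducible] femb fpos frestr Word.fib Word.emb Word.restrict MultiCore.compAt MultiCore.mu
  SymWeakMultiData.assocAt SymWeakMultiData.lunitAt SymWeakMultiData.runitAt

theorem env_pentagon (A B D E G : Word C.Ob) (x : C.EnvHom A B) (y : C.EnvHom B D)
    (z : C.EnvHom D E) (t : C.EnvHom E G) :
    (C.envM A E G).map (X := ((C.envM A D E).obj ((C.envM A B D).obj (x, y), z), t))
        (Y := ((C.envM A B E).obj (x, (C.envM B D E).obj (y, z)), t))
        ((C.envA A B D E).hom.app (x, y, z), 𝟙 t) ≫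
      (C.envA A B E G).hom.app (x, (C.envM B D E).obj (y, z), t) ≫
      (C.envM A B G).map (X := (x, (C.envM B E G).obj ((C.envM B D E).obj (y, z), t)))
        (Y := (x, (C.envM B D G).obj (y, (C.envM D E G).obj (z, t))))
        (𝟙 x, (C.envA B D E G).hom.app (y, z, t)) =
    (C.envA A D E G).hom.app ((C.envM A B D).obj (x, y), z, t) ≫
      (C.envA A B D G).hom.app (x, y, (C.envM D E G).obj (z, t)) := by
  obtain ⟨φ, p⟩ := x
  obtain ⟨ψ, q⟩ := y
  obtain ⟨ξ, s⟩ := z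
  obtain ⟨κ, t⟩ := t
  have h := funext fun m => C.pentagonAt φ ψ ξ κ m (G.col m) p q s (t m)
  exact congrArg (fun f => (Sigma.SigmaHom.mk f :
    (⟨κ ∘ ξ ∘ ψ ∘ φ, _⟩ : C.EnvHom A G) ⟶ ⟨κ ∘ ξ ∘ ψ ∘ φ, _⟩)) h

theorem env_triangle (A B D : Word C.Ob) (x : C.EnvHom A B) (y : C.EnvHom B D) :
    (C.envA A B B D).hom.app (x, C.envOne B, y) ≫
      (C.envM A B D).map (X := (x, (C.envM B B D).obj (C.envOne B, y))) (Y := (x, y))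
        (𝟙 x, (C.envL B D).hom.app y) =
    (C.envM A B D).map (X := ((C.envM A B B).obj (x, C.envOne B), y)) (Y := (x, y))
      ((C.envR A B).hom.app x, 𝟙 y) := by
  obtain ⟨φ, p⟩ := x
  obtain ⟨ψ, q⟩ := y
  exact congrArg Sigma.SigmaHom.mk (funext fun m =>
    C.triangleAt φ ψ m (D.col m) p (q m))

end SymWeakMulticategory
/-! ### Compatibility of inclusions of letters -/

namespace Word

theorem range_incl {S : Type*} {I L : ℕ} (f : Fin I → Fin L) (A : Fin I → Word S) (l : Fin L) :
    Set.range (incl f A l) = {s | f (pr A s) = l} := by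
  ext s
  exact ⟨by rintro ⟨t, rfl⟩; exact f_pr_incl f A l t, fun h => ⟨_, incl_place f A l s h⟩⟩

theorem incl_surj {S : Type*} {I L : ℕ} (f : Fin I → Fin L) (A : Fin I → Word S)
    (s : Fin (concat A).len) : ∃ l t, incl f A l t = s :=
  ⟨_, _, incl_place f A _ s rfl⟩

theorem incl_const {S : Type*} {I L : ℕ} (f : Fin I → Fin L) (A : Fin I → Word S) (l : Fin L)
    (h : ∀ i, f i = l) (s) : (incl f A l s).val = s.val := by
  have H := enum_unique (incl_strictMono f A l) (strictMono_id (α := Fin (concat A).len))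
    (by rw [range_incl]; simp [h])
  exact congrArg Fin.val (H.2 s (Fin.cast H.1 s) rfl)

theorem pr_congr {S : Type*} {I I' : Type} [Fintype I] [LinearOrder I] [Fintype I']
    [LinearOrder I'] (e : I ≃o I') (A : I → Word S) (A' : I' → Word S)
    (h : ∀ i, A i = A' (e i)) (s : Fin (concat A).len) (t : Fin (concat A').len)
    (hst : s.val = t.val) : pr A' t = e (pr A s) := by
  obtain rfl : A = fun i => A' (e i) := funext h
  have H := (enum_unique (f := fun s => lexCongr e A' (letters (fun i => A' (e i)) s))
    (g := letters A')
    ((lexCongr e A').strictMono.comp (OrderIso.strictMono (letters (fun i => A' (e i)))))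
    (letters A').strictMono
    (by rw [(letters A').surjective.range_eq]
        exact ((lexCongr e A').surjective.comp (letters _).surjective).range_eq)).2 s t hst
  exact (congrArg (fun x => (ofLex x).1) H).symm

/-- The inclusions of letters for a fibre of `h`, and then for a fibre of the restriction of `g`,
compose to the inclusion for a fibre of `g`. -/
theorem incl_incl {S : Type*} {J K L : ℕ} (g : Fin J → Fin K) (h : Fin K → Fin L) (l : Fin L)
    (B : Fin J → Word S) (k : Fin (Fintype.card {k // h k = l}))
    (s : Fin (concat fun j : {j // frestr g h l j = k} => B (femb (h ∘ g) l j)).len)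
    (t : Fin (concat fun j : {j // (h ∘ g) j = l} => B j).len)
    (s' : Fin (concat fun j : {j // g j = femb h l k} => B j).len)
    (hs : s.val = s'.val)
    (ht : t.val = (incl (frestr g h l) (fun j => B (femb (h ∘ g) l j)) k s).val) :
    incl (h ∘ g) B l t = incl g B (femb h l k) s' := by
  have hl := congrArg Word.len (concat_femb (h ∘ g) l B)
  have hpr : ∀ s t, s.val = t.val → pr (fun j : {j // (h ∘ g) j = l} => B j) t =
      monoEquivOfFin {j // (h ∘ g) j = l} rfl (pr (fun j => B (femb (h ∘ g) l j)) s) :=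
    pr_congr (monoEquivOfFin {j // (h ∘ g) j = l} rfl) _ _ fun _ => rfl
  have hpr' : ∀ t, pr B (incl (h ∘ g) B l t) = (pr (fun j : {j // (h ∘ g) j = l} => B j) t).1 := by
    intro t
    unfold incl
    rw [pr, OrderIso.apply_symm_apply]
    rfl
  have hpr2 : ∀ s t, s.val = t.val → pr B (incl (h ∘ g) B l t) =
      femb (h ∘ g) l (pr (fun j => B (femb (h ∘ g) l j)) s) := by
    intro s t e
    rw [hpr', hpr s t e]
    rfl
  have H := (enum_unique (f := fun s => incl (h ∘ g) B l
      (Fin.cast hl (incl (frestr g h l) (fun j => B (femb (h ∘ g) l j)) k s)))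
    (g := incl g B (femb h l k))
    (fun x y hxy => incl_strictMono _ _ _ (incl_strictMono (frestr g h l) _ k hxy))
    (incl_strictMono _ _ _) ?_).2 s s' hs
  · rw [← H]
    exact congrArg _ (Fin.ext ht)
  · rw [range_incl]
    ext q
    constructor
    · rintro ⟨x, rfl⟩
      change g (pr B _) = _
      rw [hpr2 (incl (frestr g h l) (fun j => B (femb (h ∘ g) l j)) k x) _ rfl]
      have e1 := femb_frestr g h l (pr (fun j => B (femb (h ∘ g) l j))
        (incl (frestr g h l) (fun j => B (femb (h ∘ g) l j)) k x))
      refine e1.symm.trans (congrArg (femb h l) ?_)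
      exact f_pr_incl (frestr g h l) (fun j => B (femb (h ∘ g) l j)) k x
    · intro hq
      have hq' : g (pr B q) = femb h l k := hq
      obtain ⟨t, rfl⟩ : q ∈ Set.range (incl (h ∘ g) B l) := by
        rw [range_incl]
        exact (congrArg h hq').trans (femb_spec h l k)
      have e2 := hpr2 (Fin.cast hl.symm t) t rfl
      generalize hu : pr (fun j => B (femb (h ∘ g) l j)) (Fin.cast hl.symm t) = u at e2
      have e4 : g (femb (h ∘ g) l u) = femb h l k := (congrArg g e2.symm).trans hq'
      have e5 : frestr g h l u = k :=
        (femb_strictMono h l).injective ((femb_frestr g h l u).trans e4)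
      have e3 : frestr g h l (pr (fun j => B (femb (h ∘ g) l j)) (Fin.cast hl.symm t)) = k := by
        rw [hu, e5]
      refine ⟨place (frestr g h l) (fun j => B (femb (h ∘ g) l j)) k (Fin.cast hl.symm t) e3, ?_⟩
      have e6 := incl_place (frestr g h l) (fun j => B (femb (h ∘ g) l j)) k (Fin.cast hl.symm t) e3
      exact congrArg (incl (h ∘ g) B l) ((congrArg (Fin.cast hl) e6).trans (Fin.ext rfl))

end Word
namespace SymWeakMulticategory

open MultiCore SymWeakMultiData

variable {C : SymWeakMulticategory.{v, w, u}}

attribute [local irreducible] femb fpos frestr Word.glue Word.incl Word.pr Word.place Word.letters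
  Word.concat Word.fib Word.emb Word.restrict MultiCore.compAt MultiCore.mu SymWeakMultiData.assocAt SymWeakMultiData.lunitAt SymWeakMultiData.runitAt

/-- The components of a morphism of a hom-category of the envelope. -/
noncomputable def ecomp {A B : Word C.Ob} {X Y : C.EnvHom A B} (F : X ⟶ Y) (j : Fin B.len) : C.TArr :=
  match X, Y, F with
  | _, _, .mk f => tarr (f j)

theorem ecomp_id {A B : Word C.Ob} (X : C.EnvHom A B) (j : Fin B.len) :
    ecomp (𝟙 X) j = tarr (𝟙 (X.2 j)) :=
  rfl

theorem arrow_ext {A B : Word C.Ob} {X Y X' Y' : C.EnvHom A B} {F : X ⟶ Y} {F' : X' ⟶ Y'}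
    (hφ : ∀ i, X.1 i = X'.1 i) (h : ∀ j, ecomp F j = ecomp F' j) : Arrow.mk F = Arrow.mk F' := by
  obtain ⟨φ, x⟩ := X
  obtain ⟨φ', x'⟩ := X'
  obtain ⟨f⟩ := F
  obtain ⟨f'⟩ := F'
  obtain rfl : φ = φ' := funext hφ
  have h' := fun j => (Arrow.mk_eq_mk_iff _ _).1 (tarr_inj (h j))
  obtain rfl : x = x' := funext fun j => (h' j).1
  rename_i y y'
  obtain rfl : y = y' := funext fun j => (h' j).2.1
  obtain rfl : f = f' := funext fun j => by
    obtain ⟨_, _, h⟩ := h' j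
    simpa using h
  rfl

theorem env_ext {A B : Word C.Ob} {X X' : C.EnvHom A B}
    (hφ : ∀ i, X.1 i = X'.1 i) (h : ∀ j, tarr (𝟙 (X.2 j)) = tarr (𝟙 (X'.2 j))) : X = X' :=
  ((Arrow.mk_eq_mk_iff _ _).1 (arrow_ext (F := 𝟙 X) (F' := 𝟙 X') hφ h)).1

theorem cast_fst {A A' B B' : Word C.envelopeData.Col} (hA : A = A') (hB : B = B')
    (X : C.envelopeData.Hom A B) (i : Fin A'.len) (i' : Fin A.len) (h : i.val = i'.val) :
    (Sigma.fst (β := fun φ : Fin A'.len → Fin B'.len =>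
      ∀ j, C.Hom (Word.fib A' φ j) (B'.col j)) ((C.envelopeData.cast hA hB).obj X) i).val =
      (Sigma.fst (β := fun φ : Fin A.len → Fin B.len =>
        ∀ j, C.Hom (Word.fib A φ j) (B.col j)) X i').val := by
  subst hA hB
  obtain rfl := Fin.ext h
  rfl

theorem ecomp_cast {A A' B B' : Word C.envelopeData.Col} (hA : A = A') (hB : B = B')
    {X Y : C.envelopeData.Hom A B} (F : X ⟶ Y) (j : Fin B'.len) (j' : Fin B.len)
    (h : j.val = j'.val) :
    ecomp (C := C) (A := A') (B := B') ((C.envelopeData.cast hA hB).map F) j =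
      ecomp (C := C) (A := A) (B := B) F j' := by
  subst hA hB
  obtain rfl := Fin.ext h
  rfl

/-- Induction for families of morphisms of hom-categories of the envelope. -/
theorem fam_ind {Λ : Type*} {A B : Λ → Word C.Ob}
    {motive : ∀ X Y : (∀ l, C.EnvHom (A l) (B l)), (X ⟶ Y) → Prop}
    (mk : ∀ (φ : ∀ l, Fin (A l).len → Fin (B l).len)
      (x y : ∀ l j, C.Hom ((A l).fib (φ l) j) ((B l).col j)) (f : ∀ l, x l ⟶ y l),
      motive (fun l => ⟨φ l, x l⟩) (fun l => ⟨φ l, y l⟩) (fun l => .mk (f l)))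
    (X Y : ∀ l, C.EnvHom (A l) (B l)) (F : X ⟶ Y) : motive X Y F := by
  obtain ⟨φ, x, rfl⟩ : ∃ (φ : ∀ l, Fin (A l).len → Fin (B l).len)
      (x : ∀ l j, C.Hom ((A l).fib (φ l) j) ((B l).col j)), X = fun l => ⟨φ l, x l⟩ :=
    ⟨fun l => (X l).1, fun l => (X l).2, rfl⟩
  obtain ⟨ψ, y, rfl⟩ : ∃ (φ : ∀ l, Fin (A l).len → Fin (B l).len)
      (x : ∀ l j, C.Hom ((A l).fib (φ l) j) ((B l).col j)), Y = fun l => ⟨φ l, x l⟩ :=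
    ⟨fun l => (Y l).1, fun l => (Y l).2, rfl⟩
  obtain rfl : φ = ψ := funext fun l => sigmaHom_fst (F l)
  have hF : F = fun l => .mk (sigmaSnd (F l)) := funext fun l => sigmaHom_mk_snd (F l)
  rw [hF]
  exact mk φ x y _

section Tensor

variable {I J L : ℕ} (f : Fin I → Fin L) (g : Fin J → Fin L)
    (A : Fin I → Word C.Ob) (B : Fin J → Word C.Ob)

theorem tensor_fst_incl (X : ∀ l, C.EnvHom (Word.concat fun i : {i // f i = l} => A i)
      (Word.concat fun j : {j // g j = l} => B j)) (l : Fin L) (s) :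
    ((C.envTensor f g A B).obj X).1 (Word.incl f A l s) = Word.incl g B l ((X l).1 s) :=
  Word.glue_incl f A g B (fun l => (X l).1) l s

theorem tarr_glue (φ : ∀ l, Fin (Word.concat fun i : {i // f i = l} => A i).len →
      Fin (Word.concat fun j : {j // g j = l} => B j).len)
    {x y : ∀ l j, C.Hom ((Word.concat fun i : {i // f i = l} => A i).fib (φ l) j)
      ((Word.concat fun j : {j // g j = l} => B j).col j)} (F : x ⟶ y) (l : Fin L) (s) :
    tarr ((C.envGlue f g A B φ).map F (Word.incl g B l s)) = tarr (F l s) := by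
  refine (tarr_cast _ _ _).trans ?_
  have key : ∀ l' (h : g (Word.pr B (Word.incl g B l s)) = l'),
      tarr (F l' (Word.place g B l' (Word.incl g B l s) h)) = tarr (F l s) := by
    intro l' h
    obtain rfl : l' = l := h.symm.trans (Word.f_pr_incl g B l s)
    exact tarr_idx (F l') (Word.place_incl g B l' s h)
  exact key _ rfl

theorem tarr_id_glue (φ : ∀ l, Fin (Word.concat fun i : {i // f i = l} => A i).len →
      Fin (Word.concat fun j : {j // g j = l} => B j).len)
    (x : ∀ l j, C.Hom ((Word.concat fun i : {i // f i = l} => A i).fib (φ l) j)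
      ((Word.concat fun j : {j // g j = l} => B j).col j)) (l : Fin L) (s) :
    tarr (𝟙 ((C.envGlue f g A B φ).obj x (Word.incl g B l s))) = tarr (𝟙 (x l s)) := by
  have h := tarr_glue f g A B φ (𝟙 x) l s
  rw [CategoryTheory.Functor.map_id] at h
  exact h

theorem ecomp_tensor (X Y : ∀ l, C.EnvHom (Word.concat fun i : {i // f i = l} => A i)
      (Word.concat fun j : {j // g j = l} => B j)) (F : X ⟶ Y) (l : Fin L) (s) :
    ecomp ((C.envTensor f g A B).map F) (Word.incl g B l s) = ecomp (F l) s := by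
  induction X, Y, F using fam_ind with
  | mk φ x y F =>
    exact tarr_glue f g A B φ F l s

end Tensor

theorem tarr_compAt_glue {I J K L : ℕ} (f : Fin I → Fin L) (g : Fin J → Fin L) (h : Fin K → Fin L)
    (A : Fin I → Word C.Ob) (B : Fin J → Word C.Ob) (D : Fin K → Word C.Ob)
    (φ : ∀ l, Fin (Word.concat fun i : {i // f i = l} => A i).len →
      Fin (Word.concat fun j : {j // g j = l} => B j).len)
    (ψ : ∀ l, Fin (Word.concat fun j : {j // g j = l} => B j).len →
      Fin (Word.concat fun k : {k // h k = l} => D k).len)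
    {x y : ∀ l j, C.Hom ((Word.concat fun i : {i // f i = l} => A i).fib (φ l) j)
      ((Word.concat fun j : {j // g j = l} => B j).col j)} (F : x ⟶ y)
    {x' y' : ∀ l k, C.Hom ((Word.concat fun j : {j // g j = l} => B j).fib (ψ l) k)
      ((Word.concat fun k : {k // h k = l} => D k).col k)} (F' : x' ⟶ y') (l : Fin L) (q) :
    tarr ((C.compAt (φ l) (ψ l) q
        ((Word.concat fun k : {k // h k = l} => D k).col q)).map
          (X := (x l, x' l q)) (Y := (y l, y' l q)) (F l, F' l q)) =
      tarr ((C.compAt (Word.glue f A g B φ) (Word.glue g B h D ψ) (Word.incl h D l q)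
        ((Word.concat D).col (Word.incl h D l q))).map
          (X := ((C.envGlue f g A B φ).obj x, (C.envGlue g h B D ψ).obj x' (Word.incl h D l q)))
          (Y := ((C.envGlue f g A B φ).obj y, (C.envGlue g h B D ψ).obj y' (Word.incl h D l q)))
          ((C.envGlue f g A B φ).map F,
            (C.envGlue g h B D ψ).map F' (Word.incl h D l q))) := by
  have e1 := fun j => (tarr_glue f g A B φ F l j).symm
  have e2 := (tarr_glue g h B D ψ F' l q).symm
  have t1 := @tarr_compAt_cart C.toMultiCore (Word.concat A) (Word.concat B)
    (Word.concat fun i : {i // f i = l} => A i) (Word.concat fun j : {j // g j = l} => B j) _ _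
    _ _ _ _ _ _ _ (Word.cart_incl f A g B φ l) (Word.cart_incl g B h D ψ l)
    (fun s => (Word.col_incl f A l s).symm) (fun s => (Word.col_incl g B l s).symm) q
    ((Word.concat D).col (Word.incl h D l q)) ((Word.concat fun k : {k // h k = l} => D k).col q)
    ((C.envGlue f g A B φ).obj x) ((C.envGlue f g A B φ).obj y) (x l) (y l) (F l)
    ((C.envGlue f g A B φ).map F) e1
  have t2 := @t1 ((C.envGlue g h B D ψ).obj x' (Word.incl h D l q))
    ((C.envGlue g h B D ψ).obj y' (Word.incl h D l q)) (x' l q) (y' l q) (F' l q)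
    ((C.envGlue g h B D ψ).map F' (Word.incl h D l q)) e2
  exact t2

theorem envTensor_map {I J L : ℕ} (f : Fin I → Fin L) (g : Fin J → Fin L)
    (A : Fin I → Word C.Ob) (B : Fin J → Word C.Ob)
    (φ : ∀ l, Fin (Word.concat fun i : {i // f i = l} => A i).len →
      Fin (Word.concat fun j : {j // g j = l} => B j).len)
    {x y : ∀ l j, C.Hom ((Word.concat fun i : {i // f i = l} => A i).fib (φ l) j)
      ((Word.concat fun j : {j // g j = l} => B j).col j)} (F : x ⟶ y) :
    (C.envTensor f g A B).map (X := fun l => ⟨φ l, x l⟩) (Y := fun l => ⟨φ l, y l⟩)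
      (fun l => .mk (F l)) = .mk ((C.envGlue f g A B φ).map F) :=
  rfl

theorem envM_map {A B D : Word C.Ob} (φ : Fin A.len → Fin B.len) (ψ : Fin B.len → Fin D.len)
    {x y : ∀ j, C.Hom (A.fib φ j) (B.col j)} (F : x ⟶ y)
    {x' y' : ∀ j, C.Hom (B.fib ψ j) (D.col j)} (F' : x' ⟶ y') :
    (C.envM A B D).map (X := (⟨φ, x⟩, ⟨ψ, x'⟩)) (Y := (⟨φ, y⟩, ⟨ψ, y'⟩)) (.mk F, .mk F') =
      .mk (fun k => (C.compAt φ ψ k (D.col k)).map (X := (x, x' k)) (Y := (y, y' k)) (F, F' k)) :=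
  rfl

theorem ecomp_envM {A B D : Word C.Ob} {φ : Fin A.len → Fin B.len} {ψ : Fin B.len → Fin D.len}
    {x y : ∀ j, C.Hom (A.fib φ j) (B.col j)} (F : x ⟶ y)
    {x' y' : ∀ j, C.Hom (B.fib ψ j) (D.col j)} (F' : x' ⟶ y') (k) :
    ecomp ((C.envM A B D).map (X := (⟨φ, x⟩, ⟨ψ, x'⟩)) (Y := (⟨φ, y⟩, ⟨ψ, y'⟩)) (.mk F, .mk F')) k =
      tarr ((C.compAt φ ψ k (D.col k)).map (X := (x, x' k)) (Y := (y, y' k)) (F, F' k)) :=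
  rfl

theorem env_tensor_m_aux {I J K L : ℕ} (f : Fin I → Fin L) (g : Fin J → Fin L) (h : Fin K → Fin L)
    (A : Fin I → Word C.Ob) (B : Fin J → Word C.Ob) (D : Fin K → Word C.Ob)
    (X Y : ∀ l, C.EnvHom (Word.concat fun i : {i // f i = l} => A i)
      (Word.concat fun j : {j // g j = l} => B j)) (F : X ⟶ Y)
    (X' Y' : ∀ l, C.EnvHom (Word.concat fun j : {j // g j = l} => B j)
      (Word.concat fun k : {k // h k = l} => D k)) (F' : X' ⟶ Y') :
    Arrow.mk ((C.envM _ _ _).map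
        (X := ((C.envTensor f g A B).obj X, (C.envTensor g h B D).obj X'))
        (Y := ((C.envTensor f g A B).obj Y, (C.envTensor g h B D).obj Y'))
        ((C.envTensor f g A B).map F, (C.envTensor g h B D).map F')) =
      Arrow.mk ((C.envTensor f h A D).map
        (X := fun l => (C.envM _ _ _).obj (X l, X' l))
        (Y := fun l => (C.envM _ _ _).obj (Y l, Y' l))
        (fun l => (C.envM _ _ _).map (X := (X l, X' l)) (Y := (Y l, Y' l)) (F l, F' l))) := by
  induction X, Y, F using fam_ind with
  | mk φ x y F =>
  induction X', Y', F' using fam_ind with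
  | mk ψ x' y' F' =>
  refine arrow_ext ?_ ?_
  · intro s
    obtain ⟨l, s, rfl⟩ := Word.incl_surj f A s
    refine Eq.trans ?_ (Word.glue_incl f A h D (fun l => ψ l ∘ φ l) l s).symm
    refine (congrArg (Word.glue g B h D ψ) (Word.glue_incl f A g B φ l s)).trans ?_
    exact Word.glue_incl g B h D ψ l (φ l s)
  · intro q
    obtain ⟨l, q, rfl⟩ := Word.incl_surj h D q
    refine Eq.trans ?_ (ecomp_tensor f h A D _ _ _ l q).symm
    refine Eq.trans ?_ (ecomp_envM (F l) (F' l) q).symm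
    refine Eq.trans ?_ (tarr_compAt_glue f g h A B D φ ψ F F' l q).symm
    rw [envTensor_map, envTensor_map]
    exact ecomp_envM ((C.envGlue f g A B φ).map F) ((C.envGlue g h B D ψ).map F') _

theorem env_tensor_m {I J K L : ℕ} (f : Fin I → Fin L) (g : Fin J → Fin L) (h : Fin K → Fin L)
    (A : Fin I → Word C.Ob) (B : Fin J → Word C.Ob) (D : Fin K → Word C.Ob) :
    (C.envTensor f g A B).prod (C.envTensor g h B D) ⋙
        C.envM (Word.concat A) (Word.concat B) (Word.concat D) =
      (Functor.pi' fun l => (Pi.eval _ l).prod (Pi.eval _ l) ⋙ C.envM _ _ _) ⋙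
        C.envTensor f h A D :=
  functor_eq_of_arrow fun X Y F => env_tensor_m_aux f g h A B D X.1 Y.1 F.1 X.2 Y.2 F.2

end SymWeakMulticategory
namespace SymWeakMulticategory

open MultiCore SymWeakMultiData

variable {C : SymWeakMulticategory.{v, w, u}}

attribute [local irreducible] femb fpos frestr Word.glue Word.incl Word.pr Word.place Word.letters
  Word.concat Word.fib Word.emb Word.restrict MultiCore.compAt MultiCore.mu SymWeakMultiData.assocAt SymWeakMultiData.lunitAt SymWeakMultiData.runitAt

theorem tarr_assocAt_glue {I J K L N : ℕ} (f : Fin I → Fin N) (g : Fin J → Fin N)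
    (h : Fin K → Fin N) (e : Fin L → Fin N)
    (A : Fin I → Word C.Ob) (B : Fin J → Word C.Ob) (D : Fin K → Word C.Ob)
    (E : Fin L → Word C.Ob)
    (φ : ∀ l, Fin (Word.concat fun i : {i // f i = l} => A i).len →
      Fin (Word.concat fun j : {j // g j = l} => B j).len)
    (ψ : ∀ l, Fin (Word.concat fun j : {j // g j = l} => B j).len →
      Fin (Word.concat fun k : {k // h k = l} => D k).len)
    (ξ : ∀ l, Fin (Word.concat fun k : {k // h k = l} => D k).len →
      Fin (Word.concat fun r : {r // e r = l} => E r).len)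
    (x : ∀ l j, C.Hom ((Word.concat fun i : {i // f i = l} => A i).fib (φ l) j)
      ((Word.concat fun j : {j // g j = l} => B j).col j))
    (y : ∀ l k, C.Hom ((Word.concat fun j : {j // g j = l} => B j).fib (ψ l) k)
      ((Word.concat fun k : {k // h k = l} => D k).col k))
    (z : ∀ l r, C.Hom ((Word.concat fun k : {k // h k = l} => D k).fib (ξ l) r)
      ((Word.concat fun r : {r // e r = l} => E r).col r)) (l : Fin N) (q) :
    tarr ((C.assocAt (φ l) (ψ l) (ξ l) q
        ((Word.concat fun r : {r // e r = l} => E r).col q)).hom.app (x l, y l, z l q)) =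
      tarr ((C.assocAt (Word.glue f A g B φ) (Word.glue g B h D ψ) (Word.glue h D e E ξ)
        (Word.incl e E l q) ((Word.concat E).col (Word.incl e E l q))).hom.app
          ((C.envGlue f g A B φ).obj x, (C.envGlue g h B D ψ).obj y,
            (C.envGlue h e D E ξ).obj z (Word.incl e E l q))) := by
  have e1 := fun j => (tarr_id_glue f g A B φ x l j).symm
  have e2 := fun j => (tarr_id_glue g h B D ψ y l j).symm
  have e3 := (tarr_id_glue h e D E ξ z l q).symm
  have t1 := @tarr_assocAt_cart C.toSymWeakMultiData (Word.concat A) (Word.concat B)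
    (Word.concat D)
    (Word.concat fun i : {i // f i = l} => A i) (Word.concat fun j : {j // g j = l} => B j)
    (Word.concat fun k : {k // h k = l} => D k) _ _
    _ _ _ _ _ _ _ _ _ _ (Word.cart_incl f A g B φ l) (Word.cart_incl g B h D ψ l)
    (Word.cart_incl h D e E ξ l)
    (fun s => (Word.col_incl f A l s).symm) (fun s => (Word.col_incl g B l s).symm)
    (fun s => (Word.col_incl h D l s).symm) q
    ((Word.concat E).col (Word.incl e E l q)) ((Word.concat fun r : {r // e r = l} => E r).col q)
    ((C.envGlue f g A B φ).obj x) (x l) e1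
  have t2 := @t1 ((C.envGlue g h B D ψ).obj y) (y l) e2
  have t3 := @t2 ((C.envGlue h e D E ξ).obj z (Word.incl e E l q)) (z l q) e3
  exact t3

theorem ecomp_envA {A B D E : Word C.Ob} (φ : Fin A.len → Fin B.len) (ψ : Fin B.len → Fin D.len)
    (ξ : Fin D.len → Fin E.len) (x : ∀ j, C.Hom (A.fib φ j) (B.col j))
    (y : ∀ k, C.Hom (B.fib ψ k) (D.col k)) (z : ∀ r, C.Hom (D.fib ξ r) (E.col r)) (q) :
    ecomp ((C.envA A B D E).hom.app (⟨φ, x⟩, ⟨ψ, y⟩, ⟨ξ, z⟩)) q =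
      tarr ((C.assocAt φ ψ ξ q (E.col q)).hom.app (x, y, z q)) :=
  rfl

theorem env_tensor_a {I J K L N : ℕ} (f : Fin I → Fin N) (g : Fin J → Fin N) (h : Fin K → Fin N)
    (e : Fin L → Fin N) (A : Fin I → Word C.Ob) (B : Fin J → Word C.Ob) (D : Fin K → Word C.Ob)
    (E : Fin L → Word C.Ob)
    (x : ∀ n, C.EnvHom (Word.concat fun i : {i // f i = n} => A i)
      (Word.concat fun j : {j // g j = n} => B j))
    (y : ∀ n, C.EnvHom (Word.concat fun j : {j // g j = n} => B j)
      (Word.concat fun k : {k // h k = n} => D k))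
    (z : ∀ n, C.EnvHom (Word.concat fun k : {k // h k = n} => D k)
      (Word.concat fun l : {l // e l = n} => E l)) :
    Arrow.mk ((C.envTensor f e A E).map
        (X := fun n => (C.envM _ _ _).obj ((C.envM _ _ _).obj (x n, y n), z n))
        (Y := fun n => (C.envM _ _ _).obj (x n, (C.envM _ _ _).obj (y n, z n)))
        (fun n => (C.envA _ _ _ _).hom.app (x n, y n, z n))) =
      Arrow.mk ((C.envA (Word.concat A) (Word.concat B) (Word.concat D) (Word.concat E)).hom.app
        ((C.envTensor f g A B).obj x, (C.envTensor g h B D).obj y,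
          (C.envTensor h e D E).obj z)) := by
  refine arrow_ext ?_ ?_
  · intro s
    obtain ⟨l, s, rfl⟩ := Word.incl_surj f A s
    refine (Word.glue_incl f A e E (fun l => (z l).1 ∘ (y l).1 ∘ (x l).1) l s).trans ?_
    refine Eq.trans ?_ (congrArg (fun t => Word.glue h D e E (fun l => (z l).1)
      (Word.glue g B h D (fun l => (y l).1) t))
        (Word.glue_incl f A g B (fun l => (x l).1) l s)).symm
    refine Eq.trans ?_ (congrArg (fun t => Word.glue h D e E (fun l => (z l).1) t)
      (Word.glue_incl g B h D (fun l => (y l).1) l _)).symm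
    exact (Word.glue_incl h D e E (fun l => (z l).1) l _).symm
  · intro q
    obtain ⟨l, q, rfl⟩ := Word.incl_surj e E q
    refine (ecomp_tensor f e A E
      (fun n => (C.envM _ _ _).obj ((C.envM _ _ _).obj (x n, y n), z n))
      (fun n => (C.envM _ _ _).obj (x n, (C.envM _ _ _).obj (y n, z n)))
      (fun n => (C.envA _ _ _ _).hom.app (x n, y n, z n)) l q).trans ?_
    refine (ecomp_envA (x l).1 (y l).1 (z l).1 (x l).2 (y l).2 (z l).2 q).trans ?_
    refine (tarr_assocAt_glue f g h e A B D E (fun l => (x l).1) (fun l => (y l).1)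
      (fun l => (z l).1) (fun l => (x l).2) (fun l => (y l).2) (fun l => (z l).2) l q).trans ?_
    exact (ecomp_envA (Word.glue f A g B fun l => (x l).1) (Word.glue g B h D fun l => (y l).1)
      (Word.glue h D e E fun l => (z l).1) ((C.envGlue f g A B fun l => (x l).1).obj fun l => (x l).2)
      ((C.envGlue g h B D fun l => (y l).1).obj fun l => (y l).2)
      ((C.envGlue h e D E fun l => (z l).1).obj fun l => (z l).2) (Word.incl e E l q)).symm

theorem env_tensor_unit {I L : ℕ} (f : Fin I → Fin L) (A : Fin I → Word C.Ob) :
    (C.envTensor f f A A).obj (fun _ => C.envOne _) = C.envOne (Word.concat A) := by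
  refine env_ext ?_ ?_
  · intro s
    obtain ⟨l, s, rfl⟩ := Word.incl_surj f A s
    exact Word.glue_incl f A f A (fun _ => id) l s
  · intro s
    obtain ⟨l, s, rfl⟩ := Word.incl_surj f A s
    refine (tarr_id_glue f f A A (fun _ => id) (fun _ => C.units _) l s).trans ?_
    refine (tarr_units _ _).trans (Eq.trans ?_ (tarr_units (Word.concat A) _).symm)
    rw [Word.col_incl]

theorem env_tensor_l {I J K : ℕ} (f : Fin I → Fin K) (g : Fin J → Fin K)
    (A : Fin I → Word C.Ob) (B : Fin J → Word C.Ob)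
    (x : ∀ k, C.EnvHom (Word.concat fun i : {i // f i = k} => A i)
      (Word.concat fun j : {j // g j = k} => B j)) :
    Arrow.mk ((C.envTensor f g A B).map
        (X := fun k => (C.envM _ _ _).obj (C.envOne _, x k)) (Y := x)
        (fun k => (C.envL _ _).hom.app (x k))) =
      Arrow.mk ((C.envL (Word.concat A) (Word.concat B)).hom.app ((C.envTensor f g A B).obj x)) := by
  refine arrow_ext (fun _ => rfl) ?_
  intro q
  obtain ⟨l, q, rfl⟩ := Word.incl_surj g B q
  refine (ecomp_tensor f g A B _ _ _ l q).trans ?_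
  refine (C.tarr_lunitAt _ (x l).1 q _ _).trans (Eq.trans ?_ (C.tarr_lunitAt (Word.concat A)
    (Word.glue f A g B fun l => (x l).1) (Word.incl g B l q) _ _).symm)
  refine C.tarr_lunit ?_ ?_
  · exact (Word.cart_incl f A g B (fun l => (x l).1) l).fib_eq
      (fun s => (Word.col_incl f A l s).symm) q
  · exact (tarr_id_glue f g A B (fun l => (x l).1) (fun l => (x l).2) l q).symm

theorem env_tensor_r {I J K : ℕ} (f : Fin I → Fin K) (g : Fin J → Fin K)
    (A : Fin I → Word C.Ob) (B : Fin J → Word C.Ob)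
    (x : ∀ k, C.EnvHom (Word.concat fun i : {i // f i = k} => A i)
      (Word.concat fun j : {j // g j = k} => B j)) :
    Arrow.mk ((C.envTensor f g A B).map
        (X := fun k => (C.envM _ _ _).obj (x k, C.envOne _)) (Y := x)
        (fun k => (C.envR _ _).hom.app (x k))) =
      Arrow.mk ((C.envR (Word.concat A) (Word.concat B)).hom.app ((C.envTensor f g A B).obj x)) := by
  refine arrow_ext (fun _ => rfl) ?_
  intro q
  obtain ⟨l, q, rfl⟩ := Word.incl_surj g B q
  refine (ecomp_tensor f g A B _ _ _ l q).trans ?_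
  refine (C.tarr_runitAt (x l).1 q _).trans (Eq.trans ?_ (C.tarr_runitAt
    (A := Word.concat A) (B := Word.concat B)
    (Word.glue f A g B fun l => (x l).1) (Word.incl g B l q) _).symm)
  refine C.tarr_runit ?_ ?_
  · exact (Word.cart_incl f A g B (fun l => (x l).1) l).fib_eq
      (fun s => (Word.col_incl f A l s).symm) q
  · exact (tarr_id_glue f g A B (fun l => (x l).1) (fun l => (x l).2) l q).symm

theorem env_tensor_id {I J : ℕ} (f : Fin I → Fin 1) (g : Fin J → Fin 1)
    (A : Fin I → Word C.envelopeData.Col) (B : Fin J → Word C.envelopeData.Col) :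
    C.envelopeData.tensor f g A B =
      Pi.eval (fun l => C.envelopeData.Hom (Word.concat fun i : {i // f i = l} => A i)
        (Word.concat fun j : {j // g j = l} => B j)) 0 ⋙ C.envelopeData.cast
      (Word.concat_const f 0 (fun _ => Subsingleton.elim _ _) A)
      (Word.concat_const g 0 (fun _ => Subsingleton.elim _ _) B) := by
  refine functor_eq_of_arrow fun X Y F => ?_
  refine arrow_ext (C := C) (A := Word.concat A) (B := Word.concat B) ?_ ?_
  · intro s
    obtain ⟨l, s, rfl⟩ := Word.incl_surj f A s
    obtain rfl : l = 0 := Subsingleton.elim _ _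
    refine (Word.glue_incl f A g B (fun l => Sigma.fst (X l)) 0 s).trans (Fin.ext ?_)
    refine (Word.incl_const g B 0 (fun _ => Subsingleton.elim _ _) _).trans ?_
    exact (cast_fst _ _ (X 0) _ s (Word.incl_const f A 0 (fun _ => Subsingleton.elim _ _) s)).symm
  · intro s
    obtain ⟨l, s, rfl⟩ := Word.incl_surj g B s
    obtain rfl : l = 0 := Subsingleton.elim _ _
    refine (ecomp_tensor f g A B X Y F 0 s).trans ?_
    exact (ecomp_cast _ _ (F 0) _ s
      (Word.incl_const g B 0 (fun _ => Subsingleton.elim _ _) s)).symm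

end SymWeakMulticategory
namespace SymWeakMulticategory

open MultiCore SymWeakMultiData

variable {C : SymWeakMulticategory.{v, w, u}}

attribute [local irreducible] femb fpos frestr Word.glue Word.incl Word.pr Word.place Word.letters
  Word.concat Word.fib Word.emb Word.restrict MultiCore.compAt MultiCore.mu SymWeakMultiData.assocAt SymWeakMultiData.lunitAt SymWeakMultiData.runitAt

/-- The transported family which enters `tensorAt`. -/
noncomputable def rfam {I J K L : ℕ} (f : Fin I → Fin K) (g : Fin J → Fin K)
    (h : Fin K → Fin L) (l : Fin L) (A : Fin I → Word C.envelopeData.Col)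
    (B : Fin J → Word C.envelopeData.Col) :
    (∀ k, C.envelopeData.Hom (Word.concat fun i : {i // f i = k} => A i)
      (Word.concat fun j : {j // g j = k} => B j)) ⥤
    (∀ k, C.EnvHom (Word.concat fun i : {i // frestr f h l i = k} => A (femb (h ∘ f) l i))
      (Word.concat fun j : {j // frestr g h l j = k} => B (femb (h ∘ g) l j))) :=
  Functor.pi' fun k =>
    Pi.eval (fun k => C.envelopeData.Hom (Word.concat fun i : {i // f i = k} => A i)
        (Word.concat fun j : {j // g j = k} => B j)) (femb h l k) ⋙
      C.envelopeData.cast (Word.concat_frestr f h l k A) (Word.concat_frestr g h l k B)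

theorem tensorAt_eq {I J K L : ℕ} (f : Fin I → Fin K) (g : Fin J → Fin K)
    (h : Fin K → Fin L) (l : Fin L) (A : Fin I → Word C.envelopeData.Col)
    (B : Fin J → Word C.envelopeData.Col) :
    C.envelopeData.tensorAt f g h l A B = rfam f g h l A B ⋙
      C.envTensor (frestr f h l) (frestr g h l) (fun i => A (femb (h ∘ f) l i))
        (fun j => B (femb (h ∘ g) l j)) ⋙
      C.envelopeData.cast (Word.concat_femb (h ∘ f) l A) (Word.concat_femb (h ∘ g) l B) :=
  rfl

theorem tensorAt_obj {I J K L : ℕ} (f : Fin I → Fin K) (g : Fin J → Fin K)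
    (h : Fin K → Fin L) (l : Fin L) (A : Fin I → Word C.envelopeData.Col)
    (B : Fin J → Word C.envelopeData.Col)
    (X : ∀ k, C.envelopeData.Hom (Word.concat fun i : {i // f i = k} => A i)
      (Word.concat fun j : {j // g j = k} => B j)) :
    (C.envelopeData.tensorAt f g h l A B).obj X =
      (C.envelopeData.cast (Word.concat_femb (h ∘ f) l A) (Word.concat_femb (h ∘ g) l B)).obj
        ((C.envTensor (frestr f h l) (frestr g h l) (fun i => A (femb (h ∘ f) l i))
          (fun j => B (femb (h ∘ g) l j))).obj ((rfam f g h l A B).obj X)) :=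
  rfl

theorem ecomp_congr {T : Type*} [Category* T] {A B : Word C.Ob} {G G' : T ⥤ C.EnvHom A B}
    (h : G = G') {X Y : T} (F : X ⟶ Y) (j : Fin B.len) :
    ecomp (G.map F) j = ecomp (G'.map F) j := by
  rw [h]

theorem ecomp_comp₂ {T T' T'' : Type*} [Category* T] [Category* T'] [Category* T'']
    {A B : Word C.Ob} (G : T ⥤ T') (H : T' ⥤ T'') (K : T'' ⥤ C.EnvHom A B) {X Y : T} (F : X ⟶ Y)
    (j : Fin B.len) :
    ecomp ((G ⋙ H ⋙ K).map F) j = ecomp (K.map (H.map (G.map F))) j :=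
  rfl

theorem tensorAt_fst {I J K L : ℕ} (f : Fin I → Fin K) (g : Fin J → Fin K) (h : Fin K → Fin L)
    (l : Fin L) (A : Fin I → Word C.envelopeData.Col) (B : Fin J → Word C.envelopeData.Col)
    (X : ∀ k, C.envelopeData.Hom (Word.concat fun i : {i // f i = k} => A i)
      (Word.concat fun j : {j // g j = k} => B j)) (k : Fin (Fintype.card {k // h k = l}))
    (s : Fin (Word.concat fun i : {i // frestr f h l i = k} => A (femb (h ∘ f) l i)).len)
    (t : Fin (Word.concat fun i : {i // (h ∘ f) i = l} => A i).len)
    (s' : Fin (Word.concat fun i : {i // f i = femb h l k} => A i).len)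
    (hs : s.val = s'.val)
    (ht : t.val = (Word.incl (frestr f h l) (fun i => A (femb (h ∘ f) l i)) k s).val) :
    Word.incl (h ∘ g) B l (Sigma.fst
      (β := fun φ : Fin (Word.concat fun i : {i // (h ∘ f) i = l} => A i).len →
          Fin (Word.concat fun j : {j // (h ∘ g) j = l} => B j).len =>
        ∀ j, C.Hom (Word.fib _ φ j) ((Word.concat fun j : {j // (h ∘ g) j = l} => B j).col j))
      ((C.envelopeData.tensorAt f g h l A B).obj X) t) =
    Word.incl g B (femb h l k) (Sigma.fst
      (β := fun φ : Fin (Word.concat fun i : {i // f i = femb h l k} => A i).len →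
          Fin (Word.concat fun j : {j // g j = femb h l k} => B j).len =>
        ∀ j, C.Hom (Word.fib _ φ j) ((Word.concat fun j : {j // g j = femb h l k} => B j).col j))
      (X (femb h l k)) s') := by
  have e1 := cast_fst (C := C) (Word.concat_femb (h ∘ f) l A) (Word.concat_femb (h ∘ g) l B)
    ((C.envTensor (frestr f h l) (frestr g h l) (fun i => A (femb (h ∘ f) l i))
      (fun j => B (femb (h ∘ g) l j))).obj ((rfam f g h l A B).obj X)) t
    (Word.incl (frestr f h l) (fun i => A (femb (h ∘ f) l i)) k s) ht
  have e2 := tensor_fst_incl (frestr f h l) (frestr g h l) (fun i => A (femb (h ∘ f) l i))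
      (fun j => B (femb (h ∘ g) l j)) ((rfam f g h l A B).obj X) k s
  have e3 := cast_fst (C := C) (Word.concat_frestr f h l k A) (Word.concat_frestr g h l k B)
    (X (femb h l k)) s s' hs
  have e4 := e1.trans (congrArg Fin.val e2)
  have e5 := Word.incl_incl g h l B k (((rfam f g h l A B).obj X k).1 s) _ _ e3 e4
  rw [tensorAt_obj]
  exact e5

theorem ecomp_tensorAt {I J K L : ℕ} (f : Fin I → Fin K) (g : Fin J → Fin K) (h : Fin K → Fin L)
    (l : Fin L) (A : Fin I → Word C.envelopeData.Col) (B : Fin J → Word C.envelopeData.Col)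
    (X Y : ∀ k, C.envelopeData.Hom (Word.concat fun i : {i // f i = k} => A i)
      (Word.concat fun j : {j // g j = k} => B j)) (F : X ⟶ Y)
    (k : Fin (Fintype.card {k // h k = l}))
    (s : Fin (Word.concat fun j : {j // frestr g h l j = k} => B (femb (h ∘ g) l j)).len)
    (t : Fin (Word.concat fun j : {j // (h ∘ g) j = l} => B j).len)
    (s' : Fin (Word.concat fun j : {j // g j = femb h l k} => B j).len)
    (hs : s.val = s'.val)
    (ht : t.val = (Word.incl (frestr g h l) (fun j => B (femb (h ∘ g) l j)) k s).val) :
    ecomp (C := C) (A := Word.concat fun i : {i // (h ∘ f) i = l} => A i)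
      (B := Word.concat fun j : {j // (h ∘ g) j = l} => B j)
      ((C.envelopeData.tensorAt f g h l A B).map F) t =
    ecomp (C := C) (A := Word.concat fun i : {i // f i = femb h l k} => A i)
      (B := Word.concat fun j : {j // g j = femb h l k} => B j) (F (femb h l k)) s' := by
  have e1 := ecomp_cast (C := C) (Word.concat_femb (h ∘ f) l A) (Word.concat_femb (h ∘ g) l B)
    ((C.envTensor (frestr f h l) (frestr g h l) (fun i => A (femb (h ∘ f) l i))
      (fun j => B (femb (h ∘ g) l j))).map ((rfam f g h l A B).map F)) t
    (Word.incl (frestr g h l) (fun j => B (femb (h ∘ g) l j)) k s) ht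
  have e2 := ecomp_tensor (frestr f h l) (frestr g h l) (fun i => A (femb (h ∘ f) l i))
      (fun j => B (femb (h ∘ g) l j)) ((rfam f g h l A B).obj X) ((rfam f g h l A B).obj Y)
      ((rfam f g h l A B).map F) k s
  have e3 := ecomp_cast (C := C) (Word.concat_frestr f h l k A) (Word.concat_frestr g h l k B)
    (F (femb h l k)) s s' hs
  have e4 := e1.trans (e2.trans e3)
  have e5 := ecomp_comp₂ (C := C) (A := Word.concat fun i : {i // (h ∘ f) i = l} => A i)
    (B := Word.concat fun j : {j // (h ∘ g) j = l} => B j) (rfam f g h l A B)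
    (C.envTensor (frestr f h l) (frestr g h l) (fun i => A (femb (h ∘ f) l i))
        (fun j => B (femb (h ∘ g) l j)))
    (C.envelopeData.cast (Word.concat_femb (h ∘ f) l A) (Word.concat_femb (h ∘ g) l B)) F t
  have e6 := ecomp_congr (C := C) (A := Word.concat fun i : {i // (h ∘ f) i = l} => A i)
    (B := Word.concat fun j : {j // (h ∘ g) j = l} => B j) (tensorAt_eq f g h l A B) F t
  exact e6.trans (e5.trans e4)

theorem env_tensor_tensor {I J K L : ℕ} (f : Fin I → Fin K) (g : Fin J → Fin K)
    (h : Fin K → Fin L) (A : Fin I → Word C.envelopeData.Col)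
    (B : Fin J → Word C.envelopeData.Col) :
    C.envelopeData.tensor f g A B =
      (Functor.pi' fun l => C.envelopeData.tensorAt f g h l A B) ⋙
        C.envelopeData.tensor (h ∘ f) (h ∘ g) A B := by
  refine functor_eq_of_arrow fun X Y F => ?_
  refine arrow_ext (C := C) (A := Word.concat A) (B := Word.concat B) ?_ ?_
  · intro q
    obtain ⟨l, t, rfl⟩ := Word.incl_surj (h ∘ f) A q
    obtain ⟨k, s, hs⟩ := Word.incl_surj (frestr f h l) (fun i => A (femb (h ∘ f) l i))
      (Fin.cast (congrArg Word.len (Word.concat_femb (h ∘ f) l A)).symm t)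
    have ht := congrArg Fin.val hs.symm
    let s' : Fin (Word.concat fun i : {i // f i = femb h l k} => A i).len :=
      Fin.cast (congrArg Word.len (Word.concat_frestr f h l k A)).symm s
    refine Eq.trans ?_ (tensor_fst_incl (h ∘ f) (h ∘ g) A B
      (fun l => (C.envelopeData.tensorAt f g h l A B).obj X) l t).symm
    refine Eq.trans ?_ (tensorAt_fst f g h l A B X k s t s' rfl ht).symm
    refine Eq.trans ?_ (tensor_fst_incl f g A B X (femb h l k) s')
    exact congrArg _ (Word.incl_incl f h l A k s t s' rfl ht)
  · intro q
    obtain ⟨l, t, rfl⟩ := Word.incl_surj (h ∘ g) B q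
    obtain ⟨k, s, hs⟩ := Word.incl_surj (frestr g h l) (fun i => B (femb (h ∘ g) l i))
      (Fin.cast (congrArg Word.len (Word.concat_femb (h ∘ g) l B)).symm t)
    have ht := congrArg Fin.val hs.symm
    let s' : Fin (Word.concat fun i : {i // g i = femb h l k} => B i).len :=
      Fin.cast (congrArg Word.len (Word.concat_frestr g h l k B)).symm s
    refine Eq.trans ?_ (ecomp_tensor (h ∘ f) (h ∘ g) A B
      (fun l => (C.envelopeData.tensorAt f g h l A B).obj X)
      (fun l => (C.envelopeData.tensorAt f g h l A B).obj Y)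
      (fun l => (C.envelopeData.tensorAt f g h l A B).map F) l t).symm
    refine Eq.trans ?_ (ecomp_tensorAt f g h l A B X Y F k s t s' rfl ht).symm
    refine Eq.trans ?_ (ecomp_tensor f g A B X Y F (femb h l k) s')
    exact congrArg _ (Word.incl_incl g h l B k s t s' rfl ht)

end SymWeakMulticategory
namespace SymWeakMulticategory

attribute [local irreducible] femb fpos frestr Word.glue Word.incl Word.pr Word.place Word.letters
  Word.concat Word.fib Word.emb Word.restrict MultiCore.compAt MultiCore.mu
  SymWeakMultiData.assocAt SymWeakMultiData.lunitAt SymWeakMultiData.runitAt envM envTensor envA envL envR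

/-- The biprop envelope of a symmetric weak multicategory. -/
noncomputable def envelope (C : SymWeakMulticategory.{v, w, u}) : Biprop.{v, max v w, u} :=
  Biprop.mk C.envelopeData C.env_pentagon C.env_triangle env_tensor_m env_tensor_a env_tensor_id
    env_tensor_unit env_tensor_l env_tensor_r env_tensor_tensor

end SymWeakMulticategory
namespace SymWeakMultifunctor

variable {C D : SymWeakMulticategory.{v, w, u}} (F : SymWeakMultifunctor C D)

/-- The functor `∐_{φ : I → J} ∏_{j ∈ J} F_{(X_i)_{i ∈ φ⁻¹ j}; Y_j}`. -/
noncomputable def envFn (A B : Word C.Ob) :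
    C.EnvHom A B ⥤ D.EnvHom (A.map F.ob) (B.map F.ob) :=
  sigmaFunctor (R := fun φ : Fin (A.map F.ob).len → Fin (B.map F.ob).len =>
      ∀ j, D.Hom ((A.map F.ob).fib φ j) ((B.map F.ob).col j)) (fun φ => φ)
    fun φ =>
      letI (j : Fin B.len) : Category (D.Hom ((A.map F.ob).fib φ j) ((B.map F.ob).col j)) :=
        D.cat _ _
      Functor.pi (C := fun j => C.Hom (A.fib φ j) (B.col j))
      (D := fun j => D.Hom ((A.map F.ob).fib φ j) ((B.map F.ob).col j))
      fun j => F.fn (A.fib φ j) (B.col j)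

/-- The isomorphism `∐_{(φ,ψ)} ∏_k F^{φ| : φ⁻¹ψ⁻¹k → ψ⁻¹k}`. -/
noncomputable def envComp (A B E : Word C.Ob) :
    (F.envFn A B).prod (F.envFn B E) ⋙ D.envM (A.map F.ob) (B.map F.ob) (E.map F.ob) ≅
      C.envM A B E ⋙ F.envFn A E :=
  NatIso.ofComponents
    (fun x => (Sigma.incl (C := fun φ : Fin (A.map F.ob).len → Fin (E.map F.ob).len =>
        ∀ j, D.Hom ((A.map F.ob).fib φ j) ((E.map F.ob).col j)) (x.2.1 ∘ x.1.1)).mapIso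
      (Pi.isoMk fun k => (F.compAt x.1.1 x.2.1 k (E.col k)).app (x.1.2, x.2.2 k)))
    (by
      rintro ⟨⟨φ, p⟩, ⟨ψ, q⟩⟩ ⟨⟨φ', p'⟩, ⟨ψ', q'⟩⟩ ⟨⟨x⟩, ⟨y⟩⟩
      refine congrArg Sigma.SigmaHom.mk (funext fun k => ?_)
      exact (F.compAt φ ψ k (E.col k)).hom.naturality
        (X := (p, q k)) (Y := (_, _)) (x, y k))

noncomputable def envUnit (A : Word C.Ob) :
    D.envOne (A.map F.ob) ≅ (F.envFn A A).obj (C.envOne A) :=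
  (Sigma.incl (C := fun φ : Fin (A.map F.ob).len → Fin (A.map F.ob).len =>
      ∀ j, D.Hom ((A.map F.ob).fib φ j) ((A.map F.ob).col j)) id).mapIso
    (Pi.isoMk fun i => F.units A i)

/-- The data of the morphism of biprops induced by a symmetric weak multifunctor. -/
noncomputable def envelope : BipropMorphismData C.envelope D.envelope where
  col := F.ob
  fn := F.envFn
  comp := F.envComp
  one := F.envUnit

end SymWeakMultifunctor

/-!
Every structure functor and structure isomorphism of the envelope is given componentwise, over the
fibres of maps of finite ordered sets, by the corresponding data of the symmetric weak multicategory
or multifunctor. So each of the five equations can be checked on components.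

Equations 3, 4 and 5, evaluated at a letter `m` of the target word, are the axioms `map_assoc`,
`map_runit` and `map_lunit` of `F` for the maps restricted to the fibres over `m`; these are
`SymWeakMultifunctor.map_assocAt`, `map_runitAt` and `map_lunitAt`. Equations 1 and 2 hold because
a letter of a concatenation lies in a unique block `l`, and the component of a tensor product at
that letter is the component of its `l`-th factor (`ecomp_tensor`); for equation 2 one needs in addition
that the component of `F^φ` depends only on the fibres, which are the same in the assembled map and
in its `l`-th block. The latter is `SymWeakMultifunctorData.tarr_compAt_cart`, applied to the
cartesian square `Word.cart_incl`.

The words which index the hom-categories on the two sides are equal, but not by definition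
(a fibre of a restricted map is a fibre of the original map, and so on). Morphisms are therefore
compared through `MultiCore.tarr`, which packages a morphism with its indices, and each piece of
structure comes with a congruence lemma for `tarr`. In contrast, `Word.map` commutes with fibres and
concatenations by definition, so applying `F` requires no transport.
-/

/-! ### Congruence of the structure of a multifunctor in its indices -/

namespace SymWeakMultifunctorData

open MultiCore

variable {C D : SymWeakMulticategory.{v, w, u}} (F : SymWeakMultifunctorData C D)

theorem tarr_fn {A A' : Word C.Ob} {Y Y' : C.Ob} {x y : C.Hom A Y} {x' y' : C.Hom A' Y'}
    {f : x ⟶ y} {f' : x' ⟶ y'} (h : tarr f = tarr f') :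
    tarr ((F.fn A Y).map f) = tarr ((F.fn A' Y').map f') :=
  congrArg (fun t : C.TArr =>
    (⟨t.1.map F.ob, F.ob t.2.1, (F.fn t.1 t.2.1).mapArrow.obj t.2.2⟩ : D.TArr)) h

theorem tarr_id_fn {A A' : Word C.Ob} {Y Y' : C.Ob} {x : C.Hom A Y} {x' : C.Hom A' Y'}
    (h : tarr (𝟙 x) = tarr (𝟙 x')) :
    tarr (𝟙 ((F.fn A Y).obj x)) = tarr (𝟙 ((F.fn A' Y').obj x')) := by
  rw [← CategoryTheory.Functor.map_id, ← CategoryTheory.Functor.map_id]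
  exact F.tarr_fn h

theorem tarr_comp {A B A' B' : Word C.Ob} (hA : A = A') (hB : B = B')
    (φ : Fin A.len → Fin B.len) (φ' : Fin A'.len → Fin B'.len)
    (hφ : ∀ i i', i.val = i'.val → (φ i).val = (φ' i').val)
    (W W') (hW) (hW') {Z Z' : C.Ob}
    {p : ∀ j, C.Hom (W j) (B.col j)} {p' : ∀ j, C.Hom (W' j) (B'.col j)}
    (hp : ∀ j j', j.val = j'.val → tarr (𝟙 (p j)) = tarr (𝟙 (p' j')))
    {z : C.Hom B Z} {z' : C.Hom B' Z'} (hz : tarr (𝟙 z) = tarr (𝟙 z')) :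
    tarr ((F.comp φ W hW Z).hom.app (p, z)) = tarr ((F.comp φ' W' hW' Z').hom.app (p', z')) := by
  subst hA hB
  obtain rfl : φ = φ' := funext fun i => Fin.ext (hφ i i rfl)
  obtain rfl : W = W' := funext fun j => (hW j).trans (hW' j).symm
  obtain rfl : Z = Z' := by
    simp only [tarr, TArr, Sigma.mk.injEq, heq_eq_eq, true_and] at hz
    exact hz.1
  obtain rfl : p = p' := funext fun j => eq_of_tarr (hp j j rfl)
  obtain rfl := eq_of_tarr hz
  rfl

/-- `F^{φ|}` depends only on the fibres of the maps involved: it takes the same value over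
corresponding points of two composable pairs of maps which are related by cartesian squares. -/
theorem tarr_compAt_cart {A B A' B' : Word C.Ob} {n n' : ℕ} {a : Fin A'.len → Fin A.len}
    {b : Fin B'.len → Fin B.len} {c : Fin n' → Fin n} {φ' : Fin A'.len → Fin B'.len}
    {φ : Fin A.len → Fin B.len} {ψ' : Fin B'.len → Fin n'} {ψ : Fin B.len → Fin n}
    (h : Cart a b φ' φ) (k : Cart b c ψ' ψ) (ha : ∀ s, A'.col s = A.col (a s))
    (hb : ∀ s, B'.col s = B.col (b s)) (l : Fin n') {Z Z' : C.Ob}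
    {x : ∀ j, C.Hom (A.fib φ j) (B.col j)} {x' : ∀ j, C.Hom (A'.fib φ' j) (B'.col j)}
    (hx : ∀ j, tarr (𝟙 (x' j)) = tarr (𝟙 (x (b j))))
    {z : C.Hom (B.fib ψ (c l)) Z} {z' : C.Hom (B'.fib ψ' l) Z'} (hz : tarr (𝟙 z') = tarr (𝟙 z)) :
    tarr ((F.compAt φ' ψ' l Z').hom.app (x', z')) =
      tarr ((F.compAt φ ψ (c l) Z).hom.app (x, z)) := by
  have h1 : A'.fib (ψ' ∘ φ') l = A.fib (ψ ∘ φ) (c l) := (h.comp k).fib_eq ha l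
  have h2 : B'.fib ψ' l = B.fib ψ (c l) := k.fib_eq hb l
  refine F.tarr_comp h1 h2 (A'.restrict B' φ' ψ' l) (A.restrict B φ ψ (c l)) ?_ _ _ _ _ ?_ hz
  · exact fun s s' e => h.frestr_eq k l s s' e
  · exact fun j j' e => (hx _).trans (tarr_idx (𝟙 x) (k.femb_eq l j j' e))

theorem tarr_oneCast {A : Word C.Ob} {X : C.Ob} (h : Word.single X = A) :
    tarr (F.oneCast h).hom = tarr (F.one X).hom := by
  subst h
  rfl

theorem tarr_units (A : Word C.Ob) (i : Fin A.len) :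
    tarr (F.units A i).hom = tarr (F.one (A.col i)).hom :=
  F.tarr_oneCast (Word.fib_id A i).symm

/-- For `k ∈ ξ⁻¹m`, restricting `φ` to the fibres over `k` directly, or first to the fibres over `m`,
gives the same value of `F^{φ|}`. -/
theorem tarr_compAt_restr {A B E : Word C.Ob} {n : ℕ} (φ : Fin A.len → Fin B.len)
    (ψ : Fin B.len → Fin E.len) (ξ : Fin E.len → Fin n) (m : Fin n)
    (p : ∀ j, C.Hom (A.fib φ j) (B.col j)) (q : ∀ k, C.Hom (B.fib ψ k) (E.col k))
    (l : Fin (E.fib ξ m).len) :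
    tarr ((F.compAt φ ψ (E.emb ξ m l) (E.col (E.emb ξ m l))).hom.app (p, q (E.emb ξ m l))) =
      tarr ((F.compAt (A.restrict B φ (ξ ∘ ψ) m) (B.restrict E ψ ξ m) l
        ((E.fib ξ m).col l)).hom.app
          ((C.restr φ (ξ ∘ ψ) m).obj p, (C.restr ψ ξ m).obj q l)) := by
  symm
  exact F.tarr_compAt_cart
    (A := A) (B := B) (A' := A.fib (ξ ∘ ψ ∘ φ) m) (B' := B.fib (ξ ∘ ψ) m)
    (φ' := A.restrict B φ (ξ ∘ ψ) m)
    (ψ' := B.restrict E ψ ξ m) (φ := φ) (ψ := ψ)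
    (a := A.emb (ξ ∘ ψ ∘ φ) m) (b := B.emb (ξ ∘ ψ) m) (c := E.emb ξ m)
    (Z := E.col (E.emb ξ m l)) (Z' := (E.fib ξ m).col l) (x := p) (z := q (E.emb ξ m l))
    (x' := (C.restr φ (ξ ∘ ψ) m).obj p) (z' := (C.restr ψ ξ m).obj q l)
    (Cart.frestr φ (ξ ∘ ψ) m) (Cart.frestr ψ ξ m)
    (fun _ => rfl) (fun _ => rfl) l (C.tarr_restr φ (ξ ∘ ψ) m p) (C.tarr_restr ψ ξ m q l)

end SymWeakMultifunctorData

/-! ### The axioms of a multifunctor over a fibre -/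

namespace SymWeakMultifunctor

open MultiCore SymWeakMultiData

variable {C D : SymWeakMulticategory.{v, w, u}} (F : SymWeakMultifunctor C D)

/-- The compatibility of `F` with the associators, for the restricted maps
`φ⁻¹ψ⁻¹ξ⁻¹m → ψ⁻¹ξ⁻¹m → ξ⁻¹m`. -/
theorem map_assocAt {A B E : Word C.Ob} {n : ℕ} (φ : Fin A.len → Fin B.len)
    (ψ : Fin B.len → Fin E.len) (ξ : Fin E.len → Fin n) (m : Fin n) (Z : C.Ob)
    (p : ∀ j, C.Hom (A.fib φ j) (B.col j)) (q : ∀ k, C.Hom (B.fib ψ k) (E.col k))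
    (z : C.Hom (E.fib ξ m) Z) :
    (D.compAt (A := A.map F.ob) (B := E.map F.ob) (ψ ∘ φ) ξ m (F.ob Z)).map
        (X := (fun k => (D.compAt (A := A.map F.ob) (B := B.map F.ob) φ ψ k
          (F.ob (E.col k))).obj
          (fun j => (F.fn _ _).obj (p j), (F.fn _ _).obj (q k)), (F.fn _ _).obj z))
        (Y := (fun k => (F.fn _ _).obj ((C.compAt φ ψ k (E.col k)).obj (p, q k)),
          (F.fn _ _).obj z))
        (fun k => (F.compAt φ ψ k (E.col k)).hom.app (p, q k), 𝟙 _) ≫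
      (F.compAt (ψ ∘ φ) ξ m Z).hom.app
        (fun k => (C.compAt φ ψ k (E.col k)).obj (p, q k), z) ≫
      (F.fn (A.fib (ξ ∘ ψ ∘ φ) m) Z).map ((C.assocAt φ ψ ξ m Z).hom.app (p, q, z)) =
    (D.assocAt (A := A.map F.ob) (B := B.map F.ob) (D := E.map F.ob) φ ψ ξ m (F.ob Z)).hom.app
        (fun j => (F.fn _ _).obj (p j), fun k => (F.fn _ _).obj (q k), (F.fn _ _).obj z) ≫
      (D.compAt (A := A.map F.ob) (B := B.map F.ob) φ (ξ ∘ ψ) m (F.ob Z)).map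
        (X := (fun j => (F.fn _ _).obj (p j), (D.compAt (A := B.map F.ob) (B := E.map F.ob) ψ ξ m
          (F.ob Z)).obj (fun k => (F.fn _ _).obj (q k), (F.fn _ _).obj z)))
        (Y := (fun j => (F.fn _ _).obj (p j), (F.fn _ _).obj ((C.compAt ψ ξ m Z).obj (q, z))))
        (𝟙 _, (F.compAt ψ ξ m Z).hom.app (q, z)) ≫
      (F.compAt φ (ξ ∘ ψ) m Z).hom.app (p, (C.compAt ψ ξ m Z).obj (q, z)) := by
  have key := F.map_assoc (A.restrict B φ (ξ ∘ ψ) m) (B.restrict E ψ ξ m) Z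
    ((C.restr φ (ξ ∘ ψ) m).obj p) ((C.restr ψ ξ m).obj q) z
  have hp := C.tarr_restr φ (ξ ∘ ψ) m p
  have hq := C.tarr_restr ψ ξ m q
  apply tarr_ext
  refine Eq.trans (tarr_comp_congr ?_ (tarr_comp_congr ?_ ?_))
    ((congrArg tarr key).trans (tarr_comp_congr ?_ (tarr_comp_congr ?_ ?_)))
  · refine MultiCore.tarr_comp (C := D.toMultiCore) (A := (A.fib (ξ ∘ ψ ∘ φ) m).map F.ob)
      (B := (E.fib ξ m).map F.ob) rfl rfl
      (A.restrict E (ψ ∘ φ) ξ m)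
      (B.restrict E ψ ξ m ∘ A.restrict B φ (ξ ∘ ψ) m) ?_ _ _ _ _ _ _ ?_ _ _ rfl
    · intro i i' e
      obtain rfl := Fin.ext e
      exact congrArg Fin.val (congrFun (frestr_frestr φ ψ ξ m) i)
    · intro l l' e
      obtain rfl := Fin.ext e
      exact F.tarr_compAt_restr φ ψ ξ m p q l
  · refine F.tarr_comp rfl rfl (A.restrict E (ψ ∘ φ) ξ m)
      (B.restrict E ψ ξ m ∘ A.restrict B φ (ξ ∘ ψ) m) ?_ _ _ _ _ ?_ rfl
    · intro i i' e
      obtain rfl := Fin.ext e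
      exact congrArg Fin.val (congrFun (frestr_frestr φ ψ ξ m) i)
    · intro l l' e
      obtain rfl := Fin.ext e
      exact C.tarr_id_compAt_restr φ ψ ξ m p q l
  · exact F.tarr_fn (C.tarr_assocAt φ ψ ξ m Z p q z)
  · refine Eq.trans ?_ (D.tarr_assocAt (A := A.map F.ob) (B := B.map F.ob) (D := E.map F.ob)
      φ ψ ξ m (F.ob Z) _ _ _).symm
    refine D.tarr_assoc (A := (A.fib (ξ ∘ ψ ∘ φ) m).map F.ob)
      (B := (B.fib (ξ ∘ ψ) m).map F.ob) (D := (E.fib ξ m).map F.ob) rfl rfl rfl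
      _ _ (fun i i' e => by rw [Fin.ext e]; rfl) _ _
      (fun i i' e => by rw [Fin.ext e]; rfl) ?_ ?_ rfl
    · intro j j' e
      obtain rfl := Fin.ext e
      refine Eq.trans ?_ (D.tarr_restr (A := A.map F.ob) (B := B.map F.ob) φ (ξ ∘ ψ) m _ j).symm
      exact F.tarr_id_fn (hp j)
    · intro j j' e
      obtain rfl := Fin.ext e
      refine Eq.trans ?_ (D.tarr_restr (A := B.map F.ob) (B := E.map F.ob) ψ ξ m _ j).symm
      exact F.tarr_id_fn (hq j)
  · refine MultiCore.tarr_comp (C := D.toMultiCore) (A := (A.fib (ξ ∘ ψ ∘ φ) m).map F.ob)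
      (B := (B.fib (ξ ∘ ψ) m).map F.ob) rfl rfl
      (A.restrict B φ (ξ ∘ ψ) m) (A.restrict B φ (ξ ∘ ψ) m)
      (fun i i' e => by rw [Fin.ext e]) _ _ _ _ _ _ ?_ _ _ ?_
    · intro j j' e
      obtain rfl := Fin.ext e
      exact F.tarr_id_fn (hp j)
    · refine F.tarr_comp rfl rfl (B.restrict E ψ ξ m) (B.restrict E ψ ξ m)
        (fun i i' e => by rw [Fin.ext e]) _ _ _ _ ?_ rfl
      intro j j' e
      obtain rfl := Fin.ext e
      exact hq j
  · refine F.tarr_comp rfl rfl (A.restrict B φ (ξ ∘ ψ) m) (A.restrict B φ (ξ ∘ ψ) m)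
      (fun i i' e => by rw [Fin.ext e]) _ _ _ _ ?_ ?_
    · intro j j' e
      obtain rfl := Fin.ext e
      exact hp j
    · refine tarr_id_comp rfl rfl (B.restrict E ψ ξ m) (B.restrict E ψ ξ m)
        (fun i i' e => by rw [Fin.ext e]) _ _ _ _ ?_ rfl
      intro j j' e
      obtain rfl := Fin.ext e
      exact hq j

/-- The compatibility of `F` with the left unitor over the fibre `φ⁻¹ j`. -/
theorem map_lunitAt {A : Word C.Ob} {n : ℕ} (φ : Fin A.len → Fin n) (j : Fin n) (Z : C.Ob)
    (z : C.Hom (A.fib φ j) Z) :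
    (D.compAt (A := A.map F.ob) (B := A.map F.ob) id φ j (F.ob Z)).map
        (X := (D.units (A.map F.ob), (F.fn _ _).obj z))
        (Y := (fun i => (F.fn _ _).obj (C.units A i), (F.fn _ _).obj z))
        (fun i => (F.units A i).hom, 𝟙 _) ≫
      (F.compAt id φ j Z).hom.app (C.units A, z) ≫
      (F.fn (A.fib φ j) Z).map ((C.lunitAt A φ j Z).hom.app z) =
    (D.lunitAt (A.map F.ob) φ j (F.ob Z)).hom.app ((F.fn _ _).obj z) := by
  have key := F.map_lunit (A.fib φ j) Z z
  have hr : ∀ i i' : Fin (A.fib φ j).len, i.val = i'.val →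
      (A.restrict A id φ j i).val = (id i').val := by
    intro i i' e
    obtain rfl := Fin.ext e
    exact congrArg Fin.val (fpos_femb _ _ _ _)
  apply tarr_ext
  refine Eq.trans (tarr_comp_congr ?_ (tarr_comp_congr ?_ ?_)) ((congrArg tarr key).trans ?_)
  · refine MultiCore.tarr_comp (C := D.toMultiCore) (A := (A.fib φ j).map F.ob)
      (B := (A.fib φ j).map F.ob) rfl rfl
      (A.restrict A id φ j) id hr _ _ _ _ _ _ ?_ _ _ rfl
    intro i i' e
    obtain rfl := Fin.ext e
    exact (F.tarr_units A (A.emb φ j i)).trans (F.tarr_units (A.fib φ j) i).symm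
  · refine F.tarr_comp rfl rfl (A.restrict A id φ j) id hr _ _ _ _ ?_ rfl
    intro i i' e
    obtain rfl := Fin.ext e
    exact (MultiCore.tarr_units A (A.emb φ j i)).trans (MultiCore.tarr_units (A.fib φ j) i).symm
  · exact F.tarr_fn (C.tarr_lunitAt A φ j Z z)
  · exact (D.tarr_lunitAt (A.map F.ob) φ j (F.ob Z) _).symm

/-- The compatibility of `F` with the right unitor over the fibre `φ⁻¹ j`. -/
theorem map_runitAt {A B : Word C.Ob} (φ : Fin A.len → Fin B.len) (j : Fin B.len)
    (p : ∀ j, C.Hom (A.fib φ j) (B.col j)) :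
    (D.compAt (A := A.map F.ob) (B := B.map F.ob) φ id j (F.ob (B.col j))).map
        (X := (fun j => (F.fn _ _).obj (p j), D.units (B.map F.ob) j))
        (Y := (fun j => (F.fn _ _).obj (p j), (F.fn _ _).obj (C.units B j)))
        (𝟙 _, (F.units B j).hom) ≫
      (F.compAt φ id j (B.col j)).hom.app (p, C.units B j) ≫
      (F.fn (A.fib φ j) (B.col j)).map ((C.runitAt φ j).hom.app p) =
    (D.runitAt (A := A.map F.ob) (B := B.map F.ob) φ j).hom.app
      (fun j => (F.fn _ _).obj (p j)) := by
  have key := F.map_runit (A.fib φ j) (B.col j) (p j)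
  have hr : ∀ (i i' : Fin (A.fib φ j).len), i.val = i'.val →
      (A.restrict B φ id j i).val = (0 : Fin 1).val := by
    -- Both indices lie in one-element sets, as `id⁻¹ j` is a singleton.
    intro i i' _
    have h : ∀ t : Fin (Fintype.card {i : Fin B.len // id i = j}), t.val = 0 := by
      intro t
      have h1 := t.isLt
      have h2 := Word.card_fib_id j
      omega
    exact h _
  apply tarr_ext
  refine Eq.trans (tarr_comp_congr ?_ (tarr_comp_congr ?_ ?_)) ((congrArg tarr key).trans ?_)
  · refine MultiCore.tarr_comp (C := D.toMultiCore) (A := (A.fib φ j).map F.ob)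
      (B := (B.fib id j).map F.ob) (A' := (A.fib φ j).map F.ob)
      (B' := Word.single (F.ob (B.col j))) rfl
      (congrArg (Word.map F.ob) (Word.fib_id B j))
      (A.restrict B φ id j) (fun _ => (0 : Fin 1)) hr _ _ _ _ _ _ ?_ _ _ (F.tarr_units B j)
    intro i i' _
    exact tarr_idx (C := D.toMultiCore) (A := fun j => (A.fib φ j).map F.ob)
      (Y := fun j => F.ob (B.col j))
      (𝟙 (fun j => (F.fn (A.fib φ j) (B.col j)).obj (p j))) (Word.femb_id j i)
  · refine F.tarr_comp rfl (Word.fib_id B j) (A.restrict B φ id j) (fun _ => (0 : Fin 1)) hr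
      _ _ _ _ ?_ (MultiCore.tarr_units B j)
    intro i i' _
    exact tarr_idx (𝟙 p) (Word.femb_id j i)
  · exact F.tarr_fn (C.tarr_runitAt φ j p)
  · exact (D.tarr_runitAt (A := A.map F.ob) (B := B.map F.ob) φ j
      (fun j => (F.fn (A.fib φ j) (B.col j)).obj (p j))).symm

/-! ### Tensor products over words in the image of `F` -/

open SymWeakMulticategory

/-- `tensor_fst_incl` for words in the image of `F`, with the images of concatenations in place of
the concatenations of images (the two agree by definition). -/
theorem tensor_fst_incl_map {I J L : ℕ} (f : Fin I → Fin L) (g : Fin J → Fin L)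
    (A : Fin I → Word C.Ob) (B : Fin J → Word C.Ob)
    (X : ∀ l, D.EnvHom ((Word.concat fun i : {i // f i = l} => A i).map F.ob)
      ((Word.concat fun j : {j // g j = l} => B j).map F.ob)) (l : Fin L)
    (s : Fin (Word.concat fun i : {i // f i = l} => A i).len) :
    Sigma.fst (β := fun φ : Fin (Word.concat A).len → Fin (Word.concat B).len =>
        ∀ j, D.Hom (((Word.concat A).map F.ob).fib φ j) (((Word.concat B).map F.ob).col j))
      ((D.envTensor f g (fun i => (A i).map F.ob) (fun j => (B j).map F.ob)).obj X)
      (Word.incl f A l s) = Word.incl g B l ((X l).1 s) :=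
  tensor_fst_incl f g (fun i => (A i).map F.ob) (fun j => (B j).map F.ob) X l s

/-- `ecomp_tensor` for words in the image of `F`, with the images of concatenations in place of
the concatenations of images (the two agree by definition). -/
theorem ecomp_tensor_map {I J L : ℕ} (f : Fin I → Fin L) (g : Fin J → Fin L)
    (A : Fin I → Word C.Ob) (B : Fin J → Word C.Ob)
    (X Y : ∀ l, D.EnvHom ((Word.concat fun i : {i // f i = l} => A i).map F.ob)
      ((Word.concat fun j : {j // g j = l} => B j).map F.ob)) (G : X ⟶ Y) (l : Fin L)
    (q : Fin (Word.concat fun j : {j // g j = l} => B j).len) :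
    ecomp (C := D) (A := (Word.concat A).map F.ob) (B := (Word.concat B).map F.ob)
        ((D.envTensor f g (fun i => (A i).map F.ob) (fun j => (B j).map F.ob)).map G)
        (Word.incl g B l q) =
      ecomp (C := D) (G l) q :=
  ecomp_tensor f g (fun i => (A i).map F.ob) (fun j => (B j).map F.ob) X Y G l q

/-! ### The equations of a morphism of biprops -/

-- From here on only the characterizing lemmas of these definitions are needed; unfolding them would
-- make the definitional comparisons below too expensive.
attribute [local irreducible] femb fpos frestr Word.glue Word.incl Word.pr Word.place Word.letters
  Word.emb Word.restrict MultiCore.compAt MultiCore.mu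
  SymWeakMultiData.assocAt SymWeakMultiData.lunitAt SymWeakMultiData.runitAt
  SymWeakMultifunctorData.compAt SymWeakMultifunctorData.units

theorem envelope_comp_assoc (A B G E : Word C.Ob) (x : C.EnvHom A B) (y : C.EnvHom B G)
    (z : C.EnvHom G E) :
    (D.envM (A.map F.ob) (G.map F.ob) (E.map F.ob)).map
        (X := ((D.envM _ _ _).obj ((F.envFn A B).obj x, (F.envFn B G).obj y), (F.envFn G E).obj z))
        (Y := ((F.envFn A G).obj ((C.envM A B G).obj (x, y)), (F.envFn G E).obj z))
        ((F.envComp A B G).hom.app (x, y), 𝟙 _) ≫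
      (F.envComp A G E).hom.app ((C.envM A B G).obj (x, y), z) ≫
      (F.envFn A E).map ((C.envA A B G E).hom.app (x, y, z)) =
    (D.envA (A.map F.ob) (B.map F.ob) (G.map F.ob) (E.map F.ob)).hom.app
        ((F.envFn A B).obj x, (F.envFn B G).obj y, (F.envFn G E).obj z) ≫
      (D.envM (A.map F.ob) (B.map F.ob) (E.map F.ob)).map
        (X := ((F.envFn A B).obj x, (D.envM _ _ _).obj ((F.envFn B G).obj y, (F.envFn G E).obj z)))
        (Y := ((F.envFn A B).obj x, (F.envFn B E).obj ((C.envM B G E).obj (y, z))))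
        (𝟙 _, (F.envComp B G E).hom.app (y, z)) ≫
      (F.envComp A B E).hom.app (x, (C.envM B G E).obj (y, z)) := by
  obtain ⟨φ, p⟩ := x
  obtain ⟨ψ, q⟩ := y
  obtain ⟨ξ, s⟩ := z
  have h := funext fun m => F.map_assocAt φ ψ ξ m (E.col m) p q (s m)
  exact congrArg (fun f => (Sigma.SigmaHom.mk f :
    (⟨ξ ∘ ψ ∘ φ, _⟩ : D.EnvHom (A.map F.ob) (E.map F.ob)) ⟶ ⟨ξ ∘ ψ ∘ φ, _⟩)) h

theorem envelope_comp_r (A B : Word C.Ob) (x : C.EnvHom A B) :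
    (D.envM (A.map F.ob) (B.map F.ob) (B.map F.ob)).map
        (X := ((F.envFn A B).obj x, D.envOne (B.map F.ob)))
        (Y := ((F.envFn A B).obj x, (F.envFn B B).obj (C.envOne B))) (𝟙 _, (F.envUnit B).hom) ≫
      (F.envComp A B B).hom.app (x, C.envOne B) ≫ (F.envFn A B).map ((C.envR A B).hom.app x) =
    (D.envR (A.map F.ob) (B.map F.ob)).hom.app ((F.envFn A B).obj x) := by
  obtain ⟨φ, p⟩ := x
  have h := funext fun j => F.map_runitAt φ j p
  exact congrArg (fun f => (Sigma.SigmaHom.mk f :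
    (⟨φ, _⟩ : D.EnvHom (A.map F.ob) (B.map F.ob)) ⟶ ⟨φ, _⟩)) h

theorem envelope_comp_l (A B : Word C.Ob) (x : C.EnvHom A B) :
    (D.envM (A.map F.ob) (A.map F.ob) (B.map F.ob)).map
        (X := (D.envOne (A.map F.ob), (F.envFn A B).obj x))
        (Y := ((F.envFn A A).obj (C.envOne A), (F.envFn A B).obj x)) ((F.envUnit A).hom, 𝟙 _) ≫
      (F.envComp A A B).hom.app (C.envOne A, x) ≫ (F.envFn A B).map ((C.envL A B).hom.app x) =
    (D.envL (A.map F.ob) (B.map F.ob)).hom.app ((F.envFn A B).obj x) := by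
  obtain ⟨φ, p⟩ := x
  have h := funext fun j => F.map_lunitAt φ j (B.col j) (p j)
  exact congrArg (fun f => (Sigma.SigmaHom.mk f :
    (⟨φ, _⟩ : D.EnvHom (A.map F.ob) (B.map F.ob)) ⟶ ⟨φ, _⟩)) h

theorem ecomp_envFn {A A' B B' : Word C.Ob} {X Y : C.EnvHom A B} {X' Y' : C.EnvHom A' B'}
    (G : X ⟶ Y) (G' : X' ⟶ Y') (j : Fin B.len) (j' : Fin B'.len) (h : ecomp G j = ecomp G' j') :
    ecomp (A := A.map F.ob) (B := B.map F.ob) ((F.envFn A B).map G) j =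
      ecomp (A := A'.map F.ob) (B := B'.map F.ob) ((F.envFn A' B').map G') j' := by
  obtain ⟨φ, x⟩ := X
  obtain ⟨φ', x'⟩ := X'
  obtain ⟨G⟩ := G
  obtain ⟨G'⟩ := G'
  exact F.tarr_fn h

theorem ecomp_envComp {A B E : Word C.Ob} (φ : Fin A.len → Fin B.len) (ψ : Fin B.len → Fin E.len)
    (x : ∀ j, C.Hom (A.fib φ j) (B.col j)) (y : ∀ k, C.Hom (B.fib ψ k) (E.col k)) (q) :
    ecomp (A := A.map F.ob) (B := E.map F.ob) ((F.envComp A B E).hom.app (⟨φ, x⟩, ⟨ψ, y⟩)) q =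
      tarr ((F.compAt φ ψ q (E.col q)).hom.app (x, y q)) :=
  rfl

/-- The value of `F^{φ|}` at a letter of the `l`-th block is the same for the assembled maps and
for their `l`-th parts. -/
theorem tarr_compAt_glue {I J K L : ℕ} (f : Fin I → Fin L) (g : Fin J → Fin L) (h : Fin K → Fin L)
    (A : Fin I → Word C.Ob) (B : Fin J → Word C.Ob) (E : Fin K → Word C.Ob)
    (φ : ∀ l, Fin (Word.concat fun i : {i // f i = l} => A i).len →
      Fin (Word.concat fun j : {j // g j = l} => B j).len)
    (ψ : ∀ l, Fin (Word.concat fun j : {j // g j = l} => B j).len →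
      Fin (Word.concat fun k : {k // h k = l} => E k).len)
    (x : ∀ l j, C.Hom ((Word.concat fun i : {i // f i = l} => A i).fib (φ l) j)
      ((Word.concat fun j : {j // g j = l} => B j).col j))
    (y : ∀ l k, C.Hom ((Word.concat fun j : {j // g j = l} => B j).fib (ψ l) k)
      ((Word.concat fun k : {k // h k = l} => E k).col k)) (l : Fin L) (q) :
    tarr ((F.compAt (φ l) (ψ l) q
        ((Word.concat fun k : {k // h k = l} => E k).col q)).hom.app (x l, y l q)) =
      tarr ((F.compAt (Word.glue f A g B φ) (Word.glue g B h E ψ) (Word.incl h E l q)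
        ((Word.concat E).col (Word.incl h E l q))).hom.app
          ((C.envGlue f g A B φ).obj x, (C.envGlue g h B E ψ).obj y (Word.incl h E l q))) :=
  F.tarr_compAt_cart (A := Word.concat A) (B := Word.concat B)
    (A' := Word.concat fun i : {i // f i = l} => A i)
    (B' := Word.concat fun j : {j // g j = l} => B j)
    (φ' := φ l) (ψ' := ψ l) (x := (C.envGlue f g A B φ).obj x) (x' := x l)
    (z := (C.envGlue g h B E ψ).obj y (Word.incl h E l q)) (z' := y l q)
    (Word.cart_incl f A g B φ l) (Word.cart_incl g B h E ψ l)
    (fun s => (Word.col_incl f A l s).symm) (fun s => (Word.col_incl g B l s).symm) q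
    (fun j => (tarr_id_glue f g A B φ x l j).symm) (tarr_id_glue g h B E ψ y l q).symm

theorem envelope_tensor_fn {I J L : ℕ} (f : Fin I → Fin L) (g : Fin J → Fin L)
    (A : Fin I → Word C.Ob) (B : Fin J → Word C.Ob) :
    C.envTensor f g A B ⋙ F.envFn (Word.concat A) (Word.concat B) =
      Functor.pi (fun l => F.envFn (Word.concat fun i : {i // f i = l} => A i)
          (Word.concat fun j : {j // g j = l} => B j)) ⋙
        D.envTensor f g (fun i => (A i).map F.ob) (fun j => (B j).map F.ob) := by
  refine functor_eq_of_arrow fun X Y G => ?_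
  refine arrow_ext (A := (Word.concat A).map F.ob) (B := (Word.concat B).map F.ob) ?_ ?_
  · intro s
    obtain ⟨l, s, rfl⟩ := Word.incl_surj f A s
    refine (tensor_fst_incl f g A B X l s).trans ?_
    exact (F.tensor_fst_incl_map f g A B (fun l => (F.envFn _ _).obj (X l)) l s).symm
  · intro q
    obtain ⟨l, q, rfl⟩ := Word.incl_surj g B q
    refine Eq.trans ?_ (F.ecomp_tensor_map f g A B (fun l => (F.envFn _ _).obj (X l))
      (fun l => (F.envFn _ _).obj (Y l)) (fun l => (F.envFn _ _).map (G l)) l q).symm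
    exact F.ecomp_envFn _ _ _ _ (ecomp_tensor f g A B X Y G l q)

theorem envelope_tensor_comp {I J K L : ℕ} (f : Fin I → Fin L) (g : Fin J → Fin L)
    (h : Fin K → Fin L)
    (A : Fin I → Word C.Ob) (B : Fin J → Word C.Ob) (E : Fin K → Word C.Ob)
    (x : ∀ l, C.EnvHom (Word.concat fun i : {i // f i = l} => A i)
      (Word.concat fun j : {j // g j = l} => B j))
    (y : ∀ l, C.EnvHom (Word.concat fun j : {j // g j = l} => B j)
      (Word.concat fun k : {k // h k = l} => E k)) :
    Arrow.mk ((F.envComp (Word.concat A) (Word.concat B) (Word.concat E)).hom.app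
        ((C.envTensor f g A B).obj x, (C.envTensor g h B E).obj y)) =
      Arrow.mk ((D.envTensor f h (fun i => (A i).map F.ob) (fun k => (E k).map F.ob)).map
        (X := fun l => (D.envM _ _ _).obj ((F.envFn _ _).obj (x l), (F.envFn _ _).obj (y l)))
        (Y := fun l => (F.envFn _ _).obj ((C.envM _ _ _).obj (x l, y l)))
        (fun l => (F.envComp _ _ _).hom.app (x l, y l))) := by
  refine arrow_ext (A := (Word.concat A).map F.ob) (B := (Word.concat E).map F.ob) ?_ ?_
  · intro s
    obtain ⟨l, s, rfl⟩ := Word.incl_surj f A s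
    refine Eq.trans ?_ (F.tensor_fst_incl_map f h A E
      (fun l => (D.envM _ _ _).obj ((F.envFn _ _).obj (x l), (F.envFn _ _).obj (y l))) l s).symm
    refine (congrArg (Word.glue g B h E fun l => (y l).1)
      (Word.glue_incl f A g B (fun l => (x l).1) l s)).trans ?_
    exact Word.glue_incl g B h E (fun l => (y l).1) l _
  · intro q
    obtain ⟨l, q, rfl⟩ := Word.incl_surj h E q
    refine Eq.trans ?_ (F.ecomp_tensor_map f h A E
      (fun l => (D.envM _ _ _).obj ((F.envFn _ _).obj (x l), (F.envFn _ _).obj (y l)))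
      (fun l => (F.envFn _ _).obj ((C.envM _ _ _).obj (x l, y l)))
      (fun l => (F.envComp _ _ _).hom.app (x l, y l)) l q).symm
    refine (F.ecomp_envComp (Word.glue f A g B fun l => (x l).1)
      (Word.glue g B h E fun l => (y l).1)
      ((C.envGlue f g A B fun l => (x l).1).obj fun l => (x l).2)
      ((C.envGlue g h B E fun l => (y l).1).obj fun l => (y l).2) (Word.incl h E l q)).trans ?_
    refine (F.tarr_compAt_glue f g h A B E (fun l => (x l).1) (fun l => (y l).1)
      (fun l => (x l).2) (fun l => (y l).2) l q).symm.trans ?_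
    exact (F.ecomp_envComp (x l).1 (y l).1 (x l).2 (y l).2 q).symm

attribute [local irreducible] envM envTensor envA envL envR envOne envFn envComp envUnit
  Word.concat Word.fib

theorem envelope_isMorphism : F.envelope.IsMorphism :=
  BipropMorphismData.IsMorphism.mk F.envelope_tensor_fn F.envelope_tensor_comp
    F.envelope_comp_assoc F.envelope_comp_r F.envelope_comp_l

end SymWeakMultifunctor

theorem proposition1p4p1 (C D : SymWeakMulticategory.{v, w, u}) (F : SymWeakMultifunctor C D) :
    F.envelope.IsMorphism := by
  exact F.envelope_isMorphism
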